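/- Let $F$ be a number field with ring of integers $\mathcal O_F$, $\bar X=(\mathrm{Spec}\,\mathcal O_F,X_\infty)$ its Arakelov compactification, and $\bar X_{et}$ the Artin--Verdier étale topos: sheaves on the site of étale $\bar X$-schemes $\bar U=(U,U_\infty)$, where $U$ is étale (separated, of finite type) over $\mathrm{Spec}\,\mathcal O_F$ and $U_\infty\subset U(\mathbb C)/\mathrm{conj}$ is unramified over $X_\infty$. $\bar U$ is connected if $U$ is connected and non-empty; a map $(V,V_\infty)\to(U,U_\infty)$ is finite étale if $V\to U$ is finite and $V_\infty$ is the full preimage of $U_\infty$. Let $\mathcal T$ be the topos of sheaves on locally compact Hausdorff spaces for the open cover topology. Let $\bar X_L$ be a topos satisfying: (1) there is a given connected geometric morphism $\gamma:\bar X_L\to\bar X_{et}$; (2) there is a given connected and locally connected structure map $t:\bar X_L\to\mathcal T$ with a section, $\gamma^*\bar U$ is connected over $\mathcal T$ for every connected étale $\bar X$-scheme $\bar U$, and for every $\mathcal T$-point $p$ of $\bar U_L:=\bar X_L/\gamma^*\bar U$ the fundamental group $\pi_1(\bar U_L,p)$ is pro-representable by a locally compact strict pro-group $G$, i.e. there is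 an equivalence, compatible with $p$, between the classifying topos $B_G$ and the category of internal sums of locally constant objects of $\bar U_L$ over $\mathcal T$. (Strict means that the transition maps have local sections.) Then, for every choice of such pro-representing pro-groups: (a) Let $\bar U$ be connected, $p$ a $\mathcal T$-point of $\bar U_L$ and $q$ the induced geometric point of $\bar U$. The morphism $\bar U_L\to\bar U_{et}$ induces a unique morphism of pro-groups $\varphi_{\bar U}:\pi_1(\bar U_L,p)=(W_\alpha)_\alpha\to\pi_1(\bar U_{et},q)=(G_\beta)_\beta$ (where the $G_\beta$ are the quotients of $\pi_1(\bar U_{et},q)$ by its open normal subgroups), and it has dense image: every continuous homomorphism $W_\alpha\to G_\beta$ representing a component of $\varphi_{\bar U}$ is surjective. (b) Let $\bar V\to\bar U$ be a finite étale map of connected étale $\bar X$-schemes, and let $p'$ be a $\mathcal T$-point of $\bar V_L$ with image isomorphic to the $\mathcal T$-point $p$ of $\bar U_L$. The map $\bar V_L\to\bar U_L$, with a chosen isomorphism from $p$ to the image of $p'$, induces a unique morphism of pro-groups $\pi_1(\bar V_L,p')\to\pi_1(\bar U_L,p)$. Up to isomorphism of pro-objects this is a compatible family of inclusions of closed subgroups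 of finite index $W'_\alpha\hookrightarrow W_\alpha$, with surjective transition maps $W_\alpha\to W_\beta$ inducing bijections $W_\alpha/W'_\alpha\to W_\beta/W'_\beta$. The usual transfer maps $W_\alpha^{ab}\to W_\alpha'^{ab}$ (where $ab$ denotes the maximal Hausdorff abelian quotient) are continuous and compatible with the transition maps, and they define a morphism of abelian topological pro-groups $$\mathrm{tr}:\pi_1(\bar U_L,p)^{ab}\longrightarrow\pi_1(\bar V_L,p')^{ab}$$ which does not depend on the presentation of $\pi_1(\bar V_L,p')\to\pi_1(\bar U_L,p)$ by such a family. (c) If in (b) $\bar V\to\bar U$ is moreover Galois (its automorphism group acts transitively on geometric fibres), then there is such a family with every $W'_\alpha$ normal in $W_\alpha$, and the conjugation actions of $W_\alpha$ on $W_\alpha'^{ab}$ define an action of $\pi_1(\bar U_L,p)$ on $\pi_1(\bar V_L,p')^{ab}$, i.e. a morphism of pro-spaces $$\pi_1(\bar U_L,p)\times\pi_1(\bar V_L,p')^{ab}\longrightarrow\pi_1(\bar V_L,p')^{ab},$$ which is independent of the presentation. -/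

import Mathlib

open CategoryTheory CategoryTheory.Limits Opposite AlgebraicGeometry

namespace Lichtenbaum

universe v u v' u' w

/-! ### Pro-objects -/

/-- A pro-object of `C`: a functor to `C` from a non-empty small cofiltered category
(for any `i`, `j` there are maps `i ← k → j`, and parallel maps are equalized from the left). -/
structure Pro (C : Type u) [Category.{v} C] where
  I : Type 1
  [cat : SmallCategory I]
  [cof : IsCofiltered I]
  F : I ⥤ C

attribute [instance] Pro.cat Pro.cof

namespace Pro

variable {C : Type u} [Category.{v} C] {D : Type u'} [Category.{v'} D]

/-- `colim_i Hom(X_i, c)`. -/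
def To (X : Pro C) (c : C) : Type (max 1 v) :=
  Quot (fun a b : (Σ i : X.I, X.F.obj i ⟶ c) => ∃ s : b.1 ⟶ a.1, b.2 = X.F.map s ≫ a.2)

/-- The class in `colim_i Hom(X_i, c)` of a map `X_i ⟶ c`. -/
def To.mk {X : Pro C} {c : C} (i : X.I) (h : X.F.obj i ⟶ c) : X.To c := Quot.mk _ ⟨i, h⟩

theorem To.ind {X : Pro C} {c : C} {P : X.To c → Prop}
    (h : ∀ i g, P (To.mk i g)) (x : X.To c) : P x := by
  obtain ⟨i, g⟩ := x
  exact h i g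

theorem To.mk_eq {X : Pro C} {c : C} {i k : X.I} (s : k ⟶ i) (h : X.F.obj i ⟶ c) :
    (To.mk k (X.F.map s ≫ h) : X.To c) = To.mk i h :=
  (Quot.sound ⟨s, rfl⟩).symm

/-- Postcomposition with `g : c ⟶ d`. -/
def To.push {X : Pro C} {c d : C} (x : X.To c) (g : c ⟶ d) : X.To d :=
  Quot.lift (fun a => To.mk a.1 (a.2 ≫ g)) (by
    rintro ⟨i, a⟩ ⟨k, b⟩ ⟨s, hs⟩
    dsimp at s hs ⊢
    rw [hs, Category.assoc, To.mk_eq]) x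

@[simp] theorem To.push_mk {X : Pro C} {c d : C} (i : X.I) (h : X.F.obj i ⟶ c) (g : c ⟶ d) :
    (To.mk i h).push g = To.mk i (h ≫ g) := rfl

theorem To.push_push {X : Pro C} {c d e : C} (x : X.To c) (g : c ⟶ d) (h : d ⟶ e) :
    (x.push g).push h = x.push (g ≫ h) := by
  induction x using To.ind with | h i a => simp

/-- `Hom(X, Y) = lim_j colim_i Hom(X_i, Y_j)`. -/
@[ext] structure Hom (X Y : Pro C) where
  val : ∀ j : Y.I, X.To (Y.F.obj j)
  compat : ∀ {j k : Y.I} (s : j ⟶ k), (val j).push (Y.F.map s) = val k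

/-- Precomposition of a germ with a morphism of pro-objects. -/
def Hom.bind {X Y : Pro C} (f : Hom X Y) {c : C} (y : Y.To c) : X.To c :=
  Quot.lift (fun a => (f.val a.1).push a.2) (by
    rintro ⟨i, a⟩ ⟨k, b⟩ ⟨s, hs⟩
    dsimp at s hs ⊢
    rw [hs, ← To.push_push, f.compat]) y

@[simp] theorem Hom.bind_mk {X Y : Pro C} (f : Hom X Y) {c : C} (j : Y.I) (g : Y.F.obj j ⟶ c) :
    f.bind (To.mk j g) = (f.val j).push g := rfl

theorem Hom.bind_push {X Y : Pro C} (f : Hom X Y) {c d : C} (y : Y.To c) (g : c ⟶ d) :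
    f.bind (y.push g) = (f.bind y).push g := by
  induction y using To.ind with | h i a => simp [To.push_push]

instance : Category (Pro C) where
  Hom := Hom
  id X := ⟨fun j => To.mk j (𝟙 _), fun s => by
    simpa using (To.mk_eq s (𝟙 _) : To.mk _ (X.F.map s ≫ 𝟙 _) = _)⟩
  comp f g := ⟨fun k => f.bind (g.val k), fun s => by rw [← Hom.bind_push, g.compat]⟩
  id_comp f := by
    ext j
    dsimp
    generalize f.val j = y
    induction y using To.ind with | h i a => simp
  comp_id f := by
    ext j
    dsimp
    generalize f.val j = y
    induction y using To.ind with | h i a => simp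
  assoc f g h := by
    ext j
    dsimp
    generalize h.val j = y
    induction y using To.ind with | h i a => simp [Hom.bind_push]

/-- The image of a germ under a functor. -/
def To.map (K : C ⥤ D) {X : Pro C} {c : C} (x : X.To c) :
    (Pro.mk X.I (X.F ⋙ K)).To (K.obj c) :=
  Quot.lift (fun a => To.mk (X := Pro.mk X.I (X.F ⋙ K)) a.1 (K.map a.2)) (by
    rintro ⟨i, a⟩ ⟨k, b⟩ ⟨s, hs⟩
    dsimp at s hs ⊢
    rw [hs, K.map_comp]
    exact (To.mk_eq (X := Pro.mk X.I (X.F ⋙ K)) s (K.map a)).symm) x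

theorem To.map_push (K : C ⥤ D) {X : Pro C} {c d : C} (x : X.To c) (g : c ⟶ d) :
    To.map K (x.push g) = (To.map K x).push (K.map g) := by
  induction x using To.ind with
  | h i a => exact congrArg (To.mk (X := Pro.mk X.I (X.F ⋙ K)) i) (K.map_comp a g)

/-- The functor on pro-objects induced by a functor, levelwise on objects. -/
def mapFunctor (K : C ⥤ D) : Pro C ⥤ Pro D where
  obj X := Pro.mk X.I (X.F ⋙ K)
  map f := ⟨fun j => To.map K (f.val j), fun s => by
    rw [← f.compat s, To.map_push]
    rfl⟩
  map_id X := by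
    apply Hom.ext
    funext j
    exact congrArg (To.mk (X := Pro.mk X.I (X.F ⋙ K)) j) (K.map_id _)
  map_comp {X Y Z} f g := by
    apply Hom.ext
    funext j
    change To.map K (f.bind (g.val j)) = Hom.bind _ (To.map K (g.val j))
    generalize g.val j = y
    induction y using To.ind with | h i a => exact To.map_push K _ _

/-- The morphism of pro-objects given by a natural transformation of diagrams with the same index
category. -/
def level {I : Type 1} [SmallCategory I] [IsCofiltered I] {F G : I ⥤ C} (τ : F ⟶ G) :
    Pro.mk I F ⟶ Pro.mk I G :=
  ⟨fun j => To.mk j (τ.app j), fun {j k} s => by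
    change To.mk (X := Pro.mk I F) j (τ.app j ≫ G.map s) = _
    rw [← τ.naturality s]
    exact To.mk_eq (X := Pro.mk I F) s (τ.app k)⟩

end Pro

/-! ### Locally compact groups and pro-groups -/

/-- Locally compact Hausdorff topological groups; morphisms are continuous homomorphisms. -/
structure LCGrp : Type (w + 1) where
  carrier : Type w
  [grp : Group carrier]
  [top : TopologicalSpace carrier]
  [topGrp : IsTopologicalGroup carrier]
  [t2 : T2Space carrier]
  [lc : LocallyCompactSpace carrier]

namespace LCGrp

instance : CoeSort LCGrp.{w} (Type w) := ⟨LCGrp.carrier⟩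

attribute [instance] LCGrp.grp LCGrp.top LCGrp.topGrp LCGrp.t2 LCGrp.lc

instance : Category LCGrp.{w} where
  Hom A B := A →ₜ* B
  id A := ContinuousMonoidHom.id A
  comp f g := ContinuousMonoidHom.comp g f

/-- The continuous homomorphism underlying a morphism. -/
abbrev hom {A B : LCGrp.{w}} (f : A ⟶ B) : A →ₜ* B := f

theorem hom_ext {A B : LCGrp.{w}} {f g : A ⟶ B} (h : ∀ x, hom f x = hom g x) : f = g :=
  ContinuousMonoidHom.ext h

theorem commutator_closure_le {A B : LCGrp.{w}} (f : A ⟶ B) :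
    (commutator A).topologicalClosure ≤
      (commutator B).topologicalClosure.comap (hom f : A →* B) := by
  refine Subgroup.topologicalClosure_minimal _ ?_ ?_
  · rw [← Subgroup.map_le_iff_le_comap]
    refine le_trans ?_ (Subgroup.le_topologicalClosure _)
    rw [commutator_def, commutator_def, Subgroup.map_commutator]
    exact Subgroup.commutator_mono le_top le_top
  · exact (Subgroup.isClosed_topologicalClosure _).preimage (hom f).continuous_toFun

/-- The maximal Hausdorff abelian quotient, i.e. the quotient by the closure of the commutator
subgroup. -/
def ab : LCGrp.{w} ⥤ LCGrp.{w} where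
  obj A :=
    haveI : IsClosed ((commutator A).topologicalClosure : Set A) :=
      Subgroup.isClosed_topologicalClosure _
    LCGrp.mk (TopologicalAbelianization A)
  map {A B} f :=
    { QuotientGroup.map _ _ (hom f : A →* B) (commutator_closure_le f) with
      continuous_toFun := by
        refine continuous_quot_lift _ ?_
        exact continuous_quot_mk.comp (hom f).continuous_toFun }
  map_id A := by
    apply ContinuousMonoidHom.ext
    rintro ⟨x⟩
    rfl
  map_comp f g := by
    apply ContinuousMonoidHom.ext
    rintro ⟨x⟩
    rfl

/-- The underlying topological space. -/
def toTop : LCGrp.{w} ⥤ TopCat.{w} where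
  obj A := TopCat.of A
  map f := TopCat.ofHom ⟨hom f, (hom f).continuous_toFun⟩

/-- The same group in a larger universe. -/
def lift : LCGrp.{0} ⥤ LCGrp.{1} where
  obj A :=
    haveI : LocallyCompactSpace (ULift.{1} A) :=
      Homeomorph.ulift.isClosedEmbedding.locallyCompactSpace
    LCGrp.mk (ULift.{1} A)
  map {A B} f :=
    { toFun := fun x => ULift.up (hom f x.down)
      map_one' := congrArg ULift.up (map_one (hom f))
      map_mul' := fun x y => congrArg ULift.up (map_mul (hom f) x.down y.down)
      continuous_toFun := by
        exact continuous_uliftUp.comp ((hom f).continuous_toFun.comp continuous_uliftDown) }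

/-- A group with the discrete topology. -/
def disc (A : Type w) [Group A] : LCGrp.{w} :=
  letI : TopologicalSpace A := ⊥
  haveI : DiscreteTopology A := ⟨rfl⟩
  LCGrp.mk A

/-- A homomorphism of discrete groups. -/
def discMap {A B : Type w} [Group A] [Group B] (f : A →* B) : disc A ⟶ disc B :=
  letI : TopologicalSpace A := ⊥
  letI : TopologicalSpace B := ⊥
  haveI : DiscreteTopology A := ⟨rfl⟩
  ({ f with continuous_toFun := continuous_of_discreteTopology } : A →ₜ* B)

end LCGrp

/-- A continuous map `f` has local sections: each point of the target has an open neighbourhood on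
which `f` admits a continuous section. -/
def HasLocalSections {X Y : Type w} [TopologicalSpace X] [TopologicalSpace Y] (f : X → Y) : Prop :=
  ∀ y : Y, ∃ V : Set Y, IsOpen V ∧ y ∈ V ∧ ∃ s : Y → X, ContinuousOn s V ∧ ∀ z ∈ V, f (s z) = z

/-- A locally compact topological pro-group is strict if its transition maps have local
sections. -/
def IsStrict (G : Pro LCGrp.{w}) : Prop :=
  ∀ ⦃i j : G.I⦄ (s : i ⟶ j), HasLocalSections (LCGrp.hom (G.F.map s))

/-- The maximal abelian quotient of a pro-group, formed levelwise. -/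
abbrev proAb : Pro LCGrp.{w} ⥤ Pro LCGrp.{w} := Pro.mapFunctor LCGrp.ab

/-- The underlying pro-space of a pro-group. -/
abbrev proTop : Pro LCGrp.{w} ⥤ Pro TopCat.{w} := Pro.mapFunctor LCGrp.toTop

/-! ### The topos of locally compact spaces -/

/-- Locally compact Hausdorff spaces. -/
def isLCH : ObjectProperty TopCat.{0} := fun X => T2Space X ∧ LocallyCompactSpace X

/-- The category of locally compact Hausdorff spaces and continuous maps. -/
abbrev LCH := isLCH.FullSubcategory

/-- The open cover topology. -/
def openCovers : GrothendieckTopology LCH :=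
  (TopCat.precoverage.comap isLCH.ι).toGrothendieck

/-- The topos of sheaves of sets on locally compact spaces for the open cover topology. As the site
is large relative to the universe of the spaces, "sets" are those of the next universe;
this applies to all topoi below. -/
abbrev T := Sheaf openCovers (Type 1)

/-- The one-point space. -/
def pt : LCH := ⟨TopCat.of PUnit, by constructor <;> dsimp <;> infer_instance⟩

/-- Sections of a sheaf over a space. -/
abbrev Sec (S : T) (Z : LCH) : Type 1 := S.obj.obj (op Z)

/-- Restriction of sections. -/
abbrev res (S : T) {Z Z' : LCH} (φ : Z' ⟶ Z) (x : Sec S Z) : Sec S Z' := S.obj.map φ.op x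

/-- The action of a morphism of sheaves on sections. -/
abbrev onSec {S S' : T} (f : S ⟶ S') {Z : LCH} (x : Sec S Z) : Sec S' Z := f.hom.app (op Z) x

/-! ### The classifying topos of a strict pro-group -/

/-- An object of the projective limit of the classifying topoi `B_{G_i}`, for a strict pro-group
`G`. A filtered projective limit of topoi is the pseudo-limit of the underlying categories
along the direct image functors; the direct image along an epimorphism `G_k ⟶ G_i` sends a
`G_k`-object to its subobject of invariants under the kernel, with its induced `G_i`-action. So an
object is a family of `G_i`-objects `X_i` of `T`, with compatible isomorphisms from `X_i` onto the
kernel invariants of `X_k`. The sheaf of groups represented by `G_i` has sections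
`C(Z, G_i)`. -/
structure BObj (G : Pro LCGrp.{0}) where
  X : G.Iᵒᵖ ⥤ T
  act : ∀ (i : G.I) (Z : LCH), C(Z.obj, G.F.obj i) → Sec (X.obj (op i)) Z → Sec (X.obj (op i)) Z
  act_one : ∀ i Z x, act i Z 1 x = x
  act_mul : ∀ i Z g h x, act i Z (g * h) x = act i Z g (act i Z h x)
  act_res : ∀ i {Z Z' : LCH} (φ : Z' ⟶ Z) (g : C(Z.obj, G.F.obj i)) x,
    res _ φ (act i Z g x) = act i Z' (g.comp φ.hom.hom) (res _ φ x)
  act_trans : ∀ {k i : G.I} (s : k ⟶ i) Z (g : C(Z.obj, G.F.obj k)) x,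
    onSec (X.map s.op) (act i Z ((LCGrp.hom (G.F.map s) : C(_, _)).comp g) x) =
      act k Z g (onSec (X.map s.op) x)
  invariants : ∀ {k i : G.I} (s : k ⟶ i) (Z : LCH) (y : Sec (X.obj (op k)) Z),
    (∀ (Z' : LCH) (φ : Z' ⟶ Z) (n : C(Z'.obj, G.F.obj k)),
      (∀ z, LCGrp.hom (G.F.map s) (n z) = 1) → act k Z' n (res _ φ y) = res _ φ y) →
    ∃! x : Sec (X.obj (op i)) Z, onSec (X.map s.op) x = y

namespace BObj

variable {G : Pro LCGrp.{0}}

/-- Morphisms: compatible families of equivariant maps. -/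
@[ext] structure Hom (X Y : BObj G) where
  app : X.X ⟶ Y.X
  equivariant : ∀ i Z g x, onSec (app.app (op i)) (X.act i Z g x) =
    Y.act i Z g (onSec (app.app (op i)) x)

instance : Category (BObj G) where
  Hom := Hom
  id X := ⟨𝟙 _, fun _ _ _ _ => rfl⟩
  comp {X _ _} f g := ⟨f.app ≫ g.app, fun i Z a x => by
    change onSec (g.app.app (op i)) (onSec (f.app.app (op i)) (X.act i Z a x)) = _
    rw [f.equivariant, g.equivariant]
    rfl⟩

/-- The inverse image of the canonical point of the classifying topos: the underlying object
`colim X_i`. -/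
noncomputable def forget (G : Pro LCGrp.{0}) : BObj G ⥤ T where
  obj X := colimit X.X
  map f := colimMap (Hom.app f)
  map_id X := by
    apply colimit.hom_ext
    intro j
    rw [ι_colimMap, Category.comp_id]
    exact Category.id_comp _
  map_comp f g := by
    apply colimit.hom_ext
    intro j
    rw [ι_colimMap, ← Category.assoc, ι_colimMap, Category.assoc, ι_colimMap, ← Category.assoc]
    rfl

/-- The inclusion `X_i ⟶ colim X_i` on sections. -/
noncomputable abbrev incl (X : BObj G) (i : G.I) {Z : LCH} (x : Sec (X.X.obj (op i)) Z) :
    Sec ((forget G).obj X) Z :=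
  onSec (colimit.ι X.X (op i)) x

end BObj

/-! ### Topoi and geometric morphisms -/

/-- Grothendieck topoi. -/
class IsTopos (E : Type u) [Category.{1} E] : Prop where
  exists_site : ∃ (C : Type 1) (_ : SmallCategory C) (J : GrothendieckTopology C),
    Nonempty (E ≌ Sheaf J (Type 1))

instance (E : Type u) [Category.{1} E] [IsTopos E] : HasFiniteLimits E := by
  obtain ⟨C, _, J, ⟨e⟩⟩ := IsTopos.exists_site (E := E)
  exact ⟨fun _ _ _ => Adjunction.hasLimitsOfShape_of_equivalence e.functor⟩

/-- A geometric morphism `E ⟶ S`. -/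
structure GeomMorphism (E : Type u) [Category.{v} E] (S : Type u') [Category.{v'} S] where
  inv : S ⥤ E
  dir : E ⥤ S
  adj : inv ⊣ dir
  lex : PreservesFiniteLimits inv

section OverT

variable {E : Type u} [Category.{1} E]

/-- A `T`-point of a topos over `T` (given by the inverse image `t` of its structure map): a
geometric morphism from `T`, given by its inverse image, which is a section of the structure
map. -/
structure TPoint (t : T ⥤ E) where
  inv : E ⥤ T
  isLeftAdjoint : inv.IsLeftAdjoint
  lex : PreservesFiniteLimits inv
  sec : t ⋙ inv ≅ 𝟭 T

/-- Internal sums of locally constant objects: `X` has a map to some `t J`, relative to which it is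
locally constant over `T / J`. That is, there are an epimorphism `U ⟶ t J`, an object `S` over
`J`, and an isomorphism between `X ×_{t J} U` and `t S ×_{t J} U` over `U`. For `J` the final
object this says that `X` is locally constant. -/
def SLC (t : T ⥤ E) : ObjectProperty E := fun X =>
  ∃ (J : T) (g : X ⟶ t.obj J) (U : E) (c : U ⟶ t.obj J) (S : T) (h : S ⟶ J)
    (P : E) (a : P ⟶ X) (b : P ⟶ U) (a' : P ⟶ t.obj S),
    Epi c ∧ IsPullback a b g c ∧ IsPullback a' b (t.map h) c

/-- A locally compact strict pro-group which pro-represents the fundamental group at the point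
`p`: an equivalence from its classifying topos to the topos of sums of locally constant objects,
compatible with the point. -/
structure PiOne (t : T ⥤ E) (p : TPoint t) where
  G : Pro LCGrp.{0}
  strict : IsStrict G
  equiv : BObj G ≌ (SLC t).FullSubcategory
  fiber : equiv.functor ⋙ (SLC t).ι ⋙ p.inv ≅ BObj.forget G

namespace PiOne

variable {t : T ⥤ E} {p : TPoint t}

/-- The object of the topos given by an object of the classifying topos. -/
abbrev obj (R : PiOne t p) (Y : BObj R.G) : E := (R.equiv.functor.obj Y).obj

/-- A morphism of topoi `E' ⟶ E` over `T` with inverse image `f`, mapping the point `p'` to `p` by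
the isomorphism `κ`, induces `φ` on fundamental groups: for each sum of locally constant objects
`R.obj Y` of `E`, the fundamental group of `E'` acts on the fibre of `f (R.obj Y)` at `p'`, which
is the fibre of `R.obj Y` at `p`, via `φ`. -/
def Induces (R : PiOne t p) {E' : Type u'} [Category.{1} E'] {t' : T ⥤ E'} {p' : TPoint t'}
    (R' : PiOne t' p') (f : E ⥤ E') (κ : p.inv ≅ f ⋙ p'.inv) (φ : R'.G ⟶ R.G) : Prop :=
  ∀ (Y : BObj R.G) (Y' : BObj R'.G) (e : f.obj (R.obj Y) ≅ R'.obj Y'),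
    let θ : (BObj.forget R.G).obj Y ⟶ (BObj.forget R'.G).obj Y' :=
      R.fiber.inv.app Y ≫ κ.hom.app (R.obj Y) ≫ p'.inv.map e.hom ≫ R'.fiber.hom.app Y'
    ∀ (i : R.G.I) (k : R'.G.I) (h : R'.G.F.obj k ⟶ R.G.F.obj i), φ.val i = Pro.To.mk k h →
      ∀ (l : R'.G.I) (s : l ⟶ k) (Z : LCH) (y : Sec (Y.X.obj (op i)) Z)
        (y' : Sec (Y'.X.obj (op l)) Z), onSec θ (Y.incl i y) = Y'.incl l y' →
        ∀ g : C(Z.obj, R'.G.F.obj l),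
          onSec θ (Y.incl i (Y.act i Z
            ((LCGrp.hom (R'.G.F.map s ≫ h) : C(R'.G.F.obj l, R.G.F.obj i)).comp g) y)) =
          Y'.incl l (Y'.act l Z g y')

end PiOne

end OverT

/-! ### The Artin–Verdier étale topos -/

section Etale

/-- Complex conjugation on `Spec ℂ`. -/
noncomputable def conj : Spec (CommRingCat.of ℂ) ⟶ Spec (CommRingCat.of ℂ) :=
  Spec.map (CommRingCat.ofHom (starRingEnd ℂ))

variable (F : Type) [Field F]

/-- Étale schemes over the Arakelov compactification of `Spec 𝓞_F`: an étale scheme `U` over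
`Spec 𝓞_F` (separated, of finite type) and a set of archimedean points of `U`, i.e. complex points
up to conjugation (given as a conjugation-stable set of complex points), such that points over
real points are real. -/
structure EtSch where
  U : Scheme.{0}
  str : U ⟶ Spec (CommRingCat.of (NumberField.RingOfIntegers F))
  etale : Etale str
  separated : IsSeparated str
  quasiCompact : QuasiCompact str
  inf : Set (Spec (CommRingCat.of ℂ) ⟶ U)
  conj_mem : ∀ y ∈ inf, conj ≫ y ∈ inf
  unramified : ∀ y ∈ inf, conj ≫ y ≫ str = y ≫ str → conj ≫ y = y

variable {F}

namespace EtSch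

/-- Morphisms over the compactification. -/
@[ext] structure Hom (V U : EtSch F) where
  map : V.U ⟶ U.U
  comp_str : map ≫ U.str = V.str
  map_inf : ∀ y ∈ V.inf, y ≫ map ∈ U.inf

instance : Category (EtSch F) where
  Hom := Hom
  id U := ⟨𝟙 _, Category.id_comp _, fun y hy => by rwa [Category.comp_id]⟩
  comp f g := ⟨f.map ≫ g.map, by rw [Category.assoc, g.comp_str, f.comp_str], fun y hy => by
    rw [← Category.assoc]
    exact g.map_inf _ (f.map_inf _ hy)⟩

/-- The underlying morphism of schemes. -/
abbrev hom {V U : EtSch F} (f : V ⟶ U) : V.U ⟶ U.U := Hom.map f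

/-- Coverings: families which are jointly surjective on points and on archimedean points. -/
def coverings : Precoverage (EtSch F) where
  coverings U := {R |
    (∀ x : U.U, ∃ (V : EtSch F) (f : V ⟶ U), R f ∧ ∃ z : V.U, hom f z = x) ∧
    (∀ y ∈ U.inf, ∃ (V : EtSch F) (f : V ⟶ U), R f ∧ ∃ z ∈ V.inf, z ≫ hom f = y)}

/-- The scheme is connected (in particular non-empty). -/
def Connected (U : EtSch F) : Prop := ConnectedSpace U.U

/-- Finite étale maps: finite, and with all archimedean points over those of the target. -/
def IsFiniteEtale {V U : EtSch F} (f : V ⟶ U) : Prop :=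
  IsFinite (hom f) ∧ ∀ y : Spec (CommRingCat.of ℂ) ⟶ V.U, y ≫ hom f ∈ U.inf → y ∈ V.inf

/-- A finite étale map (of connected objects) is Galois if its automorphisms act transitively on
the fibres over complex points. (Complex points of étale `𝓞_F`-schemes lie over the generic point,
so these are geometric generic fibres.) -/
def IsGalois {V U : EtSch F} (f : V ⟶ U) : Prop :=
  IsFiniteEtale f ∧ ∀ x y : Spec (CommRingCat.of ℂ) ⟶ V.U, x ≫ hom f = y ≫ hom f →
    ∃ σ : V ≅ V, σ.hom ≫ f = f ∧ x ≫ hom σ.hom = y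

/-- The category of finite étale covers. -/
abbrev FinEt (U : EtSch F) := ObjectProperty.FullSubcategory
  (fun V : Over U => IsFiniteEtale V.hom)

end EtSch

variable (F)

/-- The Artin–Verdier étale topos. -/
abbrev EtTopos := Sheaf (EtSch.coverings (F := F)).toGrothendieck (Type 1)

/-- The sheaf represented by an étale scheme. -/
noncomputable def yo : EtSch F ⥤ EtTopos F := uliftYoneda.{1} ⋙ presheafToSheaf _ (Type 1)

end Etale

/-! ### The étale fundamental group -/

section EtalePiOne

variable {C : Type 1} [Category.{0} C] (q : C ⥤ Type 1)

/-- The automorphism group of a fibre functor. -/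
def AutFib := Aut q

noncomputable instance : Group (AutFib q) := inferInstanceAs (Group (Aut q))

/-- The permutation of a fibre. -/
def AutFib.perm {q : C ⥤ Type 1} (σ : AutFib q) (V : C) (x : q.obj V) : q.obj V :=
  (Iso.hom σ).app V x

/-- The coarsest topology for which the actions on all fibres are continuous, for the discrete
topology on the permutations of a (finite) fibre. -/
instance : TopologicalSpace (AutFib q) :=
  ⨅ V : C, TopologicalSpace.induced (fun σ : AutFib q => σ.perm V) ⊥

/-- Open normal subgroups. -/
@[ext] structure OpenNormal where
  N : Subgroup (AutFib q)
  normal : N.Normal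
  isOpen : IsOpen (N : Set (AutFib q))

noncomputable instance : PartialOrder (OpenNormal q) := PartialOrder.lift OpenNormal.N (fun _ _ => OpenNormal.ext)

instance : IsCofiltered (OpenNormal q) where
  nonempty := ⟨⟨⊤, inferInstance, isOpen_univ⟩⟩
  cone_objs A B := ⟨⟨A.N ⊓ B.N, (haveI := A.normal; haveI := B.normal; inferInstance),
    A.isOpen.inter B.isOpen⟩, homOfLE (inf_le_left : A.N ⊓ B.N ≤ A.N),
    homOfLE (inf_le_right : A.N ⊓ B.N ≤ B.N), trivial⟩
  cone_maps A _ _ _ := ⟨A, 𝟙 A, Subsingleton.elim _ _⟩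

instance (A : OpenNormal q) : A.N.Normal := A.normal

/-- The quotient by an open normal subgroup, as a discrete group. -/
noncomputable def OpenNormal.quot (A : OpenNormal q) : LCGrp.{1} := LCGrp.disc (AutFib q ⧸ A.N)

/-- The class of an automorphism. -/
noncomputable def OpenNormal.cls (A : OpenNormal q) (σ : AutFib q) : A.quot := (QuotientGroup.mk σ : AutFib q ⧸ A.N)

/-- The étale fundamental group as a projective system of finite groups: the quotients of the
automorphism group of the fibre functor by open normal subgroups. -/
noncomputable def etPiOne : Pro LCGrp.{1} where
  I := OpenNormal q
  F :=
    { obj := fun A => A.quot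
      map := fun {A B} s => LCGrp.discMap (QuotientGroup.map A.N B.N (MonoidHom.id _) (leOfHom s))
      map_id := fun A => by
        apply LCGrp.hom_ext
        rintro ⟨x⟩
        rfl
      map_comp := fun f g => by
        apply LCGrp.hom_ext
        rintro ⟨x⟩
        rfl }

end EtalePiOne

/-- A morphism `(W_α) ⟶ (G_β)` of pro-groups has dense image if all the maps `W_α ⟶ G_β`
representing it are surjective. -/
def HasDenseImage {W G : Pro LCGrp.{w}} (φ : W ⟶ G) : Prop :=
  ∀ (β : G.I) (α : W.I) (h : W.F.obj α ⟶ G.F.obj β), φ.val β = Pro.To.mk α h →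
    Function.Surjective (LCGrp.hom h)

/-! ### Topoi over the étale topos -/

/-- A topos `E` with a connected morphism `gamma` to the Artin–Verdier étale topos and a connected
and locally connected structure map `t` to `T` which has a section; the inverse image of each
connected étale scheme is connected over `T`, and the fundamental groups of its slice are
pro-representable by locally compact strict pro-groups. Connected means that the inverse image is
fully faithful; locally connected means that the inverse image has a left adjoint which is
indexed over `T`, i.e. satisfies the Beck–Chevalley condition. -/
structure LichtenbaumTopos (F : Type) [Field F] where
  E : Type u
  [cat : Category.{1} E]
  [isTopos : IsTopos E]
  gamma : GeomMorphism E (EtTopos F)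
  gamma_full : gamma.inv.Full
  gamma_faithful : gamma.inv.Faithful
  t : GeomMorphism E T
  t_full : t.inv.Full
  t_faithful : t.inv.Faithful
  tSh : E ⥤ T
  tAdj : tSh ⊣ t.inv
  beckChevalley : ∀ {A B : T} {X P : E} (h : A ⟶ B) (g : X ⟶ t.inv.obj B) (a : P ⟶ X)
    (b : P ⟶ t.inv.obj A), IsPullback a b g (t.inv.map h) →
      IsPullback (tSh.map a) ((tAdj.homEquiv _ _).symm b) ((tAdj.homEquiv _ _).symm g) h
  point : Nonempty (TPoint t.inv)
  connected : ∀ U : EtSch F, U.Connected →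
    Nonempty (IsTerminal (tSh.obj (gamma.inv.obj ((yo F).obj U))))
  proRepresentable : ∀ U : EtSch F, U.Connected →
    ∀ p : TPoint (t.inv ⋙ Over.star (gamma.inv.obj ((yo F).obj U))), Nonempty (PiOne _ p)

namespace LichtenbaumTopos

attribute [instance] LichtenbaumTopos.cat LichtenbaumTopos.isTopos

variable {F : Type} [Field F] (L : LichtenbaumTopos.{u} F)

/-- The inverse image in `E` of an étale scheme. -/
noncomputable abbrev et : EtSch F ⥤ L.E := yo F ⋙ L.gamma.inv

/-- The slice topos `U_L`. -/
abbrev slice (U : EtSch F) := Over (L.et.obj U)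

/-- The inverse image of the structure map `U_L ⟶ T`. -/
noncomputable abbrev str (U : EtSch F) : T ⥤ L.slice U := L.t.inv ⋙ Over.star (L.et.obj U)

/-- The inverse image of the morphism `V_L ⟶ U_L`. -/
noncomputable abbrev pull {V U : EtSch F} (f : V ⟶ U) : L.slice U ⥤ L.slice V :=
  Over.pullback (L.et.map f)

/-- The inverse image in `U_L` of finite étale covers of `U`. -/
noncomputable abbrev cover (U : EtSch F) : U.FinEt ⥤ L.slice U :=
  ObjectProperty.ι _ ⋙ Over.post L.et

/-- The fibre functor on finite étale covers at the geometric point of `U` defined by a `T`-point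
of `U_L`: pull back to `T` and then to the canonical point of `T`. -/
noncomputable def fib {U : EtSch F} (p : TPoint (L.str U)) : U.FinEt ⥤ Type 1 :=
  L.cover U ⋙ p.inv ⋙ (sheafSections openCovers (Type 1)).obj (op pt)

/-- The morphism `U_L ⟶ U_et` induces `φ` on fundamental groups: if the inverse image of a finite
étale cover `V` of `U` corresponds to `Y`, then the fundamental group of `U_L` acts on the fibre
of `V` via `φ`. -/
def InducesEt {U : EtSch F} {p : TPoint (L.str U)} (R : PiOne (L.str U) p)
    (φ : (Pro.mapFunctor LCGrp.lift).obj R.G ⟶ etPiOne (L.fib p)) : Prop :=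
  ∀ (V : U.FinEt) (Y : BObj R.G) (e : R.obj Y ≅ (L.cover U).obj V),
    let θ : (BObj.forget R.G).obj Y ⟶ p.inv.obj ((L.cover U).obj V) :=
      R.fiber.inv.app Y ≫ p.inv.map e.hom
    ∀ N : OpenNormal (L.fib p), (∀ σ ∈ N.N, ∀ x, σ.perm V x = x) →
      ∀ (i : R.G.I) (h : LCGrp.lift.obj (R.G.F.obj i) ⟶ N.quot),
        φ.val N = Pro.To.mk (X := (Pro.mapFunctor LCGrp.lift).obj R.G) i h →
        ∀ (l : R.G.I) (s : l ⟶ i) (y : Sec (Y.X.obj (op l)) pt) (g : R.G.F.obj l)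
          (σ : AutFib (L.fib p)),
          LCGrp.hom (LCGrp.lift.map (R.G.F.map s) ≫ h) (ULift.up g) = N.cls _ σ →
          onSec θ (Y.incl l (Y.act l pt (ContinuousMap.const _ g) y)) =
            σ.perm V (onSec θ (Y.incl l y))

end LichtenbaumTopos

/-! ### Transfer and conjugation for finite index inclusions of pro-groups -/

/-- A morphism of locally compact strict pro-groups written as a compatible family of inclusions of
closed subgroups `S_α ⊆ H_α` of finite index. The condition that `S_α` is the preimage of `S_β`
says that the (surjective) transition map `H_α ⟶ H_β` induces a bijection
`H_α / S_α ⟶ H_β / S_β`. -/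
structure FinIndexSystem where
  A : Type 1
  [cat : SmallCategory A]
  [cof : IsCofiltered A]
  H : A ⥤ LCGrp.{0}
  strict : IsStrict (Pro.mk A H)
  S : ∀ α, Subgroup (H.obj α)
  closed : ∀ α, IsClosed (S α : Set (H.obj α))
  finiteIndex : ∀ α, (S α).FiniteIndex
  comap : ∀ {α β : A} (s : α ⟶ β), (S β).comap (LCGrp.hom (H.map s) : H.obj α →* H.obj β) = S α

namespace FinIndexSystem

attribute [instance] cat cof finiteIndex

variable (P : FinIndexSystem)

/-- The group `S_α`. -/
def subObj (α : P.A) : LCGrp.{0} :=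
  haveI : LocallyCompactSpace (P.S α) :=
    (P.closed α).isClosedEmbedding_subtypeVal.locallyCompactSpace
  LCGrp.mk (P.S α)

/-- The restriction of a transition map. -/
def subMap {α β : P.A} (s : α ⟶ β) : P.subObj α ⟶ P.subObj β :=
  ({ toFun := fun x => ⟨LCGrp.hom (P.H.map s) x, (P.comap s).ge x.2⟩
     map_one' := Subtype.ext (map_one (LCGrp.hom (P.H.map s)))
     map_mul' := fun x y => Subtype.ext (map_mul (LCGrp.hom (P.H.map s)) x.1 y.1)
     continuous_toFun := by
       exact ((LCGrp.hom (P.H.map s)).continuous_toFun.comp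
        continuous_subtype_val).subtype_mk _ } : P.S α →ₜ* P.S β)

/-- The diagram of the groups `S_α`. -/
def sub : P.A ⥤ LCGrp.{0} where
  obj α := P.subObj α
  map s := P.subMap s
  map_id α := by
    apply LCGrp.hom_ext
    intro x
    exact Subtype.ext (DFunLike.congr_fun (congrArg LCGrp.hom (P.H.map_id α)) x.1)
  map_comp f g := by
    apply LCGrp.hom_ext
    intro x
    exact Subtype.ext (DFunLike.congr_fun (congrArg LCGrp.hom (P.H.map_comp f g)) x.1)

/-- The inclusions `S_α ⟶ H_α`. -/
def incl : P.sub ⟶ P.H where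
  app α := ({ (P.S α).subtype with continuous_toFun := continuous_subtype_val } :
    P.S α →ₜ* P.H.obj α)

/-- The class of `x ∈ S_α` in the maximal abelian quotient. -/
def clsS (α : P.A) : P.S α →* TopologicalAbelianization (P.S α) := QuotientGroup.mk' _

/-- `τ` is given at each level by the transfer `H_α^ab ⟶ S_α^ab`. -/
def IsTransfer (τ : P.H ⋙ LCGrp.ab ⟶ P.sub ⋙ LCGrp.ab) : Prop :=
  ∀ (α : P.A) (x : P.H.obj α),
    LCGrp.hom (τ.app α) (QuotientGroup.mk x : TopologicalAbelianization (P.H.obj α)) =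
      (MonoidHom.transfer (P.clsS α) x : TopologicalAbelianization (P.S α))

end FinIndexSystem

/-- The product of two pro-spaces. -/
def Pro.prod (X Y : Pro TopCat.{0}) : Pro TopCat.{0} where
  I := X.I × Y.I
  F :=
    { obj := fun a => TopCat.of (X.F.obj a.1 × Y.F.obj a.2)
      map := fun s => TopCat.ofHom ((X.F.map s.1).hom.prodMap (Y.F.map s.2).hom) }

theorem Pro.To.pair_aux {X Y : Pro TopCat.{0}} {c d : TopCat.{0}} {i i' : X.I} {k k' : Y.I}
    (s : i' ⟶ i) (t : k' ⟶ k) (a : X.F.obj i ⟶ c) (b : Y.F.obj k ⟶ d) :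
    Pro.To.mk (X := X.prod Y) (i', k')
        (TopCat.ofHom ((X.F.map s ≫ a).hom.prodMap (Y.F.map t ≫ b).hom)) =
      Pro.To.mk (X := X.prod Y) (i, k) (TopCat.ofHom (a.hom.prodMap b.hom)) :=
  Pro.To.mk_eq (X := X.prod Y) (i := (i, k)) (k := (i', k')) (s, t)
    (TopCat.ofHom (a.hom.prodMap b.hom))

/-- The product of two germs of maps. -/
def Pro.To.pair {X Y : Pro TopCat.{0}} {c d : TopCat.{0}} (x : X.To c) (y : Y.To d) :
    (X.prod Y).To (TopCat.of (c × d)) :=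
  Quot.lift₂ (fun a b => Pro.To.mk (X := X.prod Y) (a.1, b.1)
      (TopCat.ofHom (a.2.hom.prodMap b.2.hom)))
    (by
      rintro ⟨i, a⟩ ⟨k, b⟩ ⟨l, c⟩ ⟨s, hs⟩
      dsimp at s hs
      subst hs
      have h := Pro.To.pair_aux (𝟙 i) s a b
      rw [X.F.map_id, Category.id_comp] at h
      exact h.symm)
    (by
      rintro ⟨i, a⟩ ⟨l, c⟩ ⟨k, b⟩ ⟨s, hs⟩
      dsimp at s hs
      subst hs
      have h := Pro.To.pair_aux s (𝟙 k) a b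
      rw [Y.F.map_id, Category.id_comp] at h
      exact h.symm) x y

/-- The product of two morphisms of pro-spaces. -/
def Pro.prodMap {X X' Y Y' : Pro TopCat.{0}} (f : X ⟶ X') (g : Y ⟶ Y') :
    X.prod Y ⟶ X'.prod Y' :=
  ⟨fun a => Pro.To.pair (f.val a.1) (g.val a.2), fun {a b} s => by
    rw [← f.compat s.1, ← g.compat s.2]
    generalize f.val a.1 = x
    generalize g.val a.2 = y
    induction x using Pro.To.ind with | h i x =>
    induction y using Pro.To.ind with | h k y => rfl⟩

namespace FinIndexSystem

variable (P : FinIndexSystem)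

/-- The pro-group `(H_α)`. -/
abbrev proH : Pro LCGrp.{0} := Pro.mk P.A P.H

/-- The pro-group `(S_α)`. -/
abbrev proS : Pro LCGrp.{0} := Pro.mk P.A P.sub

/-- For `S_α` normal in `H_α`, the morphism `c` is given at each level by the conjugation action
`(h, [x]) ↦ [h x h⁻¹]` of `H_α` on `S_α^ab`. -/
def IsConj (normal : ∀ α, (P.S α).Normal)
    (c : (proTop.obj P.proH).prod (proTop.obj (proAb.obj P.proS)) ⟶
      proTop.obj (proAb.obj P.proS)) : Prop :=
  ∀ α : P.A, ∃ m : C(P.H.obj α × TopologicalAbelianization (P.S α),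
      TopologicalAbelianization (P.S α)),
    (∀ (h : P.H.obj α) (x : P.S α),
      m (h, P.clsS α x) = P.clsS α ⟨h * x * h⁻¹, (normal α).conj_mem x x.2 h⟩) ∧
    c.val α = Pro.To.mk (X := (proTop.obj P.proH).prod (proTop.obj (proAb.obj P.proS))) (α, α)
      (TopCat.ofHom m)

end FinIndexSystem

/-- A presentation of a morphism of pro-groups as a compatible family of inclusions of closed
subgroups of finite index. -/
structure FinIndexPresentation {G' G : Pro LCGrp.{0}} (f : G' ⟶ G) extends FinIndexSystem where
  isoH : toFinIndexSystem.proH ≅ G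
  isoS : toFinIndexSystem.proS ≅ G'
  comm : isoS.hom ≫ f = Pro.level toFinIndexSystem.incl ≫ isoH.hom

/-- `tr : G^ab ⟶ G'^ab` is given, in some presentation of `f : G' ⟶ G` as a family of inclusions
of closed subgroups of finite index, by the transfer maps at all levels. -/
def IsTransfer {G' G : Pro LCGrp.{0}} (f : G' ⟶ G) (tr : proAb.obj G ⟶ proAb.obj G') : Prop :=
  ∃ (P : FinIndexPresentation f) (τ : P.H ⋙ LCGrp.ab ⟶ P.sub ⋙ LCGrp.ab),
    P.toFinIndexSystem.IsTransfer τ ∧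
      proAb.map P.isoH.hom ≫ tr =
        (Pro.level τ : proAb.obj P.proH ⟶ proAb.obj P.proS) ≫ proAb.map P.isoS.hom

/-- `c : G × G'^ab ⟶ G'^ab` is given, in some presentation of `f : G' ⟶ G` as a family of
inclusions of closed normal subgroups of finite index, by the conjugation actions at all levels. -/
def IsConjugationAction {G' G : Pro LCGrp.{0}} (f : G' ⟶ G)
    (c : (proTop.obj G).prod (proTop.obj (proAb.obj G')) ⟶ proTop.obj (proAb.obj G')) : Prop :=
  ∃ (P : FinIndexPresentation f) (normal : ∀ α, (P.S α).Normal)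
    (c' : (proTop.obj P.proH).prod (proTop.obj (proAb.obj P.proS)) ⟶
      proTop.obj (proAb.obj P.proS)),
    P.IsConj normal c' ∧
      Pro.prodMap (proTop.map P.isoH.hom) (proTop.map (proAb.map P.isoS.hom)) ≫ c =
        c' ≫ proTop.map (proAb.map P.isoS.hom)

end Lichtenbaum

universe u

open Lichtenbaum

/-! A pro-group that pro-represents a fundamental group is recovered from its action on fibres, and
the morphisms into such pro-groups come from one reconstruction principle,
`ProAction.existsUnique_realizes`: a natural action of `H`, compatible between levels, on the
sheaves underlying the objects of `B_G` comes from a unique morphism `H ⟶ G`. Indeed, letting `H_l`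
act on the generator of the torsor `G_i` gives a continuous map `H_l → G_i`. It is a homomorphism
because right translations are endomorphisms of the torsor, and it governs every object because
every section is the image of a universal section of a free object under an orbit map. Actions are
partial, since an element of level `l` acts only on sections already defined at level `l`;
strictness provides the local lifts of group-valued maps needed to change levels.

The geometric input is that a finite étale map is split by a finite étale covering
(`IsFiniteEtale.exists_split`): disjoint sections are added one at a time, and their number is
bounded by the number of complex points in a fibre. Consequently finite étale covers of `U` become
sums of locally constant objects of `U_L`, their fibres at a `T`-point are finite constant sheaves
(`isFinConst_stalk`), and, for `f : V ⟶ U` finite étale, the functor `f_!` (composition with `f`)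
preserves sums of locally constant objects, as `f^*` does for any `f`.

For (a), the pro-group acts on the finite fibres of all finite étale covers. An element of one level
lifts to an automorphism of the whole fibre functor by a limit along an ultrafilter of levels, and
stabilizers are open; this gives the morphism to the finite quotients. It is unique because the
kernels of the action on finitely many fibres are cofinal among the open normal subgroups. For
density, finitely many points of fibres come from one point of a connected cover `W`. The
characteristic function of an orbit in the fibre of `W` is invariant, hence is a morphism from `W`
to the inverse image of the sheaf of locally constant truth values; since `W` is connected over `T`
it is constant, so the action is transitive.

For (b), reconstruction applied to `f^*` gives `ψ : G' ⟶ G`. The point `p'` singles out a base point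
in the fibre of `V` at `p`, and the stabilizers of this base point are open subgroups `S_α` of
finite index. The fibre of `X` at `p'` is the part of the fibre of `f_! X` at `p` over the base
point, so the `S_α` act on it, and reconstruction gives `χ : (S_α) ⟶ G'`. Conversely `ψ` factors
through `(S_α)` because the base point is fixed by `G'`. That the two morphisms are mutually inverse
is checked on torsors, with the unit and counit of `f_! ⊣ f^*` (`exists_presentation`).

The transfer and the conjugation action are natural for surjections under which the subgroup
upstairs is the preimage of the one downstairs. Transition maps are of this kind, and so are the
components of an isomorphism between two presentations (`exists_compare`); this gives both existence
and independence of the presentation. In the Galois case automorphisms of `V` act transitively on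
the fibre and commute with `G`, so the stabilizers are normal. -/

namespace Lichtenbaum

universe v u₁ w

/-! ### Germs of maps and restriction of the index category of a pro-object -/

namespace Pro

variable {C : Type u₁} [Category.{v} C]

/-- The index category is cofiltered, so having a common refinement on which two germs agree is
already transitive and contains the generated equivalence relation. -/
theorem To.mk_eq_mk_iff {X : Pro C} {c : C} {i k : X.I} {h : X.F.obj i ⟶ c} {h' : X.F.obj k ⟶ c} :
    To.mk i h = To.mk k h' ↔
      ∃ (l : X.I) (s : l ⟶ i) (s' : l ⟶ k), X.F.map s ≫ h = X.F.map s' ≫ h' := by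
  constructor
  · intro H
    have key : ∀ a b : (Σ i : X.I, X.F.obj i ⟶ c),
        Relation.EqvGen (fun a b : (Σ i : X.I, X.F.obj i ⟶ c) =>
          ∃ s : b.1 ⟶ a.1, b.2 = X.F.map s ≫ a.2) a b →
        ∃ (l : X.I) (s : l ⟶ a.1) (s' : l ⟶ b.1), X.F.map s ≫ a.2 = X.F.map s' ≫ b.2 := by
      intro a b hab
      induction hab with
      | rel a b h =>
        obtain ⟨s, hs⟩ := h
        exact ⟨b.1, s, 𝟙 _, by simp [hs]⟩
      | refl a => exact ⟨a.1, 𝟙 _, 𝟙 _, rfl⟩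
      | symm a b _ ih =>
        obtain ⟨l, s, s', e⟩ := ih
        exact ⟨l, s', s, e.symm⟩
      | trans a b d _ _ ih₁ ih₂ =>
        obtain ⟨l, s, s', e⟩ := ih₁
        obtain ⟨m, t, t', e'⟩ := ih₂
        obtain ⟨n, p, q, hpq⟩ := IsCofiltered.cospan s' t
        refine ⟨n, p ≫ s, q ≫ t', ?_⟩
        rw [X.F.map_comp, Category.assoc, e, ← Category.assoc, ← X.F.map_comp, hpq,
          X.F.map_comp, Category.assoc, e', X.F.map_comp, Category.assoc]
    exact key _ _ (Quot.eqvGen_exact H)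
  · rintro ⟨l, s, s', e⟩
    rw [← To.mk_eq s h, e, To.mk_eq]

theorem To.exists_rep {X : Pro C} {c : C} (x : X.To c) : ∃ i h, x = To.mk (X := X) i h := by
  induction x using To.ind with | h i g => exact ⟨i, g, rfl⟩

theorem To.push_injective {X : Pro C} {c d : C} (g : c ⟶ d) [Mono g] {x y : X.To c}
    (h : x.push g = y.push g) : x = y := by
  induction x using To.ind with | h i a =>
  induction y using To.ind with | h k b =>
  obtain ⟨l, s, s', e⟩ := To.mk_eq_mk_iff.1 h
  exact To.mk_eq_mk_iff.2 ⟨l, s, s', by rwa [← cancel_mono g, Category.assoc, Category.assoc]⟩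

/-- The restriction of a pro-object to the indices over `i₀`. -/
def slice (X : Pro C) (i₀ : X.I) : Pro C where
  I := Over i₀
  F := Over.forget i₀ ⋙ X.F

/-- A pro-object is isomorphic to its restriction to the indices over a given one. -/
noncomputable def sliceIso (X : Pro C) (i₀ : X.I) : X.slice i₀ ≅ X where
  hom := ⟨fun j => To.mk (X := X.slice i₀) (Over.mk (IsCofiltered.minToRight j i₀))
      (X.F.map (IsCofiltered.minToLeft j i₀)), fun {j k} s => by
    -- Two coincidences are needed: `n` makes the two maps to `i₀` agree, so that it is an object
    -- over `i₀` above both indices, and `m` then equalizes the two maps to `k`.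
    obtain ⟨n, p, q, hpq⟩ := IsCofiltered.cospan (IsCofiltered.minToRight j i₀)
      (IsCofiltered.minToRight k i₀)
    obtain ⟨m, r, hr⟩ := IsCofilteredOrEmpty.cone_maps (p ≫ IsCofiltered.minToLeft j i₀ ≫ s)
      (q ≫ IsCofiltered.minToLeft k i₀)
    refine To.mk_eq_mk_iff.2 ⟨Over.mk (r ≫ p ≫ IsCofiltered.minToRight j i₀),
      Over.homMk (r ≫ p) (by simp), Over.homMk (r ≫ q) (by simp [hpq]), ?_⟩
    change X.F.map (r ≫ p) ≫ X.F.map _ ≫ X.F.map s = X.F.map (r ≫ q) ≫ X.F.map _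
    rw [← X.F.map_comp, ← X.F.map_comp, ← X.F.map_comp]
    congr 1
    simpa using hr⟩
  inv := ⟨fun a => To.mk a.left (𝟙 _), fun {a b} s => by
    change To.mk a.left (𝟙 _ ≫ X.F.map s.left) = _
    rw [Category.id_comp, ← Category.comp_id (X.F.map s.left)]
    exact To.mk_eq s.left (𝟙 (X.F.obj b.left))⟩
  hom_inv_id := by
    apply Hom.ext
    funext a
    change To.mk (X := X.slice i₀) (Over.mk (IsCofiltered.minToRight a.left i₀))
      (X.F.map (IsCofiltered.minToLeft a.left i₀) ≫ 𝟙 _) = To.mk (X := X.slice i₀) a (𝟙 _)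
    obtain ⟨m, r, hr⟩ := IsCofilteredOrEmpty.cone_maps (IsCofiltered.minToLeft a.left i₀ ≫ a.hom)
      (IsCofiltered.minToRight a.left i₀)
    refine To.mk_eq_mk_iff.2 ⟨Over.mk (r ≫ IsCofiltered.minToRight a.left i₀),
      Over.homMk r, Over.homMk (r ≫ IsCofiltered.minToLeft a.left i₀) (by simpa using hr), ?_⟩
    change X.F.map r ≫ X.F.map _ ≫ 𝟙 _ = X.F.map _ ≫ 𝟙 _
    rw [← Category.assoc, ← X.F.map_comp]
    rfl
  inv_hom_id := by
    apply Hom.ext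
    funext j
    change To.mk (X := X) (IsCofiltered.min j i₀) (𝟙 _ ≫ X.F.map (IsCofiltered.minToLeft j i₀))
      = To.mk j (𝟙 _)
    rw [Category.id_comp]
    simpa using To.mk_eq (X := X) (IsCofiltered.minToLeft j i₀) (𝟙 _)

end Pro

theorem IsStrict.surjective {G : Pro LCGrp.{w}} (hG : IsStrict G) {i j : G.I} (s : i ⟶ j) :
    Function.Surjective (LCGrp.hom (G.F.map s)) := by
  intro y
  obtain ⟨V, -, hy, σ, -, h⟩ := hG s y
  exact ⟨σ y, h y hy⟩

end Lichtenbaum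
namespace Lichtenbaum

open TopologicalSpace Topology

/-! ### Locally compact spaces and their sheaves -/

/-- The morphism given by a continuous map. -/
def LCH.ofC {Z Z' : LCH} (f : C(Z.obj, Z'.obj)) : Z ⟶ Z' := ObjectProperty.homMk (TopCat.ofHom f)

/-- The continuous map underlying a morphism. -/
abbrev LCH.toC {Z Z' : LCH} (f : Z ⟶ Z') : C(Z.obj, Z'.obj) := f.hom.hom

theorem LCH.hom_ext {Z Z' : LCH} {f g : Z ⟶ Z'} (h : ∀ z, LCH.toC f z = LCH.toC g z) : f = g :=
  ObjectProperty.hom_ext _ (TopCat.ext h)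

instance (Z : LCH) : T2Space Z.obj := Z.property.1
instance (Z : LCH) : LocallyCompactSpace Z.obj := Z.property.2

/-- An open subspace. -/
def opn {Z : LCH} (O : Opens Z.obj) : LCH :=
  ⟨TopCat.of O, ⟨inferInstanceAs (T2Space O), O.isOpen.locallyCompactSpace⟩⟩

/-- The inclusion of an open subspace. -/
def opnι {Z : LCH} (O : Opens Z.obj) : opn O ⟶ Z := LCH.ofC ⟨Subtype.val, continuous_subtype_val⟩

/-- The inclusion between two open subspaces. -/
def opnLE {Z : LCH} {O O' : Opens Z.obj} (h : O ≤ O') : opn O ⟶ opn O' :=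
  LCH.ofC ⟨fun z => ⟨z.1, h z.2⟩, by fun_prop⟩

@[simp] theorem opnLE_ι {Z : LCH} {O O' : Opens Z.obj} (h : O ≤ O') : opnLE h ≫ opnι O' = opnι O :=
  rfl

/-- A point of a space as a morphism. -/
def ptTo {Z : LCH} (z : Z.obj) : pt ⟶ Z := LCH.ofC ⟨fun _ => z, continuous_const⟩

/-- The map to the point. -/
def toPt (Z : LCH) : Z ⟶ pt := LCH.ofC ⟨fun _ => PUnit.unit, continuous_const⟩

@[simp] theorem ptTo_comp {Z Z' : LCH} (z : Z.obj) (f : Z ⟶ Z') :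
    ptTo z ≫ f = ptTo (LCH.toC f z) := rfl

theorem toPt_unique {Z : LCH} (f g : Z ⟶ pt) : f = g := LCH.hom_ext fun _ => rfl

/-- Induction on the generation of the topology. Only the pullback case needs an argument: the
preimage of the image of an open embedding is open, and its map to that image factors through the
embedding. -/
theorem exists_openEmbedding_of_mem {Z : LCH} {R : Sieve Z} (hR : R ∈ openCovers Z) (z : Z.obj) :
    ∃ (N : LCH) (j : N ⟶ Z), IsOpenEmbedding (LCH.toC j) ∧ z ∈ Set.range (LCH.toC j) ∧ R j := by
  induction hR with
  | of X S hS =>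
    obtain ⟨_, _, ⟨⟨hj⟩⟩, hi⟩ := hS.1 z
    exact ⟨_, _, hS.2 ⟨hj⟩, hi, ⟨_, 𝟙 _, _, hj, Category.id_comp _⟩⟩
  | top X => exact ⟨X, 𝟙 _, IsOpenEmbedding.id, ⟨z, rfl⟩, trivial⟩
  | pullback X S _ Y f ih =>
    obtain ⟨N, j, hj, hz, hS⟩ := ih (LCH.toC f z)
    let O : Opens Y.obj := ⟨LCH.toC f ⁻¹' Set.range (LCH.toC j),
      hj.isOpen_range.preimage (LCH.toC f).continuous⟩
    refine ⟨opn O, opnι O, O.isOpen.isOpenEmbedding_subtypeVal, ⟨⟨z, hz⟩, rfl⟩, ?_⟩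
    let e := hj.isEmbedding.toHomeomorph
    let k : opn O ⟶ N := LCH.ofC ⟨fun w => e.symm ⟨LCH.toC f w.1, w.2⟩, by
      refine e.symm.continuous.comp ?_
      exact ((LCH.toC f).continuous.comp continuous_subtype_val).subtype_mk _⟩
    have : k ≫ j = opnι O ≫ f := LCH.hom_ext fun w =>
      congrArg Subtype.val (e.apply_symm_apply ⟨LCH.toC f w.1, w.2⟩)
    change S (opnι O ≫ f)
    rw [← this]
    exact S.downward_closed hS _
  | transitive X S R _ _ ih₁ ih₂ =>
    obtain ⟨N, j, hj, ⟨y, rfl⟩, hS⟩ := ih₁ z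
    obtain ⟨N', j', hj', ⟨y', rfl⟩, hR⟩ := ih₂ hS y
    exact ⟨N', j' ≫ j, hj.comp hj', ⟨y', rfl⟩, hR⟩

theorem exists_opn_of_mem {Z : LCH} {R : Sieve Z} (hR : R ∈ openCovers Z) (z : Z.obj) :
    ∃ O : Opens Z.obj, z ∈ O ∧ R (opnι O) := by
  obtain ⟨N, j, hj, hz, h⟩ := exists_openEmbedding_of_mem hR z
  refine ⟨⟨Set.range (LCH.toC j), hj.isOpen_range⟩, hz, ?_⟩
  let e := hj.isEmbedding.toHomeomorph
  let O : Opens Z.obj := ⟨Set.range (LCH.toC j), hj.isOpen_range⟩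
  let k : opn O ⟶ N := LCH.ofC ⟨fun w => e.symm w, e.symm.continuous⟩
  have : k ≫ j = opnι O := LCH.hom_ext fun w => congrArg Subtype.val (e.apply_symm_apply w)
  change R (opnι O)
  rw [← this]
  exact R.downward_closed h _

/-- Every point factors through a member of a cover. This allows compatible families of functions to
be evaluated pointwise. -/
theorem ptTo_mem {Z : LCH} {R : Sieve Z} (hR : R ∈ openCovers Z) (z : Z.obj) : R (ptTo z) := by
  obtain ⟨O, hz, h⟩ := exists_opn_of_mem hR z
  exact R.downward_closed h (ptTo (Z := opn O) ⟨z, hz⟩)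

theorem mem_openCovers {Z : LCH} {R : Sieve Z}
    (h : ∀ z, ∃ O : Opens Z.obj, z ∈ O ∧ R (opnι O)) : R ∈ openCovers Z := by
  let S : Presieve Z := fun W f => R f ∧ IsOpenEmbedding (LCH.toC f)
  have hS : S ∈ (TopCat.precoverage.comap isLCH.ι) Z := by
    refine ⟨fun z => ?_, ?_⟩
    · obtain ⟨O, hz, hO⟩ := h z
      exact ⟨_, _, ⟨Presieve.map_map (F := isLCH.ι) (show S (opnι O) from
        ⟨hO, O.isOpen.isOpenEmbedding_subtypeVal⟩)⟩, ⟨⟨z, hz⟩, rfl⟩⟩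
    · rintro _ _ ⟨hf⟩
      exact hf.2
  exact openCovers.superset_covering ((Sieve.generate_le_iff _ _).2 fun _ _ hf => hf.1)
    (Precoverage.generate_mem_toGrothendieck hS)

/-! ### Sections -/

variable {S S' S'' : T}

@[simp] theorem res_id {Z : LCH} (x : Sec S Z) : res S (𝟙 Z) x = x := by
  change S.obj.map (𝟙 (op Z)) x = x
  rw [S.obj.map_id]; rfl

@[simp] theorem res_res {Z Z' Z'' : LCH} (f : Z' ⟶ Z) (g : Z'' ⟶ Z') (x : Sec S Z) :
    res S g (res S f x) = res S (g ≫ f) x := by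
  change _ = S.obj.map (f.op ≫ g.op) x
  rw [S.obj.map_comp]; rfl

theorem onSec_res (f : S ⟶ S') {Z Z' : LCH} (φ : Z' ⟶ Z) (x : Sec S Z) :
    onSec f (res S φ x) = res S' φ (onSec f x) :=
  NatTrans.naturality_apply f.hom φ.op x

@[simp] theorem onSec_comp (f : S ⟶ S') (g : S' ⟶ S'') {Z : LCH} (x : Sec S Z) :
    onSec (f ≫ g) x = onSec g (onSec f x) := rfl

@[simp] theorem onSec_id {Z : LCH} (x : Sec S Z) : onSec (𝟙 S) x = x := rfl

theorem T_hom_ext {f g : S ⟶ S'} (h : ∀ Z (x : Sec S Z), onSec f x = onSec g x) : f = g := by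
  apply ObjectProperty.hom_ext
  ext Z x
  exact h Z.unop x

/-- A morphism of sheaves given by its action on sections. -/
def T.homMk (f : ∀ Z, Sec S Z → Sec S' Z)
    (h : ∀ {Z Z' : LCH} (φ : Z' ⟶ Z) x, f Z' (res S φ x) = res S' φ (f Z x)) : S ⟶ S' :=
  ⟨{ app := fun Z => TypeCat.ofHom (f Z.unop)
     naturality := fun Z Z' φ => by
      ext x
      exact h φ.unop x }⟩

@[simp] theorem onSec_homMk (f : ∀ Z, Sec S Z → Sec S' Z)
    (h : ∀ {Z Z' : LCH} (φ : Z' ⟶ Z) x, f Z' (res S φ x) = res S' φ (f Z x)) {Z : LCH}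
    (x : Sec S Z) : onSec (T.homMk f h) x = f Z x := rfl

theorem sec_ext_sieve {Z : LCH} {R : Sieve Z} (hR : R ∈ openCovers Z) {x y : Sec S Z}
    (h : ∀ ⦃W⦄ (f : W ⟶ Z), R f → res S f x = res S f y) : x = y :=
  (((isSheaf_iff_isSheaf_of_type _ _).1 S.property).isSeparated R hR).ext h

/-- Sections which agree locally are equal. -/
theorem sec_ext {Z : LCH} {x y : Sec S Z}
    (h : ∀ z : Z.obj, ∃ O : Opens Z.obj, z ∈ O ∧ res S (opnι O) x = res S (opnι O) y) : x = y := by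
  let R : Sieve Z :=
    { arrows := fun W f => res S f x = res S f y
      downward_closed := fun {W W'} f hf g => by
        rw [← res_res, hf, res_res] }
  exact sec_ext_sieve (R := R) (mem_openCovers h) fun _ _ hf => hf

/-- Gluing of sections characterized by a local property. -/
theorem sec_glue {Z : LCH} (Q : ∀ {W : LCH}, (W ⟶ Z) → Sec S W → Prop)
    (hres : ∀ {W W' : LCH} (f : W ⟶ Z) (g : W' ⟶ W) x, Q f x → Q (g ≫ f) (res S g x))
    (huniq : ∀ {W : LCH} (f : W ⟶ Z) x y, Q f x → Q f y → x = y)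
    (hex : ∀ z : Z.obj, ∃ O : Opens Z.obj, z ∈ O ∧ ∃ x, Q (opnι O) x) :
    ∃ x : Sec S Z, ∀ {W : LCH} (f : W ⟶ Z) y, Q f y → res S f x = y := by
  let R : Sieve Z :=
    { arrows := fun W f => ∃ x, Q f x
      downward_closed := by
        rintro W W' f ⟨x, hx⟩ g
        exact ⟨_, hres f g x hx⟩ }
  have hR : R ∈ openCovers Z := mem_openCovers hex
  let fam : Presieve.FamilyOfElements S.obj R.arrows := fun W f hf => hf.choose
  have hfam : ∀ W (f : W ⟶ Z) (hf : R f), Q f (fam f hf) := fun W f hf => hf.choose_spec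
  have hc : fam.Compatible := by
    intro Y₁ Y₂ W g₁ g₂ f₁ f₂ h₁ h₂ e
    refine huniq (g₁ ≫ f₁) _ _ (hres f₁ g₁ _ (hfam _ _ h₁)) ?_
    rw [e]
    exact hres f₂ g₂ _ (hfam _ _ h₂)
  obtain ⟨x, hx, -⟩ := ((isSheaf_iff_isSheaf_of_type _ _).1 S.property) R hR fam hc
  refine ⟨x, fun {W} f y hy => ?_⟩
  have hf : R f := ⟨y, hy⟩
  exact (hx f hf).trans (huniq f _ _ (hfam _ _ hf) hy)

theorem sec_subsingleton {Z : LCH} (hZ : IsEmpty Z.obj) (x y : Sec S Z) : x = y :=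
  sec_ext fun z => hZ.elim z

theorem sec_nonempty {Z : LCH} (hZ : IsEmpty Z.obj) : Nonempty (Sec S Z) :=
  ⟨(sec_glue (S := S) (Z := Z) (fun _ _ => True) (fun _ _ _ _ => trivial)
    (fun f x y _ _ => sec_subsingleton ⟨fun w => hZ.elim (LCH.toC f w)⟩ x y)
    fun z => hZ.elim z).choose⟩

/-! ### Colimits of sheaves -/

variable {K : Type 1} [SmallCategory K] {D : K ⥤ T}

noncomputable instance : HasColimitsOfShape K T :=
  inferInstanceAs (HasColimitsOfShape K (Sheaf openCovers (Type 1)))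

section

variable (D) in
/-- The colimit cocone obtained by sheafifying the colimit of presheaves. -/
noncomputable def sheafCocone : Cocone D := Sheaf.sheafifyCocone (colimit.cocone (D ⋙ sheafToPresheaf _ _))

variable (D) in
noncomputable def isColimitSheafCocone : IsColimit (sheafCocone D) :=
  Sheaf.isColimitSheafifyCocone _ (colimit.isColimit _)

variable (D) in
noncomputable def preColim : LCHᵒᵖ ⥤ Type 1 := colimit (D ⋙ sheafToPresheaf _ _)

/-- A colimit of sheaves is the sheafification of the colimit of presheaves. Sections of the former
lift locally to the latter, where each of them comes from a single stage. -/
theorem colimit_locally_surj {c : Cocone D} (hc : IsColimit c) {Z : LCH} (x : Sec c.pt Z)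
    (z : Z.obj) : ∃ O : Opens Z.obj, z ∈ O ∧ ∃ (k : K) (y : Sec (D.obj k) (opn O)),
      onSec (c.ι.app k) y = res c.pt (opnι O) x := by
  let e := (isColimitSheafCocone D).coconePointUniqueUpToIso hc
  have he : ∀ k, (sheafCocone D).ι.app k ≫ e.hom = c.ι.app k := fun k =>
    (isColimitSheafCocone D).comp_coconePointUniqueUpToIso_hom hc k
  let x' : Sec (sheafCocone D).pt Z := onSec e.inv x
  have hR := Presheaf.imageSieve_mem openCovers (toSheafify openCovers (preColim D)) (U := op Z) x'
  obtain ⟨O, hz, y, hy⟩ := exists_opn_of_mem hR z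
  refine ⟨O, hz, ?_⟩
  obtain ⟨k, w, hw⟩ := Types.jointly_surjective_of_isColimit
    (isColimitOfPreserves ((evaluation _ _).obj (op (opn O)))
      (colimit.isColimit (D ⋙ sheafToPresheaf _ _))) y
  refine ⟨k, w, ?_⟩
  rw [← he k]
  have h1 : onSec ((sheafCocone D).ι.app k) w = res (sheafCocone D).pt (opnι O) x' := by
    refine Eq.trans ?_ hy
    rw [← hw]
    have := Sheaf.sheafifyCocone_ι_app_val (colimit.cocone (D ⋙ sheafToPresheaf _ _)) k
    exact congrArg (fun f => (f.app (op (opn O))) w) this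
  rw [onSec_comp, h1]
  refine (onSec_res e.hom (opnι O) x').trans (congrArg _ ?_)
  change onSec (e.inv ≫ e.hom) x = x
  rw [e.inv_hom_id, onSec_id]

/-- Equality after sheafification is local equality in the presheaf colimit, and in a filtered
colimit of sets such an equality is visible at one later stage. -/
theorem colimit_locally_inj [IsFilteredOrEmpty K] {c : Cocone D} (hc : IsColimit c) {Z : LCH}
    {k k' : K} (x : Sec (D.obj k) Z) (y : Sec (D.obj k') Z)
    (h : onSec (c.ι.app k) x = onSec (c.ι.app k') y)
    (z : Z.obj) : ∃ O : Opens Z.obj, z ∈ O ∧ ∃ (l : K) (f : k ⟶ l) (g : k' ⟶ l),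
      onSec (D.map f) (res _ (opnι O) x) = onSec (D.map g) (res _ (opnι O) y) := by
  let e := (isColimitSheafCocone D).coconePointUniqueUpToIso hc
  have he : ∀ k, c.ι.app k ≫ e.inv = (sheafCocone D).ι.app k := fun k =>
    (isColimitSheafCocone D).comp_coconePointUniqueUpToIso_inv hc k
  have hι : ∀ k (w : Sec (D.obj k) Z), onSec ((sheafCocone D).ι.app k) w =
      (toSheafify openCovers (preColim D)).app (op Z)
        (((colimit.cocone (D ⋙ sheafToPresheaf _ _)).ι.app k).app (op Z) w) := by
    intro k w
    have := Sheaf.sheafifyCocone_ι_app_val (colimit.cocone (D ⋙ sheafToPresheaf _ _)) k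
    exact congrArg (fun f => (f.app (op Z)) w) this
  have h2 : onSec ((sheafCocone D).ι.app k) x = onSec ((sheafCocone D).ι.app k') y := by
    rw [← he, ← he, onSec_comp, onSec_comp, h]
  rw [hι, hι] at h2
  have hR := Presheaf.equalizerSieve_mem openCovers (toSheafify openCovers (preColim D))
    (X := op Z) _ _ h2
  obtain ⟨O, hz, hO⟩ := exists_opn_of_mem hR z
  refine ⟨O, hz, ?_⟩
  have hcol := isColimitOfPreserves ((evaluation _ (Type 1)).obj (op (opn O)))
      (colimit.isColimit (D ⋙ sheafToPresheaf _ _))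
  have := (Types.FilteredColimit.isColimit_eq_iff _ hcol (i := k) (j := k')
    (xi := res (D.obj k) (opnι O) x) (xj := res (D.obj k') (opnι O) y)).1 ?_
  · exact this
  · have n1 := NatTrans.naturality_apply ((colimit.cocone (D ⋙ sheafToPresheaf _ _)).ι.app k)
      (opnι O).op x
    have n2 := NatTrans.naturality_apply ((colimit.cocone (D ⋙ sheafToPresheaf _ _)).ι.app k')
      (opnι O).op y
    exact n1.trans (hO.trans n2.symm)

end

end Lichtenbaum
namespace Lichtenbaum

open TopologicalSpace Topology

/-! ### Representable sheaves -/

/-- The sheaf of continuous maps to a space `M`; if `P` fails, only its sections over the empty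
space are kept. -/
def repIf (P : Prop) (M : Type) [TopologicalSpace M] : T :=
  ⟨{ obj := fun Z => { f : ULift.{1} C(Z.unop.obj, M) // Nonempty Z.unop.obj → P }
     map := fun φ => TypeCat.ofHom fun f =>
      ⟨⟨f.1.down.comp (LCH.toC φ.unop)⟩, fun ⟨z⟩ => f.2 ⟨LCH.toC φ.unop z⟩⟩
     map_id := fun _ => rfl
     map_comp := fun _ _ => rfl }, by
    rw [isSheaf_iff_isSheaf_of_type]
    intro Z R hR fam hfam
    -- The glued function takes at `z` the value of the family at the point `z`. Each member of the
    -- family is the pullback of this function, which makes it continuous on the members of an open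
    -- cover.
    have key : ∀ {W : LCH} (f : W ⟶ Z) (hf : R f) (w : W.obj),
        (fam f hf).1.down w = (fam (ptTo (LCH.toC f w)) (ptTo_mem hR _)).1.down PUnit.unit := by
      intro W f hf w
      have := hfam (ptTo w) (𝟙 pt) hf (ptTo_mem hR (LCH.toC f w)) rfl
      exact congrArg (fun t => t.1.down PUnit.unit) this
    refine ⟨⟨⟨⟨fun z => (fam (ptTo z) (ptTo_mem hR z)).1.down PUnit.unit, ?_⟩⟩, ?_⟩, ?_, ?_⟩
    · rw [continuous_iff_continuousAt]
      intro z
      obtain ⟨O, hz, hO⟩ := exists_opn_of_mem hR z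
      have : ContinuousOn (fun z => (fam (ptTo z) (ptTo_mem hR z)).1.down PUnit.unit) O := by
        rw [continuousOn_iff_continuous_domRestrict]
        refine (fam (opnι O) hO).1.down.continuous.congr fun w => key _ _ _
      exact this.continuousAt (O.isOpen.mem_nhds hz)
    · rintro ⟨z⟩
      exact (fam (ptTo z) (ptTo_mem hR z)).2 ⟨PUnit.unit⟩
    · intro W f hf
      apply Subtype.ext
      apply ULift.ext
      ext w
      exact (key f hf w).symm
    · intro y hy
      apply Subtype.ext
      apply ULift.ext
      ext z
      exact congrArg (fun t => t.1.down PUnit.unit) (hy (ptTo z) (ptTo_mem hR z))⟩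

/-- The section given by a continuous map. -/
def repIf.mk {P : Prop} {M : Type} [TopologicalSpace M] {Z : LCH} (f : C(Z.obj, M))
    (h : Nonempty Z.obj → P) : Sec (repIf P M) Z := ⟨⟨f⟩, h⟩

/-- The continuous map given by a section. -/
def repIf.fn {P : Prop} {M : Type} [TopologicalSpace M] {Z : LCH} (x : Sec (repIf P M) Z) :
    C(Z.obj, M) := x.1.down

theorem repIf.ext {P : Prop} {M : Type} [TopologicalSpace M] {Z : LCH} {x y : Sec (repIf P M) Z}
    (h : ∀ z, repIf.fn x z = repIf.fn y z) : x = y :=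
  Subtype.ext (ULift.ext _ _ (ContinuousMap.ext h))

/-! ### Finite constant sheaves -/

/-- A sheaf whose sections are locally given by finitely many global ones. -/
def IsFinConst (S : T) : Prop :=
  ∃ (D : Type) (_ : Finite D) (e : D → Sec S pt), ∀ (Z : LCH) (x : Sec S Z) (z : Z.obj),
    ∃ O : Opens Z.obj, z ∈ O ∧ ∃ d, res S (opnι O) x = res S (toPt _) (e d)

/-- A point in an open subspace. -/
abbrev ptIn {Z : LCH} {O : Opens Z.obj} {z : Z.obj} (h : z ∈ O) : pt ⟶ opn O :=
  ptTo (Z := opn O) ⟨z, h⟩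

theorem res_ptIn {S : T} {Z : LCH} {O : Opens Z.obj} {z : Z.obj} (h : z ∈ O) (x : Sec S Z) :
    res S (ptIn h) (res S (opnι O) x) = res S (ptTo z) x := by
  rw [res_res]; rfl

theorem res_toPt_pt {S : T} {Z : LCH} (z : Z.obj) (x : Sec S pt) :
    res S (ptTo z) (res S (toPt Z) x) = x := by
  rw [res_res, toPt_unique (ptTo z ≫ toPt Z) (𝟙 _), res_id]

/-- The point of `pt`. -/
def star : pt.obj := PUnit.unit

theorem res_ptTo_pt {S : T} (p : pt.obj) (x : Sec S pt) : res S (ptTo p) x = x := by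
  rw [toPt_unique (ptTo p) (𝟙 _), res_id]

/-- The global section that represents `x` near `z` is recovered by restricting to `z`. -/
theorem IsFinConst.exists_eq {S : T} (hS : IsFinConst S) {Z : LCH} (x : Sec S Z) (z : Z.obj) :
    ∃ O : Opens Z.obj, z ∈ O ∧ res S (opnι O) x = res S (toPt _) (res S (ptTo z) x) := by
  obtain ⟨D, _, e, he⟩ := hS
  obtain ⟨O, hz, d, hd⟩ := he Z x z
  refine ⟨O, hz, ?_⟩
  rw [← res_ptIn hz, hd]
  exact congrArg _ (res_toPt_pt _ _).symm

theorem IsFinConst.finite {S : T} (hS : IsFinConst S) : Finite (Sec S pt) := by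
  obtain ⟨D, _, e, he⟩ := hS
  refine Finite.of_surjective e fun x => ?_
  obtain ⟨O, hz, d, hd⟩ := he pt x star
  refine ⟨d, ?_⟩
  rw [← res_toPt_pt (Z := opn O) ⟨star, hz⟩ (e d), ← hd]
  exact (res_ptIn hz x).trans (res_ptTo_pt _ _)

/-- Near `z` both sections are the constant section with their common value. Equality of sections of
such sheaves can therefore be tested at points, which fails for general sheaves. -/
theorem IsFinConst.eventually_eq {S : T} (hS : IsFinConst S) {Z : LCH} {x y : Sec S Z} {z : Z.obj}
    (h : res S (ptTo z) x = res S (ptTo z) y) :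
    ∃ O : Opens Z.obj, z ∈ O ∧ res S (opnι O) x = res S (opnι O) y := by
  obtain ⟨O, hO, hx⟩ := hS.exists_eq x z
  obtain ⟨O', hO', hy⟩ := hS.exists_eq y z
  refine ⟨O ⊓ O', ⟨hO, hO'⟩, ?_⟩
  have h1 := congrArg (res S (opnLE (inf_le_left : O ⊓ O' ≤ O))) hx
  have h2 := congrArg (res S (opnLE (inf_le_right : O ⊓ O' ≤ O'))) hy
  rw [res_res, res_res, opnLE_ι] at h1 h2
  rw [h1, h2, h]
  congr 1

theorem IsFinConst.of_iso {S S' : T} (hS : IsFinConst S) (e : S ≅ S') : IsFinConst S' := by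
  obtain ⟨D, hD, d, he⟩ := hS
  refine ⟨D, hD, fun a => onSec e.hom (d a), fun Z x z => ?_⟩
  obtain ⟨O, hz, a, ha⟩ := he Z (onSec e.inv x) z
  refine ⟨O, hz, a, ?_⟩
  have := congrArg (onSec e.hom) ha
  rw [onSec_res, onSec_res, ← onSec_comp, e.inv_hom_id] at this
  exact this

theorem onSec_iso_injective {S S' : T} (e : S ≅ S') {Z : LCH} {x y : Sec S Z}
    (h : onSec e.hom x = onSec e.hom y) : x = y := by
  have := congrArg (onSec e.inv) h
  rwa [← onSec_comp, ← onSec_comp, e.hom_inv_id] at this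

/-! ### Objects of the classifying topos -/

/-- Continuous maps to the target of a map with local sections lift locally. -/
theorem IsStrict.lift {G : Pro LCGrp.{0}} (hG : IsStrict G) {k j : G.I} (b : k ⟶ j) {Z : LCH}
    (g : C(Z.obj, G.F.obj j)) (z : Z.obj) : ∃ O : Opens Z.obj, z ∈ O ∧
      ∃ g' : C((opn O).obj, G.F.obj k), ∀ t, LCGrp.hom (G.F.map b) (g' t) = g t.1 := by
  obtain ⟨V, hV, hz, s, hs, h⟩ := hG b (g z)
  let O : Opens Z.obj := ⟨g ⁻¹' V, hV.preimage g.continuous⟩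
  refine ⟨O, hz, ⟨fun t => s (g t.1), ?_⟩, fun t => h _ t.2⟩
  exact hs.comp_continuous (g.continuous.comp continuous_subtype_val) fun t => t.2

namespace BObj

variable {G : Pro LCGrp.{0}} (Y : BObj G)

theorem incl_map {k i : G.I} (s : k ⟶ i) {Z : LCH} (x : Sec (Y.X.obj (op i)) Z) :
    Y.incl k (onSec (Y.X.map s.op) x) = Y.incl i x := by
  change onSec (Y.X.map s.op ≫ colimit.ι Y.X (op k)) x = _
  rw [colimit.w]

theorem incl_res {i : G.I} {Z Z' : LCH} (φ : Z' ⟶ Z) (x : Sec (Y.X.obj (op i)) Z) :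
    Y.incl i (res _ φ x) = res _ φ (Y.incl i x) := onSec_res _ _ _

/-- The kernel acts trivially on the image of a section from level `i`, and `invariants` includes
uniqueness of the preimage. -/
theorem map_injective {k i : G.I} (s : k ⟶ i) {Z : LCH} :
    Function.Injective (onSec (Y.X.map s.op) : Sec (Y.X.obj (op i)) Z → _) := by
  intro x y h
  refine (Y.invariants s Z (onSec (Y.X.map s.op) x) ?_).unique rfl h.symm
  intro Z' φ n hn
  have : (LCGrp.hom (G.F.map s) : C(G.F.obj k, G.F.obj i)).comp n = 1 :=
    ContinuousMap.ext hn
  rw [← onSec_res, ← Y.act_trans, this, Y.act_one]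

/-- A filtered colimit of injective transition maps. Hence being defined at level `i` is a property
of a section of the underlying sheaf, and identities between actions may be checked there. -/
theorem incl_injective (i : G.I) {Z : LCH} :
    Function.Injective (Y.incl i : Sec (Y.X.obj (op i)) Z → _) := by
  intro x y h
  refine sec_ext fun z => ?_
  obtain ⟨O, hz, l, f, g, e⟩ := colimit_locally_inj (colimit.isColimit Y.X) x y h z
  refine ⟨O, hz, ?_⟩
  obtain ⟨m, r, hr⟩ := IsCofilteredOrEmpty.cone_maps f.unop g.unop
  apply Y.map_injective (r ≫ f.unop)
  have e' := congrArg (onSec (Y.X.map r.op)) e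
  rw [← onSec_comp, ← onSec_comp, ← Y.X.map_comp, ← Y.X.map_comp] at e'
  refine e'.trans ?_
  rw [hr]
  rfl

theorem exists_incl {Z : LCH} (m : Sec ((forget G).obj Y) Z) (z : Z.obj) :
    ∃ O : Opens Z.obj, z ∈ O ∧ ∃ i y, Y.incl i y = res _ (opnι O) m := by
  obtain ⟨O, hz, k, y, h⟩ := colimit_locally_surj (colimit.isColimit Y.X) m z
  exact ⟨O, hz, k.unop, y, h⟩

/-- The only neighbourhood of the point of `pt` is everything, so over `pt` no localization is
necessary. -/
theorem exists_incl_pt (m : Sec ((forget G).obj Y) pt) : ∃ i y, Y.incl i y = m := by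
  obtain ⟨O, hz, i, y, h⟩ := Y.exists_incl m star
  refine ⟨i, res _ (ptIn hz) y, ?_⟩
  rw [incl_res, h]
  exact (res_ptIn hz m).trans (res_ptTo_pt _ _)

theorem forget_map_incl {Y Y' : BObj G} (f : Y ⟶ Y') {i : G.I} {Z : LCH}
    (x : Sec (Y.X.obj (op i)) Z) :
    onSec ((forget G).map f) (Y.incl i x) = Y'.incl i (onSec ((Hom.app f).app (op i)) x) := by
  change onSec (colimit.ι Y.X (op i) ≫ colimMap (Hom.app f)) x = _
  rw [ι_colimMap]
  rfl

theorem hom_equivariant {Y Y' : BObj G} (f : Y ⟶ Y') {i : G.I} {Z : LCH} (g : C(Z.obj, G.F.obj i))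
    (x : Sec (Y.X.obj (op i)) Z) : onSec ((Hom.app f).app (op i)) (Y.act i Z g x) =
      Y'.act i Z g (onSec ((Hom.app f).app (op i)) x) := Hom.equivariant f i Z g x

theorem incl_act_trans {k i : G.I} (s : k ⟶ i) {Z : LCH} (g : C(Z.obj, G.F.obj k))
    (x : Sec (Y.X.obj (op i)) Z) :
    Y.incl k (Y.act k Z g (onSec (Y.X.map s.op) x)) =
      Y.incl i (Y.act i Z ((LCGrp.hom (G.F.map s) : C(_, _)).comp g) x) := by
  rw [← Y.act_trans, incl_map]

/-- The actions at two levels agree for maps which lift locally to a common refinement. -/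
theorem incl_act_eq {k i j : G.I} (a : k ⟶ i) (b : k ⟶ j) {Z : LCH} (g : C(Z.obj, G.F.obj i))
    (g' : C(Z.obj, G.F.obj j)) (x : Sec (Y.X.obj (op i)) Z) (x' : Sec (Y.X.obj (op j)) Z)
    (e : Y.incl i x = Y.incl j x')
    (h : ∀ z : Z.obj, ∃ O : Opens Z.obj, z ∈ O ∧ ∃ n : C((opn O).obj, G.F.obj k), ∀ t,
      LCGrp.hom (G.F.map a) (n t) = g t.1 ∧ LCGrp.hom (G.F.map b) (n t) = g' t.1) :
    Y.incl i (Y.act i Z g x) = Y.incl j (Y.act j Z g' x') := by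
  refine sec_ext fun z => ?_
  obtain ⟨O, hz, n, hn⟩ := h z
  refine ⟨O, hz, ?_⟩
  have h1 : g.comp (LCH.toC (opnι O)) = (LCGrp.hom (G.F.map a) : C(_, _)).comp n :=
    ContinuousMap.ext fun t => (hn t).1.symm
  have h2 : g'.comp (LCH.toC (opnι O)) = (LCGrp.hom (G.F.map b) : C(_, _)).comp n :=
    ContinuousMap.ext fun t => (hn t).2.symm
  rw [← incl_res, ← incl_res, Y.act_res, Y.act_res, h1, h2, ← incl_act_trans, ← incl_act_trans]
  congr 2
  apply Y.incl_injective k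
  rw [incl_map, incl_map, incl_res, incl_res, e]

theorem res_pt_act {i : G.I} {Z : LCH} (g : C(Z.obj, G.F.obj i)) (x : Sec (Y.X.obj (op i)) Z)
    (z : Z.obj) : res _ (ptTo z) (Y.act i Z g x) =
      Y.act i pt (ContinuousMap.const _ (g z)) (res _ (ptTo z) x) := Y.act_res _ _ _ _

/-! ### Free objects -/

/-- `G_i` is a quotient of `G_j`, compatibly with the projections from some `G_k`. -/
def Dominates (G : Pro LCGrp.{0}) (i j : G.I) : Prop :=
  ∃ (h : G.F.obj j →ₜ* G.F.obj i) (k : G.I) (a : k ⟶ i) (b : k ⟶ j),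
    ∀ x, h (LCGrp.hom (G.F.map b) x) = LCGrp.hom (G.F.map a) x

/-- The homomorphism `G_j ⟶ G_i`. -/
noncomputable def Dominates.hom {i j : G.I} (h : Dominates G i j) : G.F.obj j →ₜ* G.F.obj i :=
  h.choose

end BObj

theorem LCGrp.map_comp_apply {G : Pro LCGrp.{w}} {i j k : G.I} (s : i ⟶ j) (t : j ⟶ k)
    (x : G.F.obj i) : LCGrp.hom (G.F.map (s ≫ t)) x =
      LCGrp.hom (G.F.map t) (LCGrp.hom (G.F.map s) x) := by
  rw [G.F.map_comp]
  rfl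

theorem LCGrp.map_id_apply {G : Pro LCGrp.{w}} {i : G.I} (x : G.F.obj i) :
    LCGrp.hom (G.F.map (𝟙 i)) x = x := by
  rw [G.F.map_id]
  rfl

namespace BObj

variable {G : Pro LCGrp.{0}}

/-- The homomorphism does not depend on the witnessing indices: two choices become equal on a common
refinement, whose projection to the given `G_k` is surjective by strictness. -/
theorem Dominates.spec (hG : IsStrict G) {i j : G.I} (h : Dominates G i j) {k : G.I} (a : k ⟶ i)
    (b : k ⟶ j) (x) : h.hom (LCGrp.hom (G.F.map b) x) = LCGrp.hom (G.F.map a) x := by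
  obtain ⟨k', a', b', hab⟩ := h.choose_spec
  obtain ⟨l, u, u', hu⟩ := IsCofiltered.cospan b b'
  obtain ⟨m, r, hr⟩ := IsCofilteredOrEmpty.cone_maps (u ≫ a) (u' ≫ a')
  obtain ⟨y, rfl⟩ := hG.surjective (r ≫ u) x
  rw [← LCGrp.map_comp_apply, ← LCGrp.map_comp_apply, Category.assoc, Category.assoc, hu, hr,
    LCGrp.map_comp_apply, LCGrp.map_comp_apply, LCGrp.map_comp_apply r, LCGrp.map_comp_apply u']
  exact hab _

theorem Dominates.of_hom {i j : G.I} (s : j ⟶ i) : Dominates G i j :=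
  ⟨LCGrp.hom (G.F.map s), j, s, 𝟙 j, fun x => by rw [LCGrp.map_id_apply]⟩

theorem Dominates.hom_of_hom (hG : IsStrict G) {i j : G.I} (h : Dominates G i j) (s : j ⟶ i) (x) :
    h.hom x = LCGrp.hom (G.F.map s) x := by
  have := h.spec hG s (𝟙 j) x
  rwa [LCGrp.map_id_apply] at this

theorem Dominates.trans {i j j' : G.I} (s : j' ⟶ j) (h : Dominates G i j) : Dominates G i j' := by
  obtain ⟨f, k, a, b, hf⟩ := h
  obtain ⟨l, u, u', hu⟩ := IsCofiltered.cospan b s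
  refine ⟨f.comp (LCGrp.hom (G.F.map s)), l, u ≫ a, u', fun x => ?_⟩
  change f (LCGrp.hom (G.F.map s) (LCGrp.hom (G.F.map u') x)) = _
  rw [← LCGrp.map_comp_apply, ← hu, LCGrp.map_comp_apply, hf, ← LCGrp.map_comp_apply]

theorem Dominates.hom_trans (hG : IsStrict G) {i j j' : G.I} (s : j' ⟶ j) (h : Dominates G i j)
    (h' : Dominates G i j') (x) : h'.hom x = h.hom (LCGrp.hom (G.F.map s) x) := by
  obtain ⟨k, a, b, -⟩ := h'.choose_spec
  obtain ⟨y, rfl⟩ := hG.surjective b x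
  rw [h'.spec hG a b, ← LCGrp.map_comp_apply, h.spec hG a (b ≫ s)]

/-- A homomorphism `G_k ⟶ G_i` which is trivial on the kernel of `G_k ⟶ G_j` factors. -/
theorem Dominates.of_kernel (hG : IsStrict G) {i j k : G.I} (s : k ⟶ j) (h : Dominates G i k)
    (hk : ∀ n, LCGrp.hom (G.F.map s) n = 1 → h.hom n = 1) : Dominates G i j := by
  have hs := hG.surjective s
  have key : ∀ x y, LCGrp.hom (G.F.map s) x = LCGrp.hom (G.F.map s) y → h.hom x = h.hom y := by
    intro x y e
    have := hk (x * y⁻¹) (by rw [map_mul, map_inv, e, mul_inv_cancel])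
    rwa [map_mul, map_inv, mul_inv_eq_one] at this
  let f : G.F.obj j → G.F.obj i := fun y => h.hom (hs y).choose
  have hf : ∀ x, f (LCGrp.hom (G.F.map s) x) = h.hom x := fun x => key _ _ (hs _).choose_spec
  refine ⟨⟨⟨⟨f, ?_⟩, ?_⟩, ?_⟩, ?_⟩
  · rw [← map_one (LCGrp.hom (G.F.map s)), hf, map_one]
  · intro x y
    obtain ⟨x, rfl⟩ := hs x
    obtain ⟨y, rfl⟩ := hs y
    change f _ = f _ * f _
    rw [← map_mul, hf, hf, hf, map_mul]
  · change Continuous f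
    rw [continuous_iff_continuousAt]
    intro y
    -- Near `y` the descended map is `h.hom` composed with a continuous local section; this is where
    -- local sections, and not only surjectivity, are needed.
    obtain ⟨V, hV, hy, σ, hσ, e⟩ := hG s y
    have : ContinuousOn f V :=
      (h.hom.continuous_toFun.comp_continuousOn hσ).congr fun z hz => by
        change f z = h.hom (σ z)
        rw [← hf, e z hz]
    exact this.continuousAt (hV.mem_nhds hy)
  · obtain ⟨l, a, b, -⟩ := h.choose_spec
    refine ⟨l, a, b ≫ s, fun x => ?_⟩
    change f _ = _
    rw [LCGrp.map_comp_apply, hf, h.spec hG a b]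

open Classical in
/-- The object of the classifying topos freely generated by a section over `Z₀` at level `i`. -/
noncomputable def free (hG : IsStrict G) (i : G.I) (Z₀ : LCH) : BObj G where
  X :=
    { obj := fun j => repIf (Dominates G i j.unop) (G.F.obj i × Z₀.obj)
      map := fun {j j'} s => T.homMk
        (fun Z x => repIf.mk (repIf.fn x) fun h => (x.2 h).trans s.unop) fun _ _ => rfl
      map_id := fun _ => rfl
      map_comp := fun _ _ => rfl }
  -- `G_j` acts by left translation on the factor `G_i` through `G_j → G_i`. If there is no such
  -- homomorphism, the sheaf has sections only over the empty space, so the default value is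
  -- harmless.
  act j Z g x :=
    if h : Dominates G i j then
      repIf.mk ⟨fun z => (h.hom (g z) * (repIf.fn x z).1, (repIf.fn x z).2), by
        have := (map_continuous h.hom).comp g.continuous
        have := (repIf.fn x).continuous
        fun_prop⟩ fun _ => h
    else x
  act_one j Z x := by
    split
    · apply repIf.ext
      intro z
      change (_ * _, _) = _
      simp
    · rfl
  act_mul j Z g h x := by
    split
    · apply repIf.ext
      intro z
      refine Prod.ext ?_ rfl
      change Dominates.hom _ (g z * h z) * _ = Dominates.hom _ (g z) * (Dominates.hom _ (h z) * _)
      rw [map_mul, mul_assoc]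
    · rfl
  act_res j {Z Z'} φ g x := by
    split
    · rfl
    · rfl
  act_trans {k j} s Z g x := by
    dsimp only
    by_cases h : Dominates G i j
    · rw [dif_pos h, dif_pos (h.trans s)]
      apply repIf.ext
      intro z
      exact Prod.ext (congrArg (· * _) (h.hom_trans hG s (h.trans s) (g z)).symm) rfl
    · have hZ : IsEmpty Z.obj := not_nonempty_iff.1 fun hn => h (x.2 hn)
      exact sec_subsingleton hZ _ _
  invariants {k j} s Z y hy := by
    have hd : Nonempty Z.obj → Dominates G i j := by
      rintro ⟨z⟩
      -- Translations of `G_i` are free. A section over a non-empty space that is invariant under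
      -- the kernel of `G_k → G_j` thus forces this kernel to die in `G_i`, and `G_k → G_i` descends
      -- to `G_j`.
      refine Dominates.of_kernel hG s (y.2 ⟨z⟩) fun n hn => ?_
      have := hy pt (ptTo z) (ContinuousMap.const _ n) fun _ => hn
      dsimp only at this
      rw [dif_pos (y.2 ⟨z⟩)] at this
      have := congrArg (fun t => (repIf.fn t PUnit.unit).1) this
      exact mul_eq_right.1 this
    refine ⟨repIf.mk (repIf.fn y) hd, rfl, fun x hx => ?_⟩
    apply repIf.ext
    intro z
    have := congrArg (fun t : Sec (repIf (Dominates G i k) _) Z => repIf.fn t z) hx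
    exact this

variable (hG : IsStrict G) {i : G.I} {Z₀ : LCH}

/-- The section at level `i` of a free object given by a continuous map. -/
noncomputable def freeMk (i : G.I) {Z₀ Z : LCH} (f : C(Z.obj, G.F.obj i × Z₀.obj)) :
    Sec ((free hG i Z₀).X.obj (op i)) Z := repIf.mk f fun _ => Dominates.of_hom (𝟙 i)

theorem free_act_fn {j : G.I} {Z : LCH} (g : C(Z.obj, G.F.obj j)) (h : Dominates G i j)
    (x : Sec ((free hG i Z₀).X.obj (op j)) Z) (z : Z.obj) :
    repIf.fn (P := Dominates G i j) ((free hG i Z₀).act j Z g x) z =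
      (h.hom (g z) * (repIf.fn (P := Dominates G i j) x z).1,
        (repIf.fn (P := Dominates G i j) x z).2) := by
  exact congrArg (fun t : Sec (repIf (Dominates G i j) _) Z => repIf.fn t z) (dif_pos h)

theorem incl_freeMk {j : G.I} {Z : LCH} (x : Sec ((free hG i Z₀).X.obj (op j)) Z) :
    (free hG i Z₀).incl j x =
      (free hG i Z₀).incl i (freeMk hG i (repIf.fn (P := Dominates G i j) x)) := by
  rw [← incl_map _ (IsCofiltered.minToLeft j i), ← incl_map _ (IsCofiltered.minToRight j i)]
  rfl

/-- Level `i` exhausts the colimit. A section defined locally at level `j` has the same underlying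
map as one at level `i`, and these local representatives glue because `incl` is injective. -/
theorem exists_freeMk {Z : LCH} (m : Sec ((forget G).obj (free hG i Z₀)) Z) :
    ∃ f : C(Z.obj, G.F.obj i × Z₀.obj), (free hG i Z₀).incl i (freeMk hG i f) = m := by
  obtain ⟨x, hx⟩ := sec_glue (S := (free hG i Z₀).X.obj (op i)) (Z := Z)
    (fun {W} f x => (free hG i Z₀).incl i x = res _ f m)
    (fun f g x h => by rw [incl_res, h, res_res])
    (fun f x y h h' => incl_injective _ _ (h.trans h'.symm))
    (fun z => by
      obtain ⟨O, hz, j, y, hy⟩ := (free hG i Z₀).exists_incl m z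
      exact ⟨O, hz, freeMk hG i (repIf.fn (P := Dominates G i j) y), by rw [← hy, ← incl_freeMk]⟩)
  refine ⟨repIf.fn (P := Dominates G i i) x, ?_⟩
  change (free hG i Z₀).incl i x = m
  refine sec_ext fun z => ?_
  obtain ⟨O, hz, j, y, hy⟩ := (free hG i Z₀).exists_incl m z
  refine ⟨O, hz, ?_⟩
  rw [incl_freeMk] at hy
  rw [← incl_res, hx _ _ hy, hy]

theorem freeMk_injective {Z : LCH} {f f' : C(Z.obj, G.F.obj i × Z₀.obj)}
    (h : (free hG i Z₀).incl i (freeMk hG i f) = (free hG i Z₀).incl i (freeMk hG i f')) : f = f' :=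
  congrArg (repIf.fn (P := Dominates G i i)) (incl_injective _ _ h)

theorem freeMk_res {Z Z' : LCH} (φ : Z' ⟶ Z) (f : C(Z.obj, G.F.obj i × Z₀.obj)) :
    res _ φ (freeMk hG i f) = freeMk hG i (f.comp (LCH.toC φ)) := rfl

variable {Y : BObj G}

/-- The value of the orbit map of `y`. -/
def orbitVal (y : Sec (Y.X.obj (op i)) Z₀) {Z : LCH} (f : C(Z.obj, G.F.obj i × Z₀.obj)) :
    Sec (Y.X.obj (op i)) Z :=
  Y.act i Z (ContinuousMap.fst.comp f) (res _ (LCH.ofC (ContinuousMap.snd.comp f)) y)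

theorem orbitVal_res (y : Sec (Y.X.obj (op i)) Z₀) {Z Z' : LCH} (φ : Z' ⟶ Z)
    (f : C(Z.obj, G.F.obj i × Z₀.obj)) :
    res _ φ (orbitVal y f) = orbitVal y (f.comp (LCH.toC φ)) := by
  rw [orbitVal, Y.act_res, res_res]
  rfl

/-- Over a non-empty space `G_i` is a quotient of `G_j`. The orbit value, moved to a common level
`k`, is then fixed by the kernel of `G_k → G_j`, so it descends to level `j`. -/
theorem exists_orbit (y : Sec (Y.X.obj (op i)) Z₀) {j : G.I} {Z : LCH}
    (x : Sec ((free hG i Z₀).X.obj (op j)) Z) :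
    ∃ w : Sec (Y.X.obj (op j)) Z, Y.incl j w =
      Y.incl i (orbitVal y (repIf.fn (P := Dominates G i j) x)) := by
  by_cases hZ : IsEmpty Z.obj
  · obtain ⟨w⟩ := sec_nonempty (S := Y.X.obj (op j)) hZ
    exact ⟨w, sec_subsingleton hZ _ _⟩
  · have h : Dominates G i j := x.2 (not_isEmpty_iff.1 hZ)
    obtain ⟨k, a, b, -⟩ := h.choose_spec
    obtain ⟨w, hw, -⟩ := Y.invariants b Z
      (onSec (Y.X.map a.op) (orbitVal y (repIf.fn (P := Dominates G i j) x))) (by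
        intro Z' φ n hn
        have : (LCGrp.hom (G.F.map a) : C(G.F.obj k, G.F.obj i)).comp n = 1 := by
          ext z
          change LCGrp.hom (G.F.map a) (n z) = 1
          rw [← h.spec hG a b, hn z, map_one]
        rw [← onSec_res, ← Y.act_trans, this, Y.act_one])
    refine ⟨w, ?_⟩
    rw [← incl_map _ b, hw, incl_map]

/-- The orbit map of a section. -/
noncomputable def orbit (y : Sec (Y.X.obj (op i)) Z₀) : free hG i Z₀ ⟶ Y where
  app :=
    { app := fun j => T.homMk (fun Z x => (exists_orbit hG y (j := j.unop) x).choose)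
        fun {Z Z'} φ x => by
          apply Y.incl_injective j.unop
          rw [(exists_orbit hG y _).choose_spec, incl_res, (exists_orbit hG y _).choose_spec,
            ← incl_res, orbitVal_res]
          rfl
      naturality := fun j j' s => T_hom_ext fun Z x => by
        apply Y.incl_injective j'.unop
        change Y.incl j'.unop (exists_orbit hG y (j := j'.unop) _).choose =
          Y.incl j'.unop (onSec (Y.X.map s.unop.op) (exists_orbit hG y (j := j.unop) _).choose)
        rw [(exists_orbit hG y _).choose_spec, incl_map, (exists_orbit hG y _).choose_spec]
        rfl }
  equivariant j Z g x := by
    apply Y.incl_injective j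
    change Y.incl j (exists_orbit hG y _).choose =
      Y.incl j (Y.act j Z g (exists_orbit hG y _).choose)
    rw [(exists_orbit hG y _).choose_spec]
    by_cases hZ : IsEmpty Z.obj
    · exact sec_subsingleton hZ _ _
    have h : Dominates G i j := x.2 (not_isEmpty_iff.1 hZ)
    obtain ⟨k, a, b, -⟩ := h.choose_spec
    -- The actions at levels `j` and `i` are compared after lifting `g` locally to the common level
    -- `k`.
    have e := Y.incl_act_eq b a g ⟨fun z => h.hom (g z), by
      exact (map_continuous h.hom).comp g.continuous⟩ _ _
      (exists_orbit hG y x).choose_spec fun z => by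
        obtain ⟨O, hz, n, hn⟩ := hG.lift b g z
        refine ⟨O, hz, n, fun t => ⟨hn t, ?_⟩⟩
        rw [← h.spec hG a b, hn]
        rfl
    have h1 : ContinuousMap.fst.comp (repIf.fn (P := Dominates G i j)
        ((free hG i Z₀).act j Z g x)) = ⟨fun z => h.hom (g z), by
          exact (map_continuous h.hom).comp g.continuous⟩ *
            ContinuousMap.fst.comp (repIf.fn (P := Dominates G i j) x) :=
      ContinuousMap.ext fun z => congrArg Prod.fst (free_act_fn hG g h x z)
    have h2 : ContinuousMap.snd.comp (repIf.fn (P := Dominates G i j)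
        ((free hG i Z₀).act j Z g x)) = ContinuousMap.snd.comp (repIf.fn (P := Dominates G i j) x) :=
      ContinuousMap.ext fun z => by
        have := congrArg Prod.snd (free_act_fn hG g h x z)
        exact this
    rw [e, orbitVal, orbitVal, ← Y.act_mul, h1, h2]

theorem forget_orbit (y : Sec (Y.X.obj (op i)) Z₀) {Z : LCH} (f : C(Z.obj, G.F.obj i × Z₀.obj)) :
    onSec ((forget G).map (orbit hG y)) ((free hG i Z₀).incl i (freeMk hG i f)) =
      Y.incl i (orbitVal y f) := by
  rw [forget_map_incl]
  exact (exists_orbit hG y (freeMk hG i f)).choose_spec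

end BObj

end Lichtenbaum
-- Torsors, and the reconstruction of morphisms of pro-groups from actions
namespace Lichtenbaum

open TopologicalSpace Topology

/-- The space underlying a locally compact group. -/
def LCGrp.lch (A : LCGrp.{0}) : LCH :=
  ⟨TopCat.of A, ⟨inferInstanceAs (T2Space A), inferInstanceAs (LocallyCompactSpace A)⟩⟩

/-- The continuous map underlying a morphism. -/
abbrev LCGrp.cont {A B : LCGrp.{0}} (f : A ⟶ B) : C(A, B) := (LCGrp.hom f : C(A, B))

namespace BObj

variable {G : Pro LCGrp.{0}} (hG : IsStrict G) {i : G.I} {Z₀ : LCH}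

theorem act_freeMk {Z : LCH} (g a : C(Z.obj, G.F.obj i)) (b : C(Z.obj, Z₀.obj)) :
    (free hG i Z₀).act i Z g (freeMk hG i (a.prodMk b)) = freeMk hG i ((g * a).prodMk b) := by
  apply repIf.ext (P := Dominates G i i)
  intro z
  refine (free_act_fn hG g (Dominates.of_hom (𝟙 i)) _ z).trans ?_
  rw [Dominates.hom_of_hom hG _ (𝟙 i), LCGrp.map_id_apply]
  rfl

theorem orbitVal_one {Y : BObj G} {Z : LCH} (y : Sec (Y.X.obj (op i)) Z) :
    orbitVal y ((1 : C(Z.obj, G.F.obj i)).prodMk (ContinuousMap.id Z.obj)) = y := by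
  have h : LCH.ofC (Z := Z) (Z' := Z) (ContinuousMap.snd.comp
    ((1 : C(Z.obj, G.F.obj i)).prodMk (ContinuousMap.id Z.obj))) = 𝟙 Z := rfl
  have h' : ContinuousMap.fst.comp ((1 : C(Z.obj, G.F.obj i)).prodMk (ContinuousMap.id Z.obj)) = 1 :=
    rfl
  rw [orbitVal, h, h', res_id, Y.act_one]

/-- The section of the torsor `G_i` given by a continuous map. -/
noncomputable def tor (i : G.I) {Z : LCH} (a : C(Z.obj, G.F.obj i)) :
    Sec ((forget G).obj (free hG i pt)) Z :=
  (free hG i pt).incl i (freeMk hG i (a.prodMk (LCH.toC (toPt Z))))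

theorem tor_injective {Z : LCH} {a b : C(Z.obj, G.F.obj i)} (h : tor hG i a = tor hG i b) :
    a = b := by
  ext z
  exact congrArg (fun f => (f z).1) (freeMk_injective hG h)

theorem tor_surjective {Z : LCH} (m : Sec ((forget G).obj (free hG i pt)) Z) :
    ∃ a, tor hG i a = m := by
  obtain ⟨f, hf⟩ := exists_freeMk hG m
  exact ⟨ContinuousMap.fst.comp f, hf⟩

theorem tor_res {Z Z' : LCH} (φ : Z' ⟶ Z) (a : C(Z.obj, G.F.obj i)) :
    res _ φ (tor hG i a) = tor hG i (a.comp (LCH.toC φ)) := by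
  rw [tor, ← incl_res, freeMk_res]
  rfl

/-- The orbit map of a global section on the torsor `G_i`. -/
theorem orbit_tor {Y : BObj G} (y : Sec (Y.X.obj (op i)) pt) {Z : LCH} (a : C(Z.obj, G.F.obj i)) :
    onSec ((forget G).map (orbit hG y)) (tor hG i a) =
      Y.incl i (Y.act i Z a (res _ (toPt Z) y)) :=
  forget_orbit hG y _

end BObj

open BObj

/-- A compatible family of partial actions of a pro-group `H` on the sheaves underlying the objects
of the classifying topos of `G`: the relation `A Y l Z g m m'` says that the section `g` of `H_l`
sends the section `m` to `m'`. -/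
structure ProAction (H G : Pro LCGrp.{0}) where
  A : ∀ (Y : BObj G) (l : H.I) (Z : LCH) (_ : C(Z.obj, H.F.obj l))
    (_ _ : Sec ((BObj.forget G).obj Y) Z), Prop
  det : ∀ {Y l Z g m m' m''}, A Y l Z g m m' → A Y l Z g m m'' → m' = m''
  mul : ∀ {Y l Z g g' m m' m''}, A Y l Z g' m m' → A Y l Z g m' m'' → A Y l Z (g * g') m m''
  res : ∀ {Y l Z g m m'} {Z' : LCH} (φ : Z' ⟶ Z), A Y l Z g m m' →
    A Y l Z' (g.comp (LCH.toC φ)) (Lichtenbaum.res _ φ m) (Lichtenbaum.res _ φ m')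
  trans : ∀ {Y l l' Z} (s : l' ⟶ l) {g : C(Z.obj, H.F.obj l')} {m m'},
    A Y l Z ((LCGrp.cont (H.F.map s)).comp g) m m' → A Y l' Z g m m'
  nat : ∀ {Y Y' : BObj G} (f : Y ⟶ Y') {l Z g m m'}, A Y l Z g m m' →
    A Y' l Z g (onSec ((BObj.forget G).map f) m) (onSec ((BObj.forget G).map f) m')
  exists_act : ∀ (Y : BObj G) (Z : LCH) (m : Sec ((BObj.forget G).obj Y) Z) (z : Z.obj),
    ∃ O : Opens Z.obj, z ∈ O ∧ ∃ l : H.I, ∀ (W : LCH) (φ : W ⟶ opn O) (g : C(W.obj, H.F.obj l)),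
      ∃ m', A Y l W g (Lichtenbaum.res _ (φ ≫ opnι O) m) m'

namespace ProAction

variable {H G : Pro LCGrp.{0}} (hH : IsStrict H) (hG : IsStrict G) (𝒜 : ProAction H G)

/-- The action is given by the morphism `φ`. -/
def Realizes (φ : H ⟶ G) : Prop :=
  ∀ (Y : BObj G) (i : G.I) (l : H.I) (h : H.F.obj l ⟶ G.F.obj i), φ.val i = Pro.To.mk l h →
    ∀ (Z : LCH) (g : C(Z.obj, H.F.obj l)) (y : Sec (Y.X.obj (op i)) Z) m',
      𝒜.A Y l Z g (Y.incl i y) m' → m' = Y.incl i (Y.act i Z ((LCGrp.cont h).comp g) y)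

/-- The action on the torsor `G_i` sends the generator to the value of `h`. -/
def Spec (i : G.I) (l : H.I) (h : C(H.F.obj l, G.F.obj i)) : Prop :=
  ∀ (Z : LCH) (g : C(Z.obj, H.F.obj l)),
    𝒜.A (free hG i pt) l Z g (tor hG i 1) (tor hG i (h.comp g))

variable {𝒜} {hG}

theorem Spec.trans {i : G.I} {l l' : H.I} {h : C(H.F.obj l, G.F.obj i)} (hs : 𝒜.Spec hG i l h)
    (s : l' ⟶ l) : 𝒜.Spec hG i l' (h.comp (LCGrp.cont (H.F.map s))) :=
  fun Z _ => 𝒜.trans s (hs Z _)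

/-- Evaluate at the tautological section: the identity map, over the space `H_l` itself. -/
theorem Spec.eq {i : G.I} {l : H.I} {h h' : C(H.F.obj l, G.F.obj i)} (hs : 𝒜.Spec hG i l h)
    (hs' : 𝒜.Spec hG i l h') : h = h' :=
  tor_injective hG (𝒜.det (hs (H.F.obj l).lch (ContinuousMap.id _)) (hs' _ _))

theorem exists_pt (Y : BObj G) (m : Sec ((BObj.forget G).obj Y) pt) :
    ∃ l : H.I, ∀ (Z : LCH) (g : C(Z.obj, H.F.obj l)), ∃ m', 𝒜.A Y l Z g (Lichtenbaum.res _ (toPt Z) m) m' := by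
  obtain ⟨O, hz, l, h⟩ := 𝒜.exists_act Y pt m star
  exact ⟨l, fun Z g => h Z (toPt Z ≫ ptIn hz) g⟩

-- The tautological section of `H_l` over the space `H_l` sends the generator of the torsor `G_i` to
-- a section of `G_i` over `H_l`, that is, to a continuous map `h`. Every other section of `H_l` is
-- a pullback of the tautological one.
variable (𝒜 hG) in
theorem exists_spec (i : G.I) : ∃ l h, 𝒜.Spec hG i l h := by
  obtain ⟨l, hl⟩ := 𝒜.exists_pt (free hG i pt) (tor hG i 1)
  obtain ⟨m', hm⟩ := hl (H.F.obj l).lch (ContinuousMap.id _)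
  obtain ⟨h, rfl⟩ := tor_surjective hG m'
  refine ⟨l, h, fun Z g => ?_⟩
  have := 𝒜.res (LCH.ofC (Z := Z) (Z' := (H.F.obj l).lch) g) hm
  rw [tor_res, tor_res, tor_res] at this
  exact this

/-- The action on constant sections generated by the torsor `G_i`. -/
theorem Spec.orbit {i : G.I} {l : H.I} {h : C(H.F.obj l, G.F.obj i)} (hs : 𝒜.Spec hG i l h)
    {Y : BObj G} (y : Sec (Y.X.obj (op i)) pt) {Z : LCH} (g : C(Z.obj, H.F.obj l)) :
    𝒜.A Y l Z g (Y.incl i (Lichtenbaum.res _ (toPt Z) y))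
      (Y.incl i (Y.act i Z (h.comp g) (Lichtenbaum.res _ (toPt Z) y))) := by
  have := 𝒜.nat (BObj.orbit hG y) (hs Z g)
  rwa [orbit_tor, orbit_tor, Y.act_one] at this

/-- Right multiplication by `h b` is the orbit map of the section `h b` of the torsor, hence
commutes with the action. So `a` sends `h b` to `h a * h b`, while `a * b` sends `1` to `h (a * b)`.
-/
theorem Spec.map_mul {i : G.I} {l : H.I} {h : C(H.F.obj l, G.F.obj i)} (hs : 𝒜.Spec hG i l h)
    (a b : H.F.obj l) : h (a * b) = h a * h b := by
  have h1 := hs pt (ContinuousMap.const _ b)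
  have h2 := hs.orbit (Y := free hG i pt)
    (freeMk hG i ((h.comp (ContinuousMap.const _ b)).prodMk (LCH.toC (toPt pt)))) (Z := pt)
    (ContinuousMap.const _ a)
  rw [toPt_unique (toPt pt) (𝟙 pt), res_id, act_freeMk] at h2
  have h3 := 𝒜.det (𝒜.mul h1 h2) (hs pt _)
  have := tor_injective hG h3
  exact (congrArg (fun f => f star) this).symm

/-- The morphism at one level. -/
def Spec.hom {i : G.I} {l : H.I} {h : C(H.F.obj l, G.F.obj i)} (hs : 𝒜.Spec hG i l h) :
    H.F.obj l ⟶ G.F.obj i :=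
  ({ MonoidHom.mk' h hs.map_mul with continuous_toFun := h.continuous } :
    H.F.obj l →ₜ* G.F.obj i)

/-- Sections of a free object are continuous maps, hence determined at points; over a point each
section at level `i` is the image of the generator of the torsor under an orbit map. -/
theorem Spec.free {i : G.I} {l : H.I} {h : C(H.F.obj l, G.F.obj i)} (hs : 𝒜.Spec hG i l h)
    {Z₀ Z : LCH} (g : C(Z.obj, H.F.obj l)) (a : C(Z.obj, G.F.obj i)) (b : C(Z.obj, Z₀.obj))
    (m') (hm : 𝒜.A (free hG i Z₀) l Z g ((BObj.free hG i Z₀).incl i (freeMk hG i (a.prodMk b))) m') :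
    m' = (BObj.free hG i Z₀).incl i (freeMk hG i ((h.comp g * a).prodMk b)) := by
  obtain ⟨f, rfl⟩ := exists_freeMk hG m'
  congr 2
  ext1 z
  have h1 := 𝒜.res (ptTo z) hm
  have h2 := hs.orbit (Y := BObj.free hG i Z₀) (Lichtenbaum.res _ (ptTo z) (freeMk hG i (a.prodMk b)))
    (Z := pt) (g.comp (LCH.toC (ptTo z)))
  rw [toPt_unique (toPt pt) (𝟙 pt), res_id, incl_res] at h2
  have h3 := 𝒜.det h1 h2
  rw [← incl_res] at h3
  have h4 := incl_injective _ _ h3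
  have e : (h.comp (g.comp (LCH.toC (ptTo z)))) = (h.comp g).comp (LCH.toC (ptTo z)) := rfl
  rw [e, ← BObj.act_res, act_freeMk, freeMk_res, freeMk_res] at h4
  exact congrArg (fun t => t star) (congrArg (repIf.fn (P := Dominates G i i)) h4)

-- The section `y` is the image, under its orbit map, of the universal section of the free object on
-- `Z`, where the action is already known. Because actions are partial, this is done on an open set
-- on which the universal section can be acted upon and `g` lifts to a level where both actions are
-- defined.
include hH in
theorem Spec.realizes {i : G.I} {l : H.I} {h : C(H.F.obj l, G.F.obj i)} (hs : 𝒜.Spec hG i l h)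
    {Y : BObj G} {Z : LCH} (g : C(Z.obj, H.F.obj l)) (y : Sec (Y.X.obj (op i)) Z) (m')
    (hm : 𝒜.A Y l Z g (Y.incl i y) m') : m' = Y.incl i (Y.act i Z (h.comp g) y) := by
  refine sec_ext fun z => ?_
  let x := (BObj.free hG i Z).incl i
    (freeMk hG i ((1 : C(Z.obj, G.F.obj i)).prodMk (ContinuousMap.id Z.obj)))
  obtain ⟨O, hz, l', hl⟩ := 𝒜.exists_act (BObj.free hG i Z) Z x z
  let k := IsCofiltered.min l l'
  let s : k ⟶ l := IsCofiltered.minToLeft l l'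
  let s' : k ⟶ l' := IsCofiltered.minToRight l l'
  obtain ⟨O', hz', n, hn⟩ := hH.lift s g z
  refine ⟨O ⊓ O', ⟨hz, hz'⟩, ?_⟩
  let n' : C((opn (O ⊓ O')).obj, H.F.obj k) := n.comp (LCH.toC (opnLE inf_le_right))
  have hn' : (LCGrp.cont (H.F.map s)).comp n' = g.comp (LCH.toC (opnι (O ⊓ O'))) :=
    ContinuousMap.ext fun t => hn _
  obtain ⟨m'', hm''⟩ := hl _ (opnLE inf_le_left) ((LCGrp.cont (H.F.map s')).comp n')
  rw [opnLE_ι] at hm''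
  have h1 := 𝒜.trans s' hm''
  have h2 : 𝒜.A Y k _ n' _ _ := 𝒜.trans s (hn' ▸ 𝒜.res (opnι (O ⊓ O')) hm)
  have hx : Lichtenbaum.res _ (opnι (O ⊓ O')) x = (BObj.free hG i Z).incl i
      (freeMk hG i ((1 : C((opn (O ⊓ O')).obj, G.F.obj i)).prodMk (LCH.toC (opnι (O ⊓ O'))))) := by
    rw [← incl_res]
    rfl
  have h3 := (hs.trans s).free n' 1 (LCH.toC (opnι (O ⊓ O'))) m'' (hx ▸ h1)
  have hy : onSec ((BObj.forget G).map (BObj.orbit hG y)) x = Y.incl i y := by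
    refine (forget_orbit hG y _).trans ?_
    rw [orbitVal_one]
  have h4 := 𝒜.nat (BObj.orbit hG y) h1
  rw [onSec_res, hy] at h4
  rw [𝒜.det h2 h4, h3, forget_orbit, ← incl_res, BObj.act_res, orbitVal]
  congr 2
  have e : (h.comp (LCGrp.cont (H.F.map s))).comp n' = (h.comp g).comp (LCH.toC (opnι (O ⊓ O'))) := by
    rw [ContinuousMap.comp_assoc, hn']
    rfl
  have e' : ContinuousMap.fst.comp (((h.comp (LCGrp.cont (H.F.map s))).comp n' * 1).prodMk
      (LCH.toC (opnι (O ⊓ O')))) = (h.comp (LCGrp.cont (H.F.map s))).comp n' := by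
    ext t
    exact mul_one _
  rw [e', e]

theorem Spec.mk_eq {i : G.I} {l l' : H.I} {h : C(H.F.obj l, G.F.obj i)}
    {h' : C(H.F.obj l', G.F.obj i)} (hs : 𝒜.Spec hG i l h) (hs' : 𝒜.Spec hG i l' h') :
    Pro.To.mk l hs.hom = Pro.To.mk (X := H) l' hs'.hom := by
  refine Pro.To.mk_eq_mk_iff.2 ⟨_, IsCofiltered.minToLeft l l', IsCofiltered.minToRight l l', ?_⟩
  apply LCGrp.hom_ext
  intro x
  exact congrArg (fun f => f x) ((hs.trans _).eq (hs'.trans _))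

theorem Spec.map {i j : G.I} {l : H.I} {h : C(H.F.obj l, G.F.obj i)} (hs : 𝒜.Spec hG i l h)
    (s : i ⟶ j) : 𝒜.Spec hG j l ((LCGrp.cont (G.F.map s)).comp h) := by
  intro Z g
  have h1 := hs.orbit (Y := BObj.free hG j pt) (onSec ((BObj.free hG j pt).X.map s.op)
    (freeMk hG j ((1 : C(pt.obj, G.F.obj j)).prodMk (LCH.toC (toPt pt))))) g
  rw [← onSec_res, incl_act_trans, incl_map, freeMk_res] at h1
  have := act_freeMk hG ((LCGrp.cont (G.F.map s)).comp (h.comp g)) 1 (LCH.toC (toPt Z))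
  rw [mul_one] at this
  rw [tor, tor, ContinuousMap.comp_assoc, ← this]
  exact h1

/-- A morphism which gives the action has the values prescribed on the torsors. -/
theorem Realizes.val_eq {φ : H ⟶ G} (hφ : 𝒜.Realizes φ) {i : G.I} {l : H.I}
    {h : C(H.F.obj l, G.F.obj i)} (hs : 𝒜.Spec hG i l h) : φ.val i = Pro.To.mk l hs.hom := by
  obtain ⟨k, f, hf⟩ := (φ.val i).exists_rep
  rw [hf]
  refine Pro.To.mk_eq_mk_iff.2 ⟨_, IsCofiltered.minToLeft k l, IsCofiltered.minToRight k l, ?_⟩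
  apply LCGrp.hom_ext
  intro x
  have h1 := (hs.trans (IsCofiltered.minToRight k l)) pt (ContinuousMap.const _ x)
  have h2 := hφ _ i _ (H.F.map (IsCofiltered.minToLeft k l) ≫ f)
    (by rw [hf, Pro.To.mk_eq]) _ _ _ _ h1
  rw [act_freeMk, mul_one] at h2
  exact (congrArg (fun t => t star) (tor_injective hG h2)).symm

variable (hG 𝒜) in
include hH hG in
/-- A compatible family of actions is given by a unique morphism of pro-groups. -/
theorem existsUnique_realizes : ∃! φ : H ⟶ G, 𝒜.Realizes φ := by
  choose l h hs using 𝒜.exists_spec hG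
  let φ : H ⟶ G := ⟨fun i => Pro.To.mk (l i) (hs i).hom, fun {i j} s =>
    ((hs i).map s).mk_eq (hs j)⟩
  refine ⟨φ, ?_, ?_⟩
  · intro Y i k f hf Z g y m' hm
    -- The given representative agrees with the chosen one only after refinement to `n`, so `g` has
    -- to be lifted locally to level `n`.
    obtain ⟨n, s, s', e⟩ := Pro.To.mk_eq_mk_iff.1 (show Pro.To.mk (X := H) (l i) (hs i).hom = _ from hf)
    refine sec_ext fun z => ?_
    obtain ⟨O, hz, g', hg'⟩ := hH.lift s' g z
    refine ⟨O, hz, ?_⟩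
    have hg : (LCGrp.cont (H.F.map s')).comp g' = g.comp (LCH.toC (opnι O)) :=
      ContinuousMap.ext fun t => hg' t
    have h1 : 𝒜.A Y n _ g' _ _ := 𝒜.trans s' (hg ▸ 𝒜.res (opnι O) hm)
    rw [← incl_res] at h1
    have h2 := ((hs i).trans s).realizes hH g' _ _ h1
    rw [h2, ← incl_res, BObj.act_res]
    congr 2
    ext t
    have h3 := congrArg (fun f => LCGrp.hom f (g' t)) e
    refine h3.trans ?_
    exact congrArg (LCGrp.hom f) (hg' t)
  · intro ψ hψ
    apply Pro.Hom.ext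
    funext i
    exact hψ.val_eq (hs i)

end ProAction

end Lichtenbaum
namespace Lichtenbaum

open TopologicalSpace Topology

/-! ### Étale schemes over the compactification -/

/-- The spectrum of the complex numbers. -/
noncomputable abbrev SpecC : Scheme.{0} := Spec (CommRingCat.of ℂ)

/-- The point of the spectrum of the complex numbers. -/
noncomputable def SpecC.pt : SpecC := IsLocalRing.closedPoint ℂ

instance : Subsingleton SpecC := inferInstanceAs (Subsingleton (PrimeSpectrum ℂ))

/-- A non-empty scheme of finite type over the complex numbers has a section. -/
theorem exists_section_SpecC {X : Scheme.{0}} [Nonempty X] (f : X ⟶ SpecC)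
    [LocallyOfFiniteType f] [QuasiCompact f] :
    ∃ s : SpecC ⟶ X, s ≫ f = 𝟙 _ := by
  have : CompactSpace X := QuasiCompact.compactSpace_of_compactSpace f
  obtain ⟨x, -, hx⟩ := IsClosed.exists_closed_singleton (isClosed_univ (X := X)) Set.univ_nonempty
  exact ⟨pointOfClosedPoint f x hx, pointOfClosedPoint_comp f x hx⟩

/-- Complex points lift along finite morphisms. -/
theorem exists_lift_SpecC {X Y : Scheme.{0}} (f : X ⟶ Y) [IsFinite f] (y : SpecC ⟶ Y)
    (h : y SpecC.pt ∈ Set.range f) : ∃ x : SpecC ⟶ X, x ≫ f = y := by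
  obtain ⟨x, hx⟩ := h
  obtain ⟨p, -⟩ := Scheme.Pullback.exists_preimage_pullback x SpecC.pt hx
  have : Nonempty ↑(pullback f y) := ⟨p⟩
  obtain ⟨s, hs⟩ := exists_section_SpecC (pullback.snd f y)
  exact ⟨s ≫ pullback.fst f y, by
    rw [Category.assoc, pullback.condition, reassoc_of% hs]⟩

/-- A finite morphism has finitely many complex points over a given one. -/
theorem finite_lifts_SpecC {X Y : Scheme.{0}} (f : X ⟶ Y) [IsFinite f] (y : SpecC ⟶ Y) :
    Finite {x : SpecC ⟶ X // x ≫ f = y} := by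
  have hfin : Finite ↑(pullback f y) := by
    have := (pullback.snd f y).finite_preimage_singleton SpecC.pt
    rw [show (pullback.snd f y) ⁻¹' {SpecC.pt} = Set.univ from
      Set.eq_univ_of_forall fun _ => Subsingleton.elim _ _] at this
    exact Set.finite_univ_iff.1 this
  have : Finite {p : SpecC ⟶ pullback f y // p ≫ pullback.snd f y = 𝟙 _} :=
    Finite.of_equiv _ (pointEquivClosedPoint (pullback.snd f y)).symm
  refine Finite.of_surjective (fun p : {p : SpecC ⟶ pullback f y // p ≫ pullback.snd f y = 𝟙 _} =>
    (⟨p.1 ≫ pullback.fst f y, by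
      rw [Category.assoc, pullback.condition, reassoc_of% p.2]⟩ :
      {x : SpecC ⟶ X // x ≫ f = y})) ?_
  rintro ⟨x, hx⟩
  exact ⟨⟨pullback.lift x (𝟙 _) (by rw [hx, Category.id_comp]), pullback.lift_snd _ _ _⟩,
    Subtype.ext (pullback.lift_fst _ _ _)⟩

/-- Two morphisms to an étale separated scheme from a connected one which agree at a complex point
are equal. -/
theorem eq_of_eq_SpecC {W V U : Scheme.{0}} [ConnectedSpace W] (f : V ⟶ U) [Etale f]
    [IsSeparated f] (a b : W ⟶ V) (h : a ≫ f = b ≫ f) (w : SpecC ⟶ W) (hw : w ≫ a = w ≫ b) :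
    a = b := by
  have l1 : pullback.lift a b h ≫ pullback.fst f f = a := pullback.lift_fst _ _ _
  have l2 : pullback.lift a b h ≫ pullback.snd f f = b := pullback.lift_snd _ _ _
  -- The equalizer of `a` and `b` is the pullback of the diagonal of `f`, which is open since `f` is
  -- étale and closed since `f` is separated. It is non-empty because of `w`, hence is all of the
  -- connected `W`.
  let e := pullback.snd (pullback.diagonal f) (pullback.lift a b h)
  have hcl : IsClopen (Set.range e) :=
    ⟨e.isClosedEmbedding.isClosed_range, e.isOpenEmbedding.isOpen_range⟩
  have hne : (Set.range e).Nonempty := by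
    let s : SpecC ⟶ pullback (pullback.diagonal f) (pullback.lift a b h) :=
      pullback.lift (w ≫ a) w (by
        apply pullback.hom_ext
        · simp [l1]
        · simp [l2, hw])
    exact ⟨_, ⟨s SpecC.pt, rfl⟩⟩
  have : IsIso e := by
    rw [isIso_iff_isOpenImmersion_and_surjective]
    exact ⟨inferInstance, ⟨Set.range_eq_univ.1 (hcl.eq_univ hne)⟩⟩
  rw [← cancel_epi e]
  have h1 : e ≫ a = pullback.fst (pullback.diagonal f) (pullback.lift a b h) := by
    have := congrArg (· ≫ pullback.fst f f) (pullback.condition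
      (f := pullback.diagonal f) (g := pullback.lift a b h))
    simpa [l1, l2] using this.symm
  have h2 : e ≫ b = pullback.fst (pullback.diagonal f) (pullback.lift a b h) := by
    have := congrArg (· ≫ pullback.snd f f) (pullback.condition
      (f := pullback.diagonal f) (g := pullback.lift a b h))
    simpa [l1, l2] using this.symm
  rw [h1, h2]

namespace EtSch

variable {F : Type} [Field F]

attribute [instance] EtSch.etale EtSch.separated EtSch.quasiCompact

section

variable {V U W X : EtSch F} (f : V ⟶ U) (g : W ⟶ U)

instance : Etale (hom f) := by
  have : Etale (hom f ≫ U.str) := by rw [f.comp_str]; infer_instance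
  exact Etale.of_comp (hom f) U.str

instance : IsSeparated (hom f) := by
  have : IsSeparated (hom f ≫ U.str) := by rw [f.comp_str]; infer_instance
  exact IsSeparated.of_comp (hom f) U.str

instance : QuasiCompact (hom f) := by
  have : QuasiCompact (hom f ≫ U.str) := by rw [f.comp_str]; infer_instance
  exact QuasiCompact.of_comp (hom f) U.str

@[simp] theorem hom_comp (f : V ⟶ U) (h : U ⟶ X) : hom (f ≫ h) = hom f ≫ hom h := rfl

theorem hom_ext' {f g : V ⟶ U} (h : hom f = hom g) : f = g := Hom.ext h

/-- The fibre product. -/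
noncomputable def pb : EtSch F where
  U := pullback (hom f) (hom g)
  str := pullback.fst (hom f) (hom g) ≫ V.str
  etale := inferInstance
  separated := inferInstance
  quasiCompact := inferInstance
  inf := {y | y ≫ pullback.fst (hom f) (hom g) ∈ V.inf ∧ y ≫ pullback.snd (hom f) (hom g) ∈ W.inf}
  conj_mem y hy := ⟨by
    rw [Category.assoc]
    exact V.conj_mem _ hy.1, by
    rw [Category.assoc]
    exact W.conj_mem _ hy.2⟩
  unramified y hy h := by
    have e : pullback.fst (hom f) (hom g) ≫ V.str = pullback.snd (hom f) (hom g) ≫ W.str := by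
      rw [← f.comp_str, ← g.comp_str, pullback.condition_assoc]
    apply pullback.hom_ext
    · rw [Category.assoc]
      exact V.unramified _ hy.1 (by simpa using h)
    · rw [Category.assoc]
      rw [e] at h
      exact W.unramified _ hy.2 (by simpa using h)

/-- The first projection. -/
noncomputable def pbFst : pb f g ⟶ V := ⟨pullback.fst (hom f) (hom g), rfl, fun _ hy => hy.1⟩

/-- The second projection. -/
noncomputable def pbSnd : pb f g ⟶ W := ⟨pullback.snd (hom f) (hom g), by
  change _ = pullback.fst (hom f) (hom g) ≫ V.str
  rw [← f.comp_str, ← g.comp_str, pullback.condition_assoc]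
  rfl, fun _ hy => hy.2⟩

theorem pb_condition : pbFst f g ≫ f = pbSnd f g ≫ g := hom_ext' pullback.condition

variable {f g} in
/-- The universal property of the fibre product. -/
noncomputable def pbLift (a : X ⟶ V) (b : X ⟶ W) (h : a ≫ f = b ≫ g) : X ⟶ pb f g :=
  ⟨pullback.lift (hom a) (hom b) (congrArg hom h), by
    change _ ≫ pullback.fst _ _ ≫ _ = _
    rw [pullback.lift_fst_assoc, a.comp_str], fun y hy => by
    have e1 : (y ≫ pullback.lift (hom a) (hom b) (congrArg hom h)) ≫ pullback.fst _ _ =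
      y ≫ hom a := by rw [Category.assoc, pullback.lift_fst]
    have e2 : (y ≫ pullback.lift (hom a) (hom b) (congrArg hom h)) ≫ pullback.snd _ _ =
      y ≫ hom b := by rw [Category.assoc, pullback.lift_snd]
    have h1 := a.map_inf _ hy
    have h2 := b.map_inf _ hy
    exact ⟨e1.symm ▸ h1, e2.symm ▸ h2⟩⟩

@[simp] theorem pbLift_fst (a : X ⟶ V) (b : X ⟶ W) (h : a ≫ f = b ≫ g) :
    pbLift a b h ≫ pbFst f g = a := hom_ext' (pullback.lift_fst _ _ _)

@[simp] theorem pbLift_snd (a : X ⟶ V) (b : X ⟶ W) (h : a ≫ f = b ≫ g) :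
    pbLift a b h ≫ pbSnd f g = b := hom_ext' (pullback.lift_snd _ _ _)

variable {f g} in
theorem pb_hom_ext {a b : X ⟶ pb f g} (h : a ≫ pbFst f g = b ≫ pbFst f g)
    (h' : a ≫ pbSnd f g = b ≫ pbSnd f g) : a = b :=
  hom_ext' (pullback.hom_ext (congrArg hom h) (congrArg hom h'))

theorem isPullback_pb : IsPullback (pbFst f g) (pbSnd f g) f g :=
  ⟨⟨pb_condition f g⟩, ⟨PullbackCone.IsLimit.mk _ (fun s => pbLift s.fst s.snd s.condition)
    (fun _ => pbLift_fst _ _ _ _ _) (fun _ => pbLift_snd _ _ _ _ _)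
    fun _ _ h h' => pb_hom_ext (h.trans (pbLift_fst _ _ _ _ _).symm)
      (h'.trans (pbLift_snd _ _ _ _ _).symm)⟩⟩

end

section

variable {V U W X : EtSch F}

theorem IsFiniteEtale.of_isIso (f : V ⟶ U) [IsIso f] : IsFiniteEtale f := by
  have h1 : hom f ≫ hom (inv f) = 𝟙 _ := by rw [← hom_comp, IsIso.hom_inv_id]; rfl
  have h2 : hom (inv f) ≫ hom f = 𝟙 _ := by rw [← hom_comp, IsIso.inv_hom_id]; rfl
  have : IsIso (hom f) := ⟨hom (inv f), h1, h2⟩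
  refine ⟨inferInstance, fun y hy => ?_⟩
  have := (inv f).map_inf _ hy
  change (y ≫ hom f) ≫ hom (inv f) ∈ _ at this
  rwa [Category.assoc, h1, Category.comp_id] at this

theorem IsFiniteEtale.comp {f : V ⟶ U} {h : U ⟶ X} (hf : IsFiniteEtale f) (hh : IsFiniteEtale h) :
    IsFiniteEtale (f ≫ h) := by
  have := hf.1
  have := hh.1
  refine ⟨by rw [hom_comp]; infer_instance, fun y hy => hf.2 _ (hh.2 _ ?_)⟩
  rwa [Category.assoc]

theorem IsFiniteEtale.of_comp {f : V ⟶ U} {h : U ⟶ X} (hfh : IsFiniteEtale (f ≫ h)) :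
    IsFiniteEtale f := by
  have : IsFinite (hom f ≫ hom h) := hfh.1
  refine ⟨IsFinite.of_comp (hom f) (hom h), fun y hy => hfh.2 _ ?_⟩
  have := h.map_inf _ hy
  rwa [Category.assoc] at this

theorem IsFiniteEtale.pbSnd {f : V ⟶ U} (hf : IsFiniteEtale f) (g : W ⟶ U) :
    IsFiniteEtale (pbSnd f g) := by
  have := hf.1
  refine ⟨inferInstanceAs (IsFinite (pullback.snd (hom f) (hom g))), fun y hy => ⟨hf.2 _ ?_, hy⟩⟩
  have e : (y ≫ hom (EtSch.pbFst f g)) ≫ hom f = (y ≫ hom (EtSch.pbSnd f g)) ≫ hom g := by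
    rw [Category.assoc, Category.assoc, ← hom_comp, ← hom_comp, pb_condition]
  exact e.symm ▸ g.map_inf _ hy

theorem IsFiniteEtale.pbFst (f : V ⟶ U) {g : W ⟶ U} (hg : IsFiniteEtale g) :
    IsFiniteEtale (pbFst f g) := by
  have := hg.1
  refine ⟨inferInstanceAs (IsFinite (pullback.fst (hom f) (hom g))), fun y hy => ⟨hy, hg.2 _ ?_⟩⟩
  have e : (y ≫ hom (EtSch.pbFst f g)) ≫ hom f = (y ≫ hom (EtSch.pbSnd f g)) ≫ hom g := by
    rw [Category.assoc, Category.assoc, ← hom_comp, ← hom_comp, pb_condition]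
  exact e ▸ f.map_inf _ hy

theorem IsFiniteEtale.isClopen_range {f : V ⟶ U} (hf : IsFiniteEtale f) :
    IsClopen (Set.range (hom f)) := by
  have := hf.1
  exact ⟨(hom f).isClosedMap.isClosed_range, (hom f).isOpenMap.isOpen_range⟩

theorem IsFiniteEtale.surjective {f : V ⟶ U} (hf : IsFiniteEtale f) (hU : U.Connected)
    [Nonempty V.U] : Function.Surjective (hom f) := by
  have : ConnectedSpace U.U := hU
  exact Set.range_eq_univ.1 (hf.isClopen_range.eq_univ (Set.range_nonempty _))

theorem IsFiniteEtale.exists_lift {f : V ⟶ U} (hf : IsFiniteEtale f) (y : SpecC ⟶ U.U)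
    (h : y SpecC.pt ∈ Set.range (hom f)) : ∃ x, x ≫ hom f = y := by
  have := hf.1
  exact exists_lift_SpecC _ _ h

/-- Surjectivity on scheme points suffices: complex points lift along finite morphisms, and the
archimedean points upstairs are the full preimage of those downstairs. -/
theorem mem_coverings {ι : Type*} (V : ι → EtSch F) (a : ∀ i, V i ⟶ U)
    (ha : ∀ i, IsFiniteEtale (a i)) (h : ∀ x, ∃ i, x ∈ Set.range (hom (a i))) :
    Presieve.ofArrows V a ∈ coverings U := by
  refine ⟨fun x => ?_, fun y hy => ?_⟩
  · obtain ⟨i, z, hz⟩ := h x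
    exact ⟨V i, a i, ⟨i⟩, z, hz⟩
  · obtain ⟨i, hi⟩ := h (y SpecC.pt)
    obtain ⟨z, hz⟩ := (ha i).exists_lift y hi
    exact ⟨V i, a i, ⟨i⟩, z, (ha i).2 _ (hz ▸ hy), hz⟩

/-- An open and closed subscheme, with all its archimedean points. -/
noncomputable def clopen (U : EtSch F) (O : Set U.U) (hO : IsClopen O) : EtSch F where
  U := (⟨O, hO.isOpen⟩ : U.U.Opens)
  str := Scheme.Opens.ι _ ≫ U.str
  etale := inferInstance
  separated := inferInstance
  quasiCompact := by
    have : IsClosedImmersion (Scheme.Opens.ι (⟨O, hO.isOpen⟩ : U.U.Opens)) :=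
      IsClosedImmersion.of_isPreimmersion _ (by simpa using hO.isClosed)
    infer_instance
  inf := {y | y ≫ Scheme.Opens.ι (⟨O, hO.isOpen⟩ : U.U.Opens) ∈ U.inf}
  conj_mem y hy := by
    change (conj ≫ y) ≫ Scheme.Opens.ι (⟨O, hO.isOpen⟩ : U.U.Opens) ∈ U.inf
    rw [Category.assoc]
    exact U.conj_mem _ hy
  unramified y hy h := by
    rw [← cancel_mono (Scheme.Opens.ι _), Category.assoc]
    exact U.unramified _ hy (by simpa using h)

/-- The inclusion of an open and closed subscheme. -/
noncomputable def clopenι (U : EtSch F) (O : Set U.U) (hO : IsClopen O) : clopen U O hO ⟶ U :=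
  ⟨Scheme.Opens.ι _, rfl, fun _ hy => hy⟩

theorem range_clopenι (U : EtSch F) (O : Set U.U) (hO : IsClopen O) :
    Set.range (hom (clopenι U O hO)) = O := Scheme.Opens.range_ι _

instance (U : EtSch F) (O : Set U.U) (hO : IsClopen O) : IsOpenImmersion (hom (clopenι U O hO)) :=
  inferInstanceAs (IsOpenImmersion (Scheme.Opens.ι _))

theorem isFiniteEtale_clopenι (U : EtSch F) (O : Set U.U) (hO : IsClopen O) :
    IsFiniteEtale (clopenι U O hO) := by
  have : IsClosedImmersion (hom (clopenι U O hO)) :=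
    IsClosedImmersion.of_isPreimmersion _ (by rw [range_clopenι]; exact hO.isClosed)
  exact ⟨inferInstance, fun y hy => hy⟩

/-- A complex point of a non-empty étale scheme. -/
theorem exists_SpecC [NumberField F] (U : EtSch F) [Nonempty U.U] : Nonempty (SpecC ⟶ U.U) := by
  obtain ⟨x⟩ := ‹Nonempty U.U›
  obtain ⟨σ⟩ := (inferInstance : Nonempty (F →+* ℂ))
  let j : SpecC ⟶ Spec (CommRingCat.of (NumberField.RingOfIntegers F)) :=
    Spec.map (CommRingCat.ofHom (σ.comp (algebraMap _ F)))
  -- An embedding of `F` into `ℂ` gives a complex point over the generic point of `Spec 𝓞_F`, and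
  -- the generic point lies in every non-empty open set, in particular in the image of the étale map
  -- `U.str`.
  have hj : j SpecC.pt ⤳ U.str x := by
    refine (PrimeSpectrum.le_iff_specializes (j SpecC.pt) (U.str x)).1 ?_
    intro r hr
    have : (σ.comp (algebraMap _ F)) r ∈ SpecC.pt.asIdeal := hr
    have h0 : SpecC.pt.asIdeal = ⊥ := IsLocalRing.maximalIdeal_eq_bot
    rw [h0, Ideal.mem_bot, RingHom.comp_apply, map_eq_zero,
      map_eq_zero_iff _ (FaithfulSMul.algebraMap_injective _ _)] at this
    rw [this]
    exact Ideal.zero_mem _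
  obtain ⟨x', hx'⟩ := hj.mem_open U.str.isOpenMap.isOpen_range ⟨x, rfl⟩
  obtain ⟨p, -⟩ := Scheme.Pullback.exists_preimage_pullback x' SpecC.pt hx'
  have : Nonempty ↑(pullback U.str j) := ⟨p⟩
  obtain ⟨s, -⟩ := exists_section_SpecC (pullback.snd U.str j)
  exact ⟨s ≫ pullback.fst U.str j⟩

end

end EtSch

end Lichtenbaum
-- Splitting finite étale maps, and connected covers
namespace Lichtenbaum

open TopologicalSpace Topology

namespace EtSch

variable {F : Type} [Field F]

/-- The complex points of `V` over a complex point of `U`. -/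
abbrev CFib {V U : EtSch F} (f : V ⟶ U) (c : SpecC ⟶ U.U) := {x : SpecC ⟶ V.U // x ≫ hom f = c}

theorem IsFiniteEtale.finite_cfib {V U : EtSch F} {f : V ⟶ U} (hf : IsFiniteEtale f)
    (c : SpecC ⟶ U.U) : Finite (CFib f c) := by
  have := hf.1
  exact finite_lifts_SpecC _ _

theorem IsFiniteEtale.nonempty_cfib {V U : EtSch F} {f : V ⟶ U} (hf : IsFiniteEtale f)
    (hU : U.Connected) [Nonempty V.U] (c : SpecC ⟶ U.U) : Nonempty (CFib f c) := by
  obtain ⟨x, hx⟩ := hf.exists_lift c (hf.surjective hU _)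
  exact ⟨⟨x, hx⟩⟩

section Split

variable {V U W : EtSch F} (f : V ⟶ U) (w : W ⟶ U)

/-- Disjoint sections of the base change of `V` to `W`. -/
structure Sections (k : ℕ) where
  s : Fin k → (W ⟶ V)
  comp : ∀ d, s d ≫ f = w
  disjoint : ∀ d e, d ≠ e →
    Disjoint (Set.range (hom (pbLift (f := f) (g := w) (s d) (𝟙 W) (by rw [comp, Category.id_comp]))))
      (Set.range (hom (pbLift (f := f) (g := w) (s e) (𝟙 W) (by rw [comp, Category.id_comp]))))

variable {f w}

/-- A section of the base change. -/
noncomputable def Sections.sec {k : ℕ} (S : Sections f w k) (d : Fin k) : W ⟶ pb f w :=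
  pbLift (S.s d) (𝟙 W) (by rw [S.comp, Category.id_comp])

@[simp] theorem Sections.sec_fst {k : ℕ} (S : Sections f w k) (d : Fin k) :
    S.sec d ≫ pbFst f w = S.s d := pbLift_fst _ _ _ _ _

@[simp] theorem Sections.sec_snd {k : ℕ} (S : Sections f w k) (d : Fin k) :
    S.sec d ≫ pbSnd f w = 𝟙 W := pbLift_snd _ _ _ _ _

theorem Sections.disj {k : ℕ} (S : Sections f w k) {d e : Fin k} (h : d ≠ e) :
    Disjoint (Set.range (hom (S.sec d))) (Set.range (hom (S.sec e))) := S.disjoint d e h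

theorem Sections.isFiniteEtale {k : ℕ} (S : Sections f w k) (d : Fin k) :
    IsFiniteEtale (S.sec d) := by
  refine IsFiniteEtale.of_comp (h := EtSch.pbSnd f w) ?_
  rw [S.sec_snd]
  exact IsFiniteEtale.of_isIso _

/-- Lift `c` to a complex point of `W`. Disjoint sections send it to distinct complex points of `V`
over `c`. -/
theorem Sections.le_card {k : ℕ} (S : Sections f w k) (hf : IsFiniteEtale f)
    (hw : IsFiniteEtale w) (hU : U.Connected) [Nonempty W.U] (c : SpecC ⟶ U.U) :
    k ≤ Nat.card (CFib f c) := by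
  have := hf.finite_cfib c
  obtain ⟨x, hx⟩ := hw.nonempty_cfib hU c
  let φ : Fin k → CFib f c := fun d => ⟨x ≫ hom (S.s d), by
    rw [Category.assoc, ← hom_comp, S.comp, hx]⟩
  have hφ : Function.Injective φ := by
    intro d e h
    by_contra hne
    have h1 : x ≫ hom (S.s d) = x ≫ hom (S.s e) := congrArg Subtype.val h
    have h2 : x ≫ hom (S.sec d) = x ≫ hom (S.sec e) := by
      apply pullback.hom_ext (f := hom f) (g := hom w)
      · change (x ≫ hom (S.sec d)) ≫ hom (EtSch.pbFst f w) =
          (x ≫ hom (S.sec e)) ≫ hom (EtSch.pbFst f w)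
        rw [Category.assoc, Category.assoc, ← hom_comp, ← hom_comp, S.sec_fst, S.sec_fst, h1]
      · change (x ≫ hom (S.sec d)) ≫ hom (EtSch.pbSnd f w) =
          (x ≫ hom (S.sec e)) ≫ hom (EtSch.pbSnd f w)
        rw [Category.assoc, Category.assoc, ← hom_comp, ← hom_comp, S.sec_snd, S.sec_snd]
    have hd := Set.disjoint_left.1 (S.disj hne)
    have h3 : (x ≫ hom (S.sec d)) SpecC.pt ∈ Set.range (hom (S.sec e)) := by
      rw [h2]
      exact ⟨x SpecC.pt, by simp⟩
    exact hd ⟨x SpecC.pt, by simp⟩ h3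
  simpa using Nat.card_le_card_of_injective φ hφ

/-- The union of the images of the sections. -/
theorem Sections.isClopen_iUnion {k : ℕ} (S : Sections f w k) :
    IsClopen (⋃ d, Set.range (hom (S.sec d))) :=
  isClopen_iUnion_of_finite fun d => (S.isFiniteEtale d).isClopen_range

/-- Base change to the complement of the given sections in `V ×_U W`, which is open and closed, and
non-empty by hypothesis. Over it the tautological projection to `V` is one more section, disjoint
from the old ones. -/
theorem Sections.exists_succ {k : ℕ} (S : Sections f w k) (hf : IsFiniteEtale f)
    (hw : IsFiniteEtale w) (h : ¬ ∀ x, ∃ d, x ∈ Set.range (hom (S.sec d))) :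
    ∃ (W' : EtSch F) (w' : W' ⟶ U), IsFiniteEtale w' ∧ Nonempty W'.U ∧
      Nonempty (Sections f w' (k + 1)) := by
  push Not at h
  obtain ⟨x, hx⟩ := h
  let O := (⋃ d, Set.range (hom (S.sec d)))ᶜ
  have hO : IsClopen O := S.isClopen_iUnion.compl
  let ι := clopenι (pb f w) O hO
  have hι : IsFiniteEtale ι := isFiniteEtale_clopenι _ _ _
  let r : clopen (pb f w) O hO ⟶ W := ι ≫ EtSch.pbSnd f w
  have hr : IsFiniteEtale r := hι.comp (hf.pbSnd w)
  let s' : Fin (k + 1) → (clopen (pb f w) O hO ⟶ V) :=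
    Fin.cons (ι ≫ EtSch.pbFst f w) fun d => r ≫ S.s d
  have hs' : ∀ d, s' d ≫ f = r ≫ w := by
    intro d
    refine Fin.cases ?_ (fun d => ?_) d
    · change (ι ≫ EtSch.pbFst f w) ≫ f = (ι ≫ EtSch.pbSnd f w) ≫ w
      rw [Category.assoc, pb_condition, Category.assoc]
    · change (r ≫ S.s d) ≫ f = _
      rw [Category.assoc, S.comp]
  -- Disjointness over the new base is checked after mapping to the old fibre product, where the new
  -- section becomes the inclusion of the complement and the old ones stay inside their images.
  let q : pb f (r ≫ w) ⟶ pb f w := pbLift (EtSch.pbFst f (r ≫ w)) (EtSch.pbSnd f (r ≫ w) ≫ r)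
    (by rw [pb_condition]; exact (Category.assoc _ _ _).symm)
  have hq : ∀ (s : clopen (pb f w) O hO ⟶ V) (e : s ≫ f = 𝟙 _ ≫ r ≫ w) (t : _ ⟶ pb f w)
      (_ : t ≫ EtSch.pbFst f w = s) (_ : t ≫ EtSch.pbSnd f w = r), pbLift s (𝟙 _) e ≫ q = t := by
    intro s e t h1 h2
    apply pb_hom_ext
    · rw [Category.assoc, pbLift_fst, pbLift_fst, h1]
    · rw [Category.assoc, pbLift_snd, ← Category.assoc, pbLift_snd, Category.id_comp, h2]
  have key : ∀ {a b : clopen (pb f w) O hO ⟶ pb f (r ≫ w)} {a' b' : clopen (pb f w) O hO ⟶ pb f w},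
      a ≫ q = a' → b ≫ q = b' → Disjoint (Set.range (hom a')) (Set.range (hom b')) →
      Disjoint (Set.range (hom a)) (Set.range (hom b)) := by
    rintro a b _ _ rfl rfl hd
    rw [Set.disjoint_left] at hd ⊢
    rintro y ⟨u, hu⟩ ⟨v, hv⟩
    have h1 : hom q y ∈ Set.range (hom (a ≫ q)) := ⟨u, by simp [hu]⟩
    have h2 : hom q y ∈ Set.range (hom (b ≫ q)) := ⟨v, by simp [hv]⟩
    exact hd h1 h2
  have hold : ∀ d, pbLift (f := f) (g := r ≫ w) (r ≫ S.s d) (𝟙 _)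
      (by rw [Category.assoc, S.comp, Category.id_comp]) ≫ q = r ≫ S.sec d := fun d =>
    hq _ _ _ (by rw [Category.assoc, S.sec_fst]) (by rw [Category.assoc, S.sec_snd, Category.comp_id])
  have hnew : pbLift (f := f) (g := r ≫ w) (ι ≫ EtSch.pbFst f w) (𝟙 _)
      (by rw [Category.assoc, pb_condition, Category.id_comp, Category.assoc]) ≫ q = ι :=
    hq _ _ _ rfl rfl
  have hsub : ∀ d, Set.range (hom (r ≫ S.sec d)) ⊆ Set.range (hom (S.sec d)) := by
    rintro d _ ⟨y, rfl⟩
    exact ⟨hom r y, by simp⟩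
  have hd0 : ∀ d, Disjoint (Set.range (hom ι)) (Set.range (hom (r ≫ S.sec d))) := by
    intro d
    rw [range_clopenι]
    refine Disjoint.mono_right ((hsub d).trans (Set.subset_iUnion (fun d => Set.range (hom (S.sec d))) d)) disjoint_compl_left
  refine ⟨_, r ≫ w, hr.comp hw, ?_, ⟨⟨s', hs', ?_⟩⟩⟩
  · exact ⟨(⟨x, by simpa [O] using hx⟩ : O)⟩
  · intro d e
    refine Fin.cases ?_ (fun d => ?_) d <;> refine Fin.cases ?_ (fun e => ?_) e
    · intro h
      exact absurd rfl h
    · intro _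
      exact key hnew (hold e) (hd0 e)
    · intro _
      exact key (hold d) hnew (hd0 d).symm
    · intro h
      refine key (hold d) (hold e) (Disjoint.mono (hsub d) (hsub e) (S.disj ?_))
      rintro rfl
      exact h rfl

/-- Finite étale maps are split by finite étale coverings. -/
theorem IsFiniteEtale.exists_split [NumberField F] (hf : IsFiniteEtale f) (hU : U.Connected) :
    ∃ (n : ℕ) (W : EtSch F) (w : W ⟶ U), IsFiniteEtale w ∧ Function.Surjective (hom w) ∧
      ∃ S : Sections f w n, ∀ x, ∃ d, x ∈ Set.range (hom (S.sec d)) := by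
  have : ConnectedSpace U.U := hU
  obtain ⟨c⟩ := exists_SpecC U
  by_contra hcon
  push Not at hcon
  -- If no covering splits `f`, a further section can always be added, and eventually there are more
  -- than the cardinality of a fibre.
  have key : ∀ k, ∃ (W : EtSch F) (w : W ⟶ U), IsFiniteEtale w ∧ Nonempty W.U ∧
      Nonempty (Sections f w k) := by
    intro k
    induction k with
    | zero => exact ⟨U, 𝟙 U, IsFiniteEtale.of_isIso _, inferInstance,
        ⟨⟨fun d => d.elim0, fun d => d.elim0, fun d => d.elim0⟩⟩⟩
    | succ k ih =>
      obtain ⟨W, w, hw, hn, ⟨S⟩⟩ := ih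
      refine S.exists_succ hf hw ?_
      push Not
      exact hcon k W w hw (hw.surjective hU) S
  obtain ⟨W, w, hw, hn, ⟨S⟩⟩ := key (Nat.card (CFib f c) + 1)
  have := S.le_card hf hw hU c
  omega

end Split

/-- A property of finite étale covers which passes to one part of each decomposition holds for a
connected cover. -/
theorem exists_connected [NumberField F] {U : EtSch F} (hU : U.Connected)
    (P : ∀ X : EtSch F, (X ⟶ U) → Prop) (hne : ∀ X x, P X x → Nonempty X.U)
    (hstep : ∀ X x, IsFiniteEtale x → P X x → ∀ (O : Set X.U) (hO : IsClopen O),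
      P _ (clopenι X O hO ≫ x) ∨ P _ (clopenι X Oᶜ hO.compl ≫ x))
    (h₀ : ∃ X x, IsFiniteEtale x ∧ P X x) :
    ∃ X x, IsFiniteEtale x ∧ P X x ∧ X.Connected := by
  have : ConnectedSpace U.U := hU
  obtain ⟨c⟩ := exists_SpecC U
  -- Among the covers with the property, one with the fewest complex points over `c` is connected.
  let Q : ℕ → Prop := fun n => ∃ X x, IsFiniteEtale x ∧ P X x ∧ Nat.card (CFib x c) = n
  have hQ : ∃ n, Q n := by
    obtain ⟨X, x, h, h'⟩ := h₀
    exact ⟨_, X, x, h, h', rfl⟩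
  classical
  obtain ⟨X, x, hx, hP, hn⟩ := Nat.find_spec hQ
  have hmin : ∀ m, Q m → Nat.find hQ ≤ m := fun m hm => Nat.find_min' hQ hm
  refine ⟨X, x, hx, hP, ?_⟩
  have hXne := hne _ _ hP
  have hfin := hx.finite_cfib c
  have key : ∀ (O : Set X.U) (hO : IsClopen O), P _ (clopenι X O hO ≫ x) → Oᶜ.Nonempty → False := by
    intro O hO hPO hne'
    have hle := hmin _ ⟨_, _, (isFiniteEtale_clopenι X O hO).comp hx, hPO, rfl⟩
    obtain ⟨p, hp⟩ := hne'
    have : Nonempty (clopen X Oᶜ hO.compl).U := ⟨(⟨p, hp⟩ : (Oᶜ : Set X.U))⟩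
    -- The non-empty complement is finite étale over the connected `U`, hence surjective. It takes
    -- up at least one complex point over `c`, so the fibre of `O` is strictly smaller.
    obtain ⟨y, hy⟩ := ((isFiniteEtale_clopenι X Oᶜ hO.compl).comp hx).nonempty_cfib hU c
    let φ : CFib (clopenι X O hO ≫ x) c → CFib x c := fun z => ⟨z.1 ≫ hom (clopenι X O hO), by
      rw [Category.assoc, ← hom_comp, z.2]⟩
    have hφ : Function.Injective φ := by
      intro z z' h
      apply Subtype.ext
      rw [← cancel_mono (hom (clopenι X O hO))]
      exact congrArg Subtype.val h
    have hlt : Nat.card (CFib (clopenι X O hO ≫ x) c) < Nat.card (CFib x c) := by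
      refine (Nat.card_le_card_of_injective φ hφ).lt_of_ne fun heq => ?_
      have hbij := (Nat.bijective_iff_injective_and_card φ).2 ⟨hφ, heq⟩
      obtain ⟨z, hz⟩ := hbij.2 ⟨y ≫ hom (clopenι X Oᶜ hO.compl), by
        rw [Category.assoc, ← hom_comp, hy]⟩
      have h1 : z.1 ≫ hom (clopenι X O hO) = y ≫ hom (clopenι X Oᶜ hO.compl) :=
        congrArg Subtype.val hz
      have h2 : (z.1 ≫ hom (clopenι X O hO)) SpecC.pt ∈ O := by
        have := (range_clopenι X O hO).le ⟨z.1 SpecC.pt, rfl⟩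
        simpa using this
      have h3 : (y ≫ hom (clopenι X Oᶜ hO.compl)) SpecC.pt ∈ Oᶜ := by
        have := (range_clopenι X Oᶜ hO.compl).le ⟨y SpecC.pt, rfl⟩
        simpa using this
      rw [h1] at h2
      exact h3 h2
    omega
  have : PreconnectedSpace X.U := by
    rw [preconnectedSpace_iff_clopen]
    intro O hO
    by_contra hcon
    push Not at hcon
    rcases hstep X x hx hP O hO with h | h
    · exact key O hO h (Set.nonempty_compl.2 hcon.2)
    · refine key Oᶜ hO.compl h ?_
      rw [compl_compl]
      exact hcon.1
  exact { toNonempty := hXne }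

end EtSch

end Lichtenbaum
namespace Lichtenbaum

open TopologicalSpace Topology

attribute [local simp] prod.lift_fst prod.lift_snd prod.comp_lift

/-! ### Exactness properties of topoi -/

section Topos

variable (E : Type u) [Category.{1} E] [IsTopos E]

instance : HasFiniteCoproducts E := by
  obtain ⟨C, _, J, ⟨e⟩⟩ := IsTopos.exists_site (E := E)
  have : HasFiniteCoproducts (Sheaf J (Type 1)) := FinitaryExtensive.hasFiniteCoproducts
  exact ⟨fun n =>
    have := HasFiniteCoproducts.out (C := Sheaf J (Type 1)) n
    Adjunction.hasColimitsOfShape_of_equivalence e.functor⟩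

instance : FinitaryExtensive E := by
  obtain ⟨C, _, J, ⟨e⟩⟩ := IsTopos.exists_site (E := E)
  exact finitaryExtensive_of_preserves_and_reflects e.functor

variable {E}

/-- For sheaves on a site epimorphisms are the locally surjective maps, and a local preimage under
`c` of the image of a section gives a local preimage in the pullback. -/
theorem epi_of_isPullback {A B C D : E} {a : A ⟶ B} {b : A ⟶ C} {g : B ⟶ D} {c : C ⟶ D}
    (h : IsPullback a b g c) [Epi c] : Epi a := by
  obtain ⟨K, _, J, ⟨e⟩⟩ := IsTopos.exists_site (E := E)
  have h' := h.map e.functor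
  have : Epi (e.functor.map a) := by
    rw [← Sheaf.isLocallySurjective_iff_epi]
    have hc : Sheaf.IsLocallySurjective (e.functor.map c) := by
      rw [Sheaf.isLocallySurjective_iff_epi]
      infer_instance
    constructor
    intro U s
    refine J.superset_covering ?_ (Presheaf.imageSieve_mem J (e.functor.map c).hom
      ((e.functor.map g).hom.app (op U) s))
    rintro V f ⟨z, hz⟩
    have h'' := ((h'.map (sheafToPresheaf _ _)).map ((evaluation _ _).obj (op V)))
    have hn := NatTrans.naturality_apply (e.functor.map g).hom f.op s
    obtain ⟨x, hx, -⟩ := Types.exists_of_isPullback h'' ((e.functor.obj B).obj.map f.op s) z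
      (hn.trans hz.symm)
    exact ⟨x, hx⟩
  exact e.functor.epi_of_epi_map this

theorem epi_of_isPullback' {A B C D : E} {a : A ⟶ B} {b : A ⟶ C} {g : B ⟶ D} {c : C ⟶ D}
    (h : IsPullback a b g c) [Epi g] : Epi b := epi_of_isPullback h.flip

/-- A finite family of epimorphisms has a common refinement. -/
theorem exists_common_refinement {B : E} {n : ℕ} (W : Fin n → E) (c : ∀ d, W d ⟶ B)
    (hc : ∀ d, Epi (c d)) :
    ∃ (X : E) (x : X ⟶ B) (r : ∀ d, X ⟶ W d), Epi x ∧ ∀ d, r d ≫ c d = x := by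
  induction n with
  | zero => exact ⟨B, 𝟙 B, fun d => d.elim0, inferInstance, fun d => d.elim0⟩
  | succ n ih =>
    obtain ⟨X, x, r, hx, hr⟩ := ih (fun d => W d.succ) (fun d => c d.succ) fun d => hc _
    have := hc 0
    have : Epi (pullback.fst x (c 0)) := epi_of_isPullback (IsPullback.of_hasPullback x (c 0))
    refine ⟨pullback x (c 0), pullback.fst _ _ ≫ x,
      Fin.cons (pullback.snd _ _) fun d => pullback.fst _ _ ≫ r d, epi_comp _ _, fun d => ?_⟩
    refine Fin.cases ?_ (fun d => ?_) d
    · exact pullback.condition.symm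
    · change (pullback.fst x (c 0) ≫ r d) ≫ c d.succ = _
      rw [Category.assoc, hr]

end Topos

section Extensive

variable {E : Type u} [Category.{1} E] [FinitaryExtensive E]

theorem isColimit_cofan_of_isPullback {ι : Type*} [Finite ι] {B Q : E} {Y R : ι → E}
    {y : ∀ d, Y d ⟶ B} (hy : IsColimit (Cofan.mk B y)) (f : Q ⟶ B) (k : ∀ d, R d ⟶ Q)
    (r : ∀ d, R d ⟶ Y d) (h : ∀ d, IsPullback (k d) (r d) f (y d)) :
    Nonempty (IsColimit (Cofan.mk Q k)) := by
  refine FinitaryPreExtensive.isUniversal_finiteCoproducts hy (Cofan.mk Q k)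
    (Discrete.natTrans fun d => r d.as) f ?_ ?_ fun d => h d.as
  · ext ⟨d⟩
    exact (h d).w.symm
  · exact NatTrans.Equifibered.of_discrete _

end Extensive

/-! ### Sums of locally constant objects of a slice -/

section SLC

variable {E : Type u} [Category.{1} E] [HasFiniteLimits E] (t : T ⥤ E)

/-- A description of the sums of locally constant objects of a slice in terms of the ambient
category. -/
def SLCOver {A X : E} (x : X ⟶ A) : Prop :=
  ∃ (J S : T) (h : S ⟶ J) (g : X ⟶ t.obj J) (W : E) (u : W ⟶ A) (c : W ⟶ t.obj J) (P : E)
    (a : P ⟶ X) (b : P ⟶ W) (a' : P ⟶ t.obj S),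
    Epi (prod.lift u c) ∧ IsPullback a b (prod.lift x g) (prod.lift u c) ∧
      IsPullback a' b (t.map h) c

theorem isPullback_prod_map_snd {A S J : E} (h : S ⟶ J) :
    IsPullback prod.snd (prod.map (𝟙 A) h) h prod.snd :=
  ⟨⟨by simp⟩, ⟨PullbackCone.IsLimit.mk _ (fun s => prod.lift (s.snd ≫ prod.fst) s.fst)
    (fun s => by simp)
    (fun s => by
      ext
      · simp
      · simpa using s.condition)
    fun s m h1 h2 => by
      ext
      · simp [← h2]
      · simp [← h1]⟩⟩

theorem over_star_hom (A Y : E) : ((Over.star A).obj Y).hom = (prod.fst : A ⨯ Y ⟶ A) :=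
  (Over.star_obj_hom A Y).trans (prod.lift_fst _ _)

theorem over_hom_left {A Y : E} {X : Over A} (g : X ⟶ (Over.star A).obj Y) :
    g.left = prod.lift X.hom (g.left ≫ (prod.snd : A ⨯ Y ⟶ Y)) := by
  apply prod.hom_ext
  · rw [prod.lift_fst, ← Over.w g]
    exact congrArg (g.left ≫ ·) (over_star_hom A Y).symm
  · exact (prod.lift_snd _ _).symm

/-- A morphism to an object coming from the base. -/
noncomputable def toStar {A Y X : E} (x : X ⟶ A) (g : X ⟶ Y) :
    Over.mk x ⟶ (Over.star A).obj Y :=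
  Over.homMk (prod.lift x g) (by rw [over_star_hom]; exact prod.lift_fst _ _)

variable {t}

/-- `Over.star A` sends `Y` to `A ⨯ Y`, so maps into it are pairs of maps; the forgetful functor of
a slice preserves and reflects the pullbacks and epimorphisms concerned. Base change and composition
can then be treated without slices of slices. -/
theorem slc_star_iff {A : E} (X : Over A) : SLC (t ⋙ Over.star A) X ↔ SLCOver t X.hom := by
  constructor
  · rintro ⟨J, g, W, c, S, h, P, a, b, a', hc, h1, h2⟩
    refine ⟨J, S, h, g.left ≫ prod.snd, W.left, W.hom, c.left ≫ prod.snd, P.left, a.left, b.left,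
      a'.left ≫ prod.snd, ?_, ?_, ?_⟩
    · rw [← over_hom_left]
      exact inferInstanceAs (Epi ((Over.forget _).map c))
    · rw [← over_hom_left, ← over_hom_left]
      exact h1.map (Over.forget _)
    · have := (h2.map (Over.forget _))
      exact this.paste_horiz (isPullback_prod_map_snd (t.map h))
  · rintro ⟨J, S, h, g, W, u, c, P, a, b, a', hc, h1, h2⟩
    have hab : a ≫ X.hom = b ≫ u := by
      have := h1.w =≫ prod.fst
      rwa [Category.assoc, Category.assoc, prod.lift_fst, prod.lift_fst] at this
    have hc' : Epi (toStar u c) := by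
      have : Epi ((Over.forget _).map (toStar u c)) := hc
      exact (Over.forget A).epi_of_epi_map this
    have h3 : prod.lift (b ≫ u) a' ≫ prod.map (𝟙 A) (t.map h) = b ≫ prod.lift u c := by
      rw [prod.lift_map, prod.comp_lift, h2.w, Category.comp_id]
    refine ⟨J, toStar X.hom g, Over.mk u, toStar u c, S, h, Over.mk (b ≫ u),
      Over.homMk a hab, Over.homMk b, toStar (b ≫ u) a', hc', ?_, ?_⟩
    · exact IsPullback.of_map (Over.forget A) (by ext1; exact h1.w) h1
    · refine IsPullback.of_map (Over.forget A) (by ext1; exact h3) ?_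
      refine IsPullback.of_right (h₁₂ := prod.snd) (h₂₂ := prod.snd) (v₁₃ := t.map h) ?_ h3
        (isPullback_prod_map_snd (t.map h))
      change IsPullback (prod.lift (b ≫ u) a' ≫ prod.snd) b (t.map h) (prod.lift u c ≫ prod.snd)
      rwa [prod.lift_snd, prod.lift_snd]

/-- If the trivializing object `P` is a finite coproduct of pieces each coming from some `S d`, then
`P` comes from the coproduct of the `S d`: `t` preserves finite coproducts, and these are stable
under pullback. -/
theorem SLCOver.of_cofan [FinitaryExtensive E] [PreservesFiniteCoproducts t] {A X : E} {x : X ⟶ A}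
    {J : T} (g : X ⟶ t.obj J) {W : E} {u : W ⟶ A} {c : W ⟶ t.obj J} {P : E} {a : P ⟶ X} {b : P ⟶ W}
    (hc : Epi (prod.lift u c)) (h : IsPullback a b (prod.lift x g) (prod.lift u c))
    {ι : Type 1} [Finite ι] {Q : ι → E} {i : ∀ d, Q d ⟶ P} (hi : IsColimit (Cofan.mk P i))
    {S : ι → T} {S₀ : T} {s : ∀ d, S d ⟶ S₀} (hs : IsColimit (Cofan.mk S₀ s)) (f : S₀ ⟶ J)
    (a' : ∀ d, Q d ⟶ t.obj (S d))
    (h' : ∀ d, IsPullback (a' d) (i d ≫ b) (t.map (s d ≫ f)) c) : SLCOver t x := by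
  let k : ∀ d, Q d ⟶ pullback (t.map f) c := fun d =>
    pullback.lift (a' d ≫ t.map (s d)) (i d ≫ b) (by
      rw [Category.assoc, ← t.map_comp, (h' d).w])
  have hk1 : ∀ d, k d ≫ pullback.fst _ _ = a' d ≫ t.map (s d) := fun d => pullback.lift_fst _ _ _
  have hk2 : ∀ d, k d ≫ pullback.snd _ _ = i d ≫ b := fun d => pullback.lift_snd _ _ _
  have hk : ∀ d, IsPullback (k d) (a' d) (pullback.fst _ _) (t.map (s d)) := by
    intro d
    refine (IsPullback.of_right (h₁₂ := pullback.snd _ _) (h₂₂ := t.map f) ?_ (hk1 d)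
      (IsPullback.of_hasPullback (t.map f) c).flip)
    rw [hk2, ← t.map_comp]
    exact (h' d).flip
  have ht : IsColimit (Cofan.mk (t.obj S₀) fun d => t.map (s d)) :=
    isColimitCofanMkObjOfIsColimit t _ _ hs
  obtain ⟨hk'⟩ := isColimit_cofan_of_isPullback ht _ k a' hk
  let e : P ≅ pullback (t.map f) c := hi.coconePointUniqueUpToIso hk'
  have he : ∀ d, i d ≫ e.hom = k d := fun d => hi.comp_coconePointUniqueUpToIso_hom hk' ⟨d⟩
  have heb : e.hom ≫ pullback.snd _ _ = b := by
    refine Cofan.IsColimit.hom_ext hi _ _ fun d => ?_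
    change i d ≫ _ = i d ≫ _
    rw [← Category.assoc, he, hk2]
  refine ⟨J, S₀, f, g, W, u, c, P, a, b, e.hom ≫ pullback.fst _ _, hc, h, ?_⟩
  refine IsPullback.of_iso_pullback ⟨?_⟩ e rfl heb
  rw [Category.assoc, pullback.condition, ← heb, Category.assoc]

end SLC

end Lichtenbaum
-- Stability of sums of locally constant objects under base change and finite étale composition
namespace Lichtenbaum

open TopologicalSpace Topology

section SLC

variable {E : Type u} [Category.{1} E]

theorem isPullback_lift [HasFiniteLimits E] {A B X X' J : E} {r : X' ⟶ X} {x' : X' ⟶ B} {x : X ⟶ A}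
    {f : B ⟶ A} (h : IsPullback r x' x f) (g : X ⟶ J) :
    IsPullback r (prod.lift x' (r ≫ g)) (prod.lift x g) (prod.map f (𝟙 J)) := by
  have hw : r ≫ prod.lift x g = prod.lift x' (r ≫ g) ≫ prod.map f (𝟙 J) := by
    rw [prod.lift_map, prod.comp_lift, h.w, Category.comp_id]
  have h1 : ∀ s : PullbackCone (prod.lift x g) (prod.map f (𝟙 J)),
      s.fst ≫ x = (s.snd ≫ prod.fst) ≫ f := fun s => by
    have := s.condition =≫ prod.fst
    rwa [Category.assoc, prod.lift_fst, Category.assoc, prod.map_fst, ← Category.assoc] at this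
  have h2 : ∀ s : PullbackCone (prod.lift x g) (prod.map f (𝟙 J)),
      s.fst ≫ g = s.snd ≫ prod.snd := fun s => by
    have := s.condition =≫ prod.snd
    rwa [Category.assoc, prod.lift_snd, Category.assoc, prod.map_snd, Category.comp_id] at this
  refine ⟨⟨hw⟩, ⟨PullbackCone.IsLimit.mk _ (fun s => h.lift s.fst (s.snd ≫ prod.fst) (h1 s))
    (fun s => h.lift_fst _ _ _) (fun s => ?_) fun s m hm hm' => ?_⟩⟩
  · rw [prod.comp_lift, h.lift_snd, h.lift_fst_assoc]
    apply prod.hom_ext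
    · rw [prod.lift_fst]
    · rw [prod.lift_snd, h2]
  · apply h.hom_ext
    · rw [h.lift_fst, hm]
    · rw [h.lift_snd, ← hm', Category.assoc, prod.lift_fst]

theorem isPullback_prod_map_fst [HasFiniteLimits E] {A S J : E} (h : S ⟶ J) :
    IsPullback prod.fst (prod.map h (𝟙 A)) h prod.fst :=
  ⟨⟨by rw [prod.map_fst]⟩, ⟨PullbackCone.IsLimit.mk _ (fun s => prod.lift s.fst (s.snd ≫ prod.snd))
    (fun s => prod.lift_fst _ _)
    (fun s => by
      apply prod.hom_ext
      · rw [Category.assoc, prod.map_fst, prod.lift_fst_assoc, s.condition]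
      · rw [Category.assoc, prod.map_snd, prod.lift_snd_assoc, Category.comp_id])
    fun s m h1 h2 => by
      apply prod.hom_ext
      · rw [prod.lift_fst, h1]
      · rw [prod.lift_snd, ← h2, Category.assoc, prod.map_snd, Category.comp_id]⟩⟩

variable {t : T ⥤ E} [IsTopos E]

/-- The trivializing epimorphism onto `A ⨯ t J` is pulled back along `f ⨯ J`; the sheaves `S` and
`J` stay the same. -/
theorem SLCOver.of_isPullback {A B X X' : E} {r : X' ⟶ X} {x' : X' ⟶ B} {x : X ⟶ A} {f : B ⟶ A}
    (hr : IsPullback r x' x f) (hx : SLCOver t x) : SLCOver t x' := by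
  obtain ⟨J, S, h, g, W, u, c, P, a, b, a', hc, h1, h2⟩ := hx
  have hW := isPullback_lift (IsPullback.of_hasPullback u f) c
  have hX := isPullback_lift hr g
  have hP := IsPullback.of_hasPullback (prod.lift x' (r ≫ g))
    (prod.lift (pullback.snd u f) (pullback.fst u f ≫ c))
  have hbig := (hP.flip.paste_vert hX.flip)
  rw [← hW.w] at hbig
  let k := h1.lift (pullback.fst (prod.lift x' (r ≫ g))
    (prod.lift (pullback.snd u f) (pullback.fst u f ≫ c)) ≫ r)
    (pullback.snd _ _ ≫ pullback.fst u f) (by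
      rw [Category.assoc, hX.w, reassoc_of% hP.w, Category.assoc, hW.w])
  have hsq : IsPullback k (pullback.snd (prod.lift x' (r ≫ g))
      (prod.lift (pullback.snd u f) (pullback.fst u f ≫ c))) b (pullback.fst u f) := by
    refine IsPullback.of_right (h₁₂ := a) (h₂₂ := prod.lift u c) ?_ (h1.lift_snd _ _ _) h1
    rw [h1.lift_fst]
    exact hbig.flip
  refine ⟨J, S, h, r ≫ g, pullback u f, pullback.snd u f, pullback.fst u f ≫ c, _, _, _, k ≫ a',
    epi_of_isPullback' hW, hP, hsq.paste_horiz h2⟩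

theorem slcOver_id [PreservesFiniteLimits t] (B : E) : SLCOver t (𝟙 B) := by
  have ht : IsTerminal (t.obj (⊤_ T)) := IsTerminal.isTerminalObj t _ terminalIsTerminal
  have hi : IsIso (prod.lift (𝟙 B) (ht.from B)) :=
    ⟨prod.fst, prod.lift_fst _ _, by
      apply prod.hom_ext
      · rw [Category.assoc, prod.lift_fst, Category.id_comp, Category.comp_id]
      · exact ht.hom_ext _ _⟩
  refine ⟨⊤_ T, ⊤_ T, 𝟙 _, ht.from B, B, 𝟙 B, ht.from B, B, 𝟙 B, 𝟙 B, ht.from B, inferInstance,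
    ?_, ?_⟩
  · exact IsPullback.of_horiz_isIso_mono ⟨rfl⟩
  · rw [t.map_id]
    exact IsPullback.of_vert_isIso ⟨by simp⟩

theorem slcOver_fst (A : E) (S : T) : SLCOver t (prod.fst : A ⨯ t.obj S ⟶ A) := by
  have : prod.lift prod.fst prod.snd = 𝟙 (A ⨯ t.obj S) := prod.lift_fst_snd
  refine ⟨S, S, 𝟙 _, prod.snd, A ⨯ t.obj S, prod.fst, prod.snd, _, 𝟙 _, 𝟙 _, prod.snd, ?_, ?_, ?_⟩
  · rw [this]
    infer_instance
  · rw [this]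
    exact IsPullback.of_horiz_isIso ⟨rfl⟩
  · rw [t.map_id]
    exact IsPullback.of_vert_isIso ⟨by simp⟩

/-- After base change along `w` the object `B` is a sum of `n` copies of the base, so `X` splits
into `n` sheets. A cover trivializing all sheets at once makes `X` a sum of `n` copies of `S`, still
over the same `J`. -/
theorem SLCOver.comp [PreservesFiniteCoproducts t] {A B X : E} {x : X ⟶ B} (hx : SLCOver t x)
    {f : B ⟶ A} {W₁ : E} {w : W₁ ⟶ A} [Epi w] {Q : E} {q₁ : Q ⟶ B} {q₂ : Q ⟶ W₁}
    (hQ : IsPullback q₁ q₂ f w) {n : ℕ} {i : Fin n → (W₁ ⟶ Q)} (hi : ∀ d, i d ≫ q₂ = 𝟙 _)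
    (hc : IsColimit (Cofan.mk Q fun d : ULift.{1} (Fin n) => i d.down)) : SLCOver t (x ≫ f) := by
  obtain ⟨J, S, h, g, W, u, c, P, a, b, a', hc', h1, h2⟩ := hx
  -- For each `d`, pull the trivializing epimorphism back along the `d`-th section to get a cover of
  -- `W₁ ⨯ t J`. `X₀` refines all of them, and since `w` is epi it also covers `A ⨯ t J`.
  obtain ⟨X₀, ρ, r, hρ, hr⟩ := exists_common_refinement
    (fun d => pullback (prod.map (i d ≫ q₁) (𝟙 (t.obj J))) (prod.lift u c))
    (fun d => pullback.fst _ _)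
    (fun d => epi_of_isPullback (IsPullback.of_hasPullback _ _))
  obtain ⟨q, hq⟩ : ∃ q : ∀ _ : Fin n, X₀ ⟶ W,
      ∀ d, q d ≫ prod.lift u c = ρ ≫ prod.map (i d ≫ q₁) (𝟙 _) :=
    ⟨fun d => r d ≫ pullback.snd _ _, fun d => by
      rw [← hr d, Category.assoc, Category.assoc, pullback.condition]⟩
  have hqu : ∀ d, q d ≫ u = (ρ ≫ prod.fst) ≫ i d ≫ q₁ := fun d => by
    have := hq d =≫ prod.fst
    rwa [Category.assoc, prod.lift_fst, Category.assoc, prod.map_fst, ← Category.assoc] at this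
  have hqc : ∀ d, q d ≫ c = ρ ≫ prod.snd := fun d => by
    have := hq d =≫ prod.snd
    rwa [Category.assoc, prod.lift_snd, Category.assoc, prod.map_snd, Category.comp_id] at this
  have hu' : prod.lift ((ρ ≫ prod.fst) ≫ w) (ρ ≫ prod.snd) = ρ ≫ prod.map w (𝟙 _) := by
    apply prod.hom_ext
    · rw [prod.lift_fst, Category.assoc, Category.assoc, prod.map_fst]
    · rw [prod.lift_snd, Category.assoc, prod.map_snd, Category.comp_id]
  have hw : Epi (prod.map w (𝟙 (t.obj J))) := by
    exact epi_of_isPullback' (isPullback_prod_map_fst w)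
  have he : Epi (prod.lift ((ρ ≫ prod.fst) ≫ w) (ρ ≫ prod.snd)) := by
    rw [hu']
    exact epi_comp _ _
  obtain ⟨P', a₀, b₀, hP⟩ : ∃ (P' : E) (a₀ : P' ⟶ X) (b₀ : P' ⟶ X₀), IsPullback a₀ b₀
      (prod.lift (x ≫ f) g) (prod.lift ((ρ ≫ prod.fst) ≫ w) (ρ ≫ prod.snd)) :=
    ⟨_, _, _, IsPullback.of_hasPullback _ _⟩
  have hP1 : (a₀ ≫ x) ≫ f = (b₀ ≫ ρ ≫ prod.fst) ≫ w := by
    have := hP.w =≫ prod.fst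
    rw [Category.assoc, prod.lift_fst, Category.assoc b₀, prod.lift_fst] at this
    simpa only [Category.assoc] using this
  have hP2 : a₀ ≫ g = b₀ ≫ ρ ≫ prod.snd := by
    have := hP.w =≫ prod.snd
    rwa [Category.assoc, prod.lift_snd, Category.assoc b₀, prod.lift_snd] at this
  let κ := hQ.lift (a₀ ≫ x) (b₀ ≫ ρ ≫ prod.fst) hP1
  have hκ1 : κ ≫ q₁ = a₀ ≫ x := hQ.lift_fst _ _ _
  have hκ2 : κ ≫ q₂ = b₀ ≫ ρ ≫ prod.fst := hQ.lift_snd _ _ _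
  have h11 : a ≫ x = b ≫ u := by
    have := h1.w =≫ prod.fst
    rwa [Category.assoc, prod.lift_fst, Category.assoc, prod.lift_fst] at this
  have h12 : a ≫ g = b ≫ c := by
    have := h1.w =≫ prod.snd
    rwa [Category.assoc, prod.lift_snd, Category.assoc, prod.lift_snd] at this
  have hcond : ∀ d, (pullback.fst b (q d) ≫ a) ≫ prod.lift (x ≫ f) g =
      pullback.snd b (q d) ≫ prod.lift ((ρ ≫ prod.fst) ≫ w) (ρ ≫ prod.snd) := by
    intro d
    apply prod.hom_ext
    · simp only [Category.assoc, prod.lift_fst]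
      rw [reassoc_of% h11, pullback.condition_assoc, reassoc_of% (hqu d), hQ.w, reassoc_of% (hi d)]
    · simp only [Category.assoc, prod.lift_snd]
      rw [h12, pullback.condition_assoc, hqc]
  let j : ∀ d, pullback b (q d) ⟶ P' := fun d => hP.lift _ _ (hcond d)
  have hja : ∀ d, j d ≫ a₀ = pullback.fst b (q d) ≫ a := fun d => hP.lift_fst _ _ _
  have hjb : ∀ d, j d ≫ b₀ = pullback.snd b (q d) := fun d => hP.lift_snd _ _ _
  -- The part of `P'` lying in the `d`-th sheet is the old trivialization `P` pulled back along `q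
  -- d`.
  have hj : ∀ d, IsPullback (j d) (pullback.snd b (q d) ≫ ρ ≫ prod.fst) κ (i d) := by
    intro d
    have hs1 : ∀ s : PullbackCone κ (i d), s.fst ≫ b₀ ≫ ρ ≫ prod.fst = s.snd := fun s => by
      rw [← hκ2, reassoc_of% s.condition, hi, Category.comp_id]
    have hs : ∀ s : PullbackCone κ (i d), (s.fst ≫ a₀) ≫ prod.lift x g =
        ((s.fst ≫ b₀) ≫ q d) ≫ prod.lift u c := by
      intro s
      apply prod.hom_ext
      · simp only [Category.assoc, prod.lift_fst]
        rw [← hκ1, reassoc_of% s.condition, hqu, ← hs1 s]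
        simp only [Category.assoc]
      · simp only [Category.assoc, prod.lift_snd]
        rw [hqc, hP2]
    refine ⟨⟨?_⟩, ⟨PullbackCone.IsLimit.mk _ (fun s => pullback.lift (h1.lift _ _ (hs s))
      (s.fst ≫ b₀) (h1.lift_snd _ _ _)) (fun s => ?_) (fun s => ?_) fun s m hm hm' => ?_⟩⟩
    · apply hQ.hom_ext
      · rw [Category.assoc, hκ1, reassoc_of% (hja d), h11, pullback.condition_assoc, hqu]
        simp only [Category.assoc]
      · rw [Category.assoc, hκ2, reassoc_of% (hjb d), Category.assoc, hi, Category.comp_id]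
    · apply hP.hom_ext
      · rw [Category.assoc, hja, pullback.lift_fst_assoc, h1.lift_fst]
      · rw [Category.assoc, hjb, pullback.lift_snd]
    · rw [pullback.lift_snd_assoc, Category.assoc, hs1]
    · apply pullback.hom_ext
      · rw [pullback.lift_fst]
        apply h1.hom_ext
        · rw [h1.lift_fst, ← hm, Category.assoc, Category.assoc, hja]
        · rw [h1.lift_snd, ← hm, Category.assoc, Category.assoc, Category.assoc,
            pullback.condition, reassoc_of% (hjb d)]
      · rw [pullback.lift_snd, ← hm, Category.assoc, hjb]
  obtain ⟨hcol⟩ := isColimit_cofan_of_isPullback hc κ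
    (fun d : ULift.{1} (Fin n) => j d.down) _ fun d => hj d.down
  have hT : HasFiniteCoproducts T := inferInstance
  have := hasColimitsOfShape_discrete T (ULift.{1} (Fin n))
  have hS := coproductIsCoproduct fun _ : ULift.{1} (Fin n) => S
  refine SLCOver.of_cofan (J := J) g he hP hcol hS (Cofan.IsColimit.desc hS fun _ => h)
    (fun d => pullback.fst b (q d.down) ≫ a') fun d => ?_
  have hd : Sigma.ι (fun _ : ULift.{1} (Fin n) => S) d ≫ Cofan.IsColimit.desc hS (fun _ => h) = h :=
    Cofan.IsColimit.fac hS _ d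
  rw [hd, hjb, ← hqc d.down]
  exact (IsPullback.of_hasPullback b (q d.down)).flip.paste_vert h2.flip |>.flip

end SLC

end Lichtenbaum
-- Étale schemes as objects of the topoi
namespace Lichtenbaum

open TopologicalSpace Topology

section Yo

variable {F : Type} [Field F]

/-- Morphisms from a represented sheaf are sections. -/
noncomputable def yoEquiv (X : EtSch F) (A : EtTopos F) : ((yo F).obj X ⟶ A) ≃ A.obj.obj (op X) :=
  ((sheafificationAdjunction _ (Type 1)).homEquiv _ _).trans uliftYonedaEquiv.{1}

theorem yoEquiv_comp {X Y : EtSch F} {A : EtTopos F} (f : Y ⟶ X) (φ : (yo F).obj X ⟶ A) :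
    yoEquiv Y A ((yo F).map f ≫ φ) = A.obj.map f.op (yoEquiv X A φ) := by
  have h := (sheafificationAdjunction _ (Type 1)).homEquiv_naturality_left
    (uliftYoneda.{1}.map f) φ
  exact (congrArg uliftYonedaEquiv.{1} h).trans (uliftYonedaEquiv_naturality _ f.op).symm

namespace EtSch

theorem isSheafFor {ι : Type*} {Q : EtSch F} (V : ι → EtSch F) (a : ∀ i, V i ⟶ Q)
    (h : Presieve.ofArrows V a ∈ coverings Q) (A : EtTopos F) :
    Presieve.IsSheafFor A.obj (Presieve.ofArrows V a) := by
  rw [Presieve.isSheafFor_iff_generate]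
  exact ((isSheaf_iff_isSheaf_of_type _ _).1 A.property) _ (Precoverage.generate_mem_toGrothendieck h)

theorem subsingleton_of_isEmpty {Q : EtSch F} (hQ : IsEmpty Q.U) (A : EtTopos F) :
    Subsingleton (A.obj.obj (op Q)) := by
  have h := isSheafFor (Q := Q) (fun i : PEmpty.{1} => i.elim) (fun i => i.elim)
    ⟨fun x => hQ.elim x, fun y _ => hQ.elim (y SpecC.pt)⟩ A
  rw [Presieve.isSheafFor_arrows_iff] at h
  obtain ⟨t, -, ht⟩ := h (fun i => i.elim) fun i => i.elim
  exact ⟨fun x y => (ht x fun i => i.elim).trans (ht y fun i => i.elim).symm⟩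

variable {Q : EtSch F} {ι : Type 1} {V : ι → EtSch F} {a : ∀ i, V i ⟶ Q}

/-- This is the sheaf condition for the covering: members are monomorphisms and distinct ones have
empty overlap, where sheaves have at most one section, so compatibility of a family is automatic. -/
theorem isColimit_yo (hfe : ∀ i, IsFiniteEtale (a i)) (hs : ∀ x, ∃ i, x ∈ Set.range (hom (a i)))
    (hm : ∀ i, Mono (a i)) (hd : ∀ i j, i ≠ j → Disjoint (Set.range (hom (a i)))
      (Set.range (hom (a j)))) :
    Nonempty (IsColimit (Cofan.mk ((yo F).obj Q) fun i => (yo F).map (a i))) := by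
  have key : ∀ s : Cofan fun i => (yo F).obj (V i),
      ∃! t : s.pt.obj.obj (op Q), ∀ i, s.pt.obj.map (a i).op t = yoEquiv _ _ (s.inj i) := by
    intro s
    have h := isSheafFor V a (mem_coverings V a hfe hs) s.pt
    rw [Presieve.isSheafFor_arrows_iff] at h
    refine h _ fun i j Z gi gj hg => ?_
    by_cases hij : i = j
    · subst hij
      rw [(cancel_mono (a i)).1 hg]
    · refine (subsingleton_of_isEmpty ⟨fun z => ?_⟩ s.pt).elim _ _
      have h1 : hom (gi ≫ a i) z ∈ Set.range (hom (a i)) := ⟨hom gi z, by simp⟩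
      have h2 : hom (gi ≫ a i) z ∈ Set.range (hom (a j)) := ⟨hom gj z, by simp [hg]⟩
      exact Set.disjoint_left.1 (hd i j hij) h1 h2
  refine ⟨Cofan.IsColimit.mk _ (fun s => (yoEquiv Q s.pt).symm (key s).choose) (fun s i => ?_)
    fun s m hm => ?_⟩
  · apply (yoEquiv _ _).injective
    change yoEquiv _ _ ((yo F).map (a i) ≫ _) = _
    rw [yoEquiv_comp, Equiv.apply_symm_apply]
    exact (key s).choose_spec.1 i
  · apply (yoEquiv _ _).injective
    rw [Equiv.apply_symm_apply]
    refine (key s).choose_spec.2 _ fun i => ?_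
    dsimp only
    rw [← yoEquiv_comp]
    exact congrArg _ (hm i)

theorem epi_yo {W : EtSch F} {w : W ⟶ Q} (hw : IsFiniteEtale w)
    (hs : Function.Surjective (hom w)) : Epi ((yo F).map w) := by
  constructor
  intro A φ ψ h
  apply (yoEquiv _ _).injective
  have hA := isSheafFor (fun _ : PUnit.{1} => W) (fun _ => w) (mem_coverings _ _ (fun _ => hw)
    fun x => ⟨PUnit.unit, hs x⟩) A
  refine hA.isSeparatedFor.ext ?_
  rintro _ _ ⟨i⟩
  rw [← yoEquiv_comp, ← yoEquiv_comp, h]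

instance : PreservesFiniteLimits (yo F) :=
  inferInstanceAs (PreservesFiniteLimits (uliftYoneda.{1} ⋙ presheafToSheaf _ (Type 1)))

end EtSch

end Yo

namespace LichtenbaumTopos

open EtSch

variable {F : Type} [Field F] (L : LichtenbaumTopos.{u} F)

instance : PreservesFiniteLimits L.et := by
  have := L.gamma.lex
  exact comp_preservesFiniteLimits _ _

instance : PreservesFiniteLimits L.t.inv := L.t.lex

instance : L.t.inv.IsLeftAdjoint := ⟨_, ⟨L.t.adj⟩⟩

instance : L.gamma.inv.IsLeftAdjoint := ⟨_, ⟨L.gamma.adj⟩⟩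

theorem isColimit_et {Q : EtSch F} {ι : Type 1} {V : ι → EtSch F} {a : ∀ i, V i ⟶ Q}
    (hfe : ∀ i, IsFiniteEtale (a i)) (hs : ∀ x, ∃ i, x ∈ Set.range (hom (a i)))
    (hm : ∀ i, Mono (a i)) (hd : ∀ i j, i ≠ j → Disjoint (Set.range (hom (a i)))
      (Set.range (hom (a j)))) :
    Nonempty (IsColimit (Cofan.mk (L.et.obj Q) fun i => L.et.map (a i))) := by
  obtain ⟨h⟩ := isColimit_yo hfe hs hm hd
  exact ⟨isColimitCofanMkObjOfIsColimit L.gamma.inv _ _ h⟩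

theorem epi_et {Q W : EtSch F} {w : W ⟶ Q} (hw : IsFiniteEtale w)
    (hs : Function.Surjective (hom w)) : Epi (L.et.map w) := by
  have := epi_yo hw hs
  exact inferInstanceAs (Epi (L.gamma.inv.map ((yo F).map w)))

theorem isColimit_sections {V U W : EtSch F} {f : V ⟶ U} {w : W ⟶ U} {n : ℕ}
    (S : Sections f w n) (hS : ∀ x, ∃ d, x ∈ Set.range (hom (S.sec d))) :
    Nonempty (IsColimit (Cofan.mk (L.et.obj (pb f w))
      fun d : ULift.{1} (Fin n) => L.et.map (S.sec d.down))) := by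
  refine L.isColimit_et (fun d => S.isFiniteEtale _) (fun x => ?_) (fun d => ?_) fun d e h => ?_
  · obtain ⟨d, h⟩ := hS x
    exact ⟨⟨d⟩, h⟩
  · exact mono_of_mono_fac (S.sec_snd d.down)
  · exact S.disj fun h' => h (ULift.ext _ _ h')

/-- A splitting of `f` by a finite étale covering is carried by `L.et` to a decomposition to which
`SLCOver.comp` applies. -/
theorem slcOver_comp [NumberField F] {V U : EtSch F} {f : V ⟶ U} (hf : IsFiniteEtale f)
    (hU : U.Connected) {X : L.E} {x : X ⟶ L.et.obj V} (hx : SLCOver L.t.inv x) :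
    SLCOver L.t.inv (x ≫ L.et.map f) := by
  obtain ⟨n, W, w, hw, hws, S, hS⟩ := hf.exists_split hU
  have := L.epi_et hw hws
  obtain ⟨hc⟩ := L.isColimit_sections S hS
  exact hx.comp ((isPullback_pb f w).map L.et) (i := fun d => L.et.map (S.sec d))
    (fun d => by rw [← L.et.map_comp, S.sec_snd, L.et.map_id]) hc

theorem slcOver_et [NumberField F] {V U : EtSch F} {f : V ⟶ U} (hf : IsFiniteEtale f)
    (hU : U.Connected) : SLCOver L.t.inv (L.et.map f) := by
  have := L.slcOver_comp hf hU (slcOver_id (t := L.t.inv) (L.et.obj V))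
  rwa [Category.id_comp] at this

theorem slc_cover [NumberField F] {U : EtSch F} (hU : U.Connected) (V : U.FinEt) :
    SLC (L.str U) ((L.cover U).obj V) :=
  (slc_star_iff _).2 (L.slcOver_et V.property hU)

theorem slc_str (U : EtSch F) (S : T) : SLC (L.str U) ((L.str U).obj S) := by
  refine (slc_star_iff _).2 ?_
  have h : ((L.str U).obj S).hom = _ := over_star_hom (L.et.obj U) (L.t.inv.obj S)
  rw [h]
  exact slcOver_fst _ _

theorem slc_pull {V U : EtSch F} (f : V ⟶ U) {X : L.slice U} (hX : SLC (L.str U) X) :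
    SLC (L.str V) ((L.pull f).obj X) :=
  (slc_star_iff _).2 (SLCOver.of_isPullback (IsPullback.of_hasPullback X.hom (L.et.map f))
    ((slc_star_iff _).1 hX))

theorem slc_map [NumberField F] {V U : EtSch F} {f : V ⟶ U} (hf : IsFiniteEtale f)
    (hU : U.Connected) {X : L.slice V} (hX : SLC (L.str V) X) :
    SLC (L.str U) ((Over.map (L.et.map f)).obj X) :=
  (slc_star_iff _).2 (L.slcOver_comp hf hU ((slc_star_iff _).1 hX))

end LichtenbaumTopos

end Lichtenbaum
namespace Lichtenbaum

open TopologicalSpace Topology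

/-! ### Sections of limits and epimorphisms -/

section Sections

theorem exists_sec_of_isPullback {A B C D : T} {a : A ⟶ B} {b : A ⟶ C} {g : B ⟶ D} {c : C ⟶ D}
    (h : IsPullback a b g c) {Z : LCH} (x : Sec B Z) (y : Sec C Z) (e : onSec g x = onSec c y) :
    ∃ z : Sec A Z, onSec a z = x ∧ onSec b z = y :=
  Types.exists_of_isPullback
    ((h.map (sheafToPresheaf _ _)).map ((evaluation _ (Type 1)).obj (op Z))) x y e

theorem onSec_injective {A B : T} (f : A ⟶ B) [Mono f] {Z : LCH} {x y : Sec A Z}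
    (h : onSec f x = onSec f y) : x = y := by
  have : Mono (((evaluation _ (Type 1)).obj (op Z)).map ((sheafToPresheaf _ _).map f)) :=
    inferInstance
  exact (mono_iff_injective _).1 this h

theorem subsingleton_of_isTerminal {A : T} (hA : IsTerminal A) (Z : LCH) :
    Subsingleton (Sec A Z) := by
  have h := IsTerminal.isTerminalObj ((evaluation _ (Type 1)).obj (op Z)) _
    (IsTerminal.isTerminalObj (sheafToPresheaf _ _) _ hA)
  exact ⟨fun x y => congrFun (congrArg (fun f : PUnit ⟶ A.obj.obj (op Z) => (f : PUnit → _))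
    (h.hom_ext (TypeCat.ofHom fun _ => x) (TypeCat.ofHom fun _ => y))) PUnit.unit⟩

theorem nonempty_of_isTerminal {A : T} (hA : IsTerminal A) (Z : LCH) : Nonempty (Sec A Z) := by
  have h := IsTerminal.isTerminalObj ((evaluation _ (Type 1)).obj (op Z)) _
    (IsTerminal.isTerminalObj (sheafToPresheaf _ _) _ hA)
  exact ⟨(h.from PUnit : PUnit → A.obj.obj (op Z)) PUnit.unit⟩

theorem exists_local_lift {A B : T} (f : A ⟶ B) [Epi f] {Z : LCH} (x : Sec B Z) (z : Z.obj) :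
    ∃ O : Opens Z.obj, z ∈ O ∧ ∃ y : Sec A (opn O), onSec f y = res _ (opnι O) x := by
  have hf : Sheaf.IsLocallySurjective f := (Sheaf.isLocallySurjective_iff_epi f).2 inferInstance
  obtain ⟨O, hz, y, hy⟩ := exists_opn_of_mem (Presheaf.imageSieve_mem openCovers f.hom x) z
  exact ⟨O, hz, y, hy⟩

theorem exists_lift_pt {A B : T} (f : A ⟶ B) [Epi f] (x : Sec B pt) :
    ∃ y : Sec A pt, onSec f y = x := by
  obtain ⟨O, hz, y, hy⟩ := exists_local_lift f x star
  refine ⟨res _ (ptIn hz) y, ?_⟩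
  rw [onSec_res, hy]
  exact (res_ptIn hz x).trans (res_ptTo_pt _ _)

theorem exists_local_lift_cofan {ι : Type 1} {B : T} {A : ι → T} {a : ∀ i, A i ⟶ B}
    (h : IsColimit (Cofan.mk B a)) {Z : LCH} (x : Sec B Z) (z : Z.obj) :
    ∃ O : Opens Z.obj, z ∈ O ∧ ∃ i, ∃ y : Sec (A i) (opn O), onSec (a i) y = res _ (opnι O) x := by
  obtain ⟨O, hz, ⟨i⟩, y, hy⟩ := colimit_locally_surj h x z
  exact ⟨O, hz, i, y, hy⟩

theorem exists_lift_pt_cofan {ι : Type 1} {B : T} {A : ι → T} {a : ∀ i, A i ⟶ B}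
    (h : IsColimit (Cofan.mk B a)) (x : Sec B pt) :
    ∃ i, ∃ y : Sec (A i) pt, onSec (a i) y = x := by
  obtain ⟨O, hz, i, y, hy⟩ := exists_local_lift_cofan h x star
  refine ⟨i, res _ (ptIn hz) y, ?_⟩
  rw [onSec_res, hy]
  exact (res_ptIn hz x).trans (res_ptTo_pt _ _)

end Sections

/-! ### Fibres of finite étale covers -/

section

variable {E : Type u} [Category.{1} E]

theorem isPullback_of_left {X : E} {A B C D : Over X} {a : A ⟶ B} {b : A ⟶ C} {g : B ⟶ D}
    {c : C ⟶ D} (h : IsPullback a.left b.left g.left c.left) : IsPullback a b g c :=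
  IsPullback.of_map (Over.forget X) (by ext1; exact h.w) h

theorem nonempty_isColimit_overMk {ι : Type*} {B X : E} {A : ι → E} {a : ∀ i, A i ⟶ B}
    (h : IsColimit (Cofan.mk B a)) (x : B ⟶ X) :
    Nonempty (IsColimit (Cofan.mk (Over.mk x)
      fun i => (Over.homMk (a i) : Over.mk (a i ≫ x) ⟶ Over.mk x))) :=
  ⟨isColimitOfIsColimitCofanMkObj (Over.forget X) _ _ h⟩

end

namespace EtSch

variable {F : Type} [Field F] {U : EtSch F}

/-- A finite étale cover. -/
abbrev FinEt.mk {V : EtSch F} (f : V ⟶ U) (hf : IsFiniteEtale f) : U.FinEt := ⟨Over.mk f, hf⟩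

/-- A morphism of finite étale covers. -/
abbrev FinEt.homMk {V W : U.FinEt} (a : V.obj.left ⟶ W.obj.left) (h : a ≫ W.obj.hom = V.obj.hom) :
    V ⟶ W := ObjectProperty.homMk (Over.homMk a h)

theorem mono_clopenι (V : EtSch F) (O : Set V.U) (hO : IsClopen O) : Mono (clopenι V O hO) :=
  ⟨fun a b h => hom_ext' (by
    rw [← cancel_mono (hom (clopenι V O hO))]
    exact congrArg hom h)⟩

end EtSch

namespace LichtenbaumTopos

open EtSch

variable {F : Type} [Field F] (L : LichtenbaumTopos.{u} F) {U : EtSch F} (p : TPoint (L.str U))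

attribute [instance] TPoint.isLeftAdjoint TPoint.lex

/-- The inverse image of a finite étale cover at a point. -/
noncomputable abbrev stalk (V : U.FinEt) : T := p.inv.obj ((L.cover U).obj V)

/-- The map on inverse images at a point. -/
noncomputable abbrev stalkMap {V W : U.FinEt} (a : V ⟶ W) : L.stalk p V ⟶ L.stalk p W :=
  p.inv.map ((L.cover U).map a)

theorem isTerminal_stalk_id : Nonempty (IsTerminal (p.inv.obj (Over.mk (𝟙 (L.et.obj U))))) :=
  ⟨IsTerminal.isTerminalObj p.inv _ Over.mkIdTerminal⟩

/-- Split the cover by `W`. The fibre of `W` has a global point, and the `n` sections send it to `n`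
global points of the fibre of `V`. Paired with this point, any section of the fibre of `V` lies
locally in one of the `n` sheets. -/
theorem isFinConst_stalk [NumberField F] (hU : U.Connected) (V : U.FinEt) :
    IsFinConst (L.stalk p V) := by
  obtain ⟨n, W, w, hw, hws, S, hS⟩ := V.property.exists_split hU
  have hepi := L.epi_et hw hws
  obtain ⟨hc⟩ := L.isColimit_sections S hS
  let f := V.obj.hom
  let I : L.slice U := Over.mk (𝟙 (L.et.obj U))
  let Xo : L.slice U := (L.cover U).obj V
  let Wo : L.slice U := Over.mk (L.et.map w)
  let Po : L.slice U := Over.mk (L.et.map (pbFst f w) ≫ L.et.map f)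
  let a : Po ⟶ Xo := Over.homMk (L.et.map (pbFst f w)) rfl
  let b : Po ⟶ Wo := Over.homMk (L.et.map (pbSnd f w)) (by
    change L.et.map (pbSnd f w) ≫ L.et.map w = L.et.map (pbFst f w) ≫ L.et.map f
    rw [← L.et.map_comp, ← L.et.map_comp, pb_condition])
  let x : Xo ⟶ I := Over.homMk (L.et.map f) (Category.comp_id _)
  let y : Wo ⟶ I := Over.homMk (L.et.map w) (Category.comp_id _)
  have h1 : IsPullback (p.inv.map a) (p.inv.map b) (p.inv.map x) (p.inv.map y) :=
    (isPullback_of_left (a := a) (b := b) (g := x) (c := y) ((isPullback_pb f w).map L.et)).map p.inv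
  obtain ⟨h2⟩ := nonempty_isColimit_overMk hc (L.et.map (pbFst f w) ≫ L.et.map f)
  have h3 := isColimitCofanMkObjOfIsColimit p.inv _ _ h2
  obtain ⟨ht⟩ := L.isTerminal_stalk_id p
  have hy : Epi y := by
    have : Epi ((Over.forget _).map y) := hepi
    exact (Over.forget _).epi_of_epi_map this
  have hy' : Epi (p.inv.map y) := inferInstance
  obtain ⟨t₀⟩ := nonempty_of_isTerminal ht pt
  obtain ⟨w₀, -⟩ := exists_lift_pt (p.inv.map y) t₀
  let s (d : Fin n) : Wo ⟶ Xo := Over.homMk (L.et.map (S.s d)) (by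
    change L.et.map (S.s d) ≫ L.et.map f = L.et.map w
    rw [← L.et.map_comp, S.comp])
  refine ⟨Fin n, inferInstance, fun d => onSec (p.inv.map (s d)) w₀, fun Z v z => ?_⟩
  have := subsingleton_of_isTerminal ht Z
  obtain ⟨u, hu, hu'⟩ := exists_sec_of_isPullback h1 v (res _ (toPt Z) w₀) (Subsingleton.elim _ _)
  obtain ⟨O, hz, ⟨d⟩, r, hr⟩ := exists_local_lift_cofan h3 u z
  refine ⟨O, hz, d, ?_⟩
  have e1 : (Over.homMk (L.et.map (S.sec d)) :
      Over.mk (L.et.map (S.sec d) ≫ L.et.map (pbFst f w) ≫ L.et.map f) ⟶ Po) ≫ a =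
      (Over.homMk (L.et.map (S.sec d)) :
      Over.mk (L.et.map (S.sec d) ≫ L.et.map (pbFst f w) ≫ L.et.map f) ⟶ Po) ≫ b ≫ s d := by
    ext1
    change L.et.map (S.sec d) ≫ L.et.map (pbFst f w) =
      L.et.map (S.sec d) ≫ L.et.map (pbSnd f w) ≫ L.et.map (S.s d)
    rw [← L.et.map_comp, ← L.et.map_comp, ← L.et.map_comp, S.sec_fst, ← Category.assoc, S.sec_snd,
      Category.id_comp]
  have e2 := congrArg (fun k => onSec (p.inv.map k) r) e1
  simp only [Functor.map_comp, onSec_comp] at e2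
  rw [hr, onSec_res, hu, onSec_res, hu', res_res, toPt_unique (opnι O ≫ toPt Z) (toPt _)] at e2
  rw [e2, onSec_res]

/-- The points of the fibre of a finite étale cover. -/
abbrev Fibre (V : U.FinEt) : Type 1 := Sec (L.stalk p V) pt

/-- The map on fibres. -/
noncomputable abbrev fibreMap {V W : U.FinEt} (a : V ⟶ W) (x : L.Fibre p V) : L.Fibre p W :=
  onSec (L.stalkMap p a) x

theorem fibreMap_comp {V W X : U.FinEt} (a : V ⟶ W) (b : W ⟶ X) (x : L.Fibre p V) :
    L.fibreMap p (a ≫ b) x = L.fibreMap p b (L.fibreMap p a x) := by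
  rw [fibreMap, stalkMap, Functor.map_comp, Functor.map_comp, onSec_comp]

theorem fibreMap_id {V : U.FinEt} (x : L.Fibre p V) : L.fibreMap p (𝟙 V) x = x := by
  rw [fibreMap, stalkMap, (L.cover U).map_id, p.inv.map_id, onSec_id]

theorem finite_fibre [NumberField F] (hU : U.Connected) (V : U.FinEt) : Finite (L.Fibre p V) :=
  (L.isFinConst_stalk p hU V).finite

theorem exists_fibre_pb (V W : U.FinEt) (x : L.Fibre p V) (y : L.Fibre p W) :
    ∃ (X : U.FinEt) (a : X ⟶ V) (b : X ⟶ W) (z : L.Fibre p X),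
      L.fibreMap p a z = x ∧ L.fibreMap p b z = y := by
  let f := V.obj.hom
  let g := W.obj.hom
  let X : U.FinEt := FinEt.mk (pbFst f g ≫ f) ((IsFiniteEtale.pbFst f W.property).comp V.property)
  let a : X ⟶ V := FinEt.homMk (pbFst f g) rfl
  let b : X ⟶ W := FinEt.homMk (pbSnd f g) (pb_condition f g).symm
  let I : L.slice U := Over.mk (𝟙 (L.et.obj U))
  let a' : (L.cover U).obj V ⟶ I := Over.homMk (L.et.map f) (Category.comp_id _)
  let b' : (L.cover U).obj W ⟶ I := Over.homMk (L.et.map g) (Category.comp_id _)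
  have h : IsPullback (L.stalkMap p a) (L.stalkMap p b) (p.inv.map a') (p.inv.map b') :=
    (isPullback_of_left (a := (L.cover U).map a) (b := (L.cover U).map b) (g := a') (c := b')
      ((isPullback_pb f g).map L.et)).map p.inv
  obtain ⟨ht⟩ := L.isTerminal_stalk_id p
  have := subsingleton_of_isTerminal ht pt
  obtain ⟨z, hz⟩ := exists_sec_of_isPullback h x y (Subsingleton.elim _ _)
  exact ⟨X, a, b, z, hz⟩

theorem exists_fibre_of_cofan {ι : Type 1} (V : U.FinEt) {W : ι → EtSch F}
    (a : ∀ i, W i ⟶ V.obj.left) (hfe : ∀ i, IsFiniteEtale (a i))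
    (hs : ∀ x, ∃ i, x ∈ Set.range (hom (a i)))
    (hm : ∀ i, Mono (a i)) (hd : ∀ i j, i ≠ j → Disjoint (Set.range (hom (a i)))
      (Set.range (hom (a j)))) (x : L.Fibre p V) :
    ∃ i, ∃ y : L.Fibre p (FinEt.mk (a i ≫ V.obj.hom) ((hfe i).comp V.property)),
      L.fibreMap p (FinEt.homMk (a i) rfl) y = x := by
  obtain ⟨h⟩ := L.isColimit_et hfe hs hm hd
  obtain ⟨h'⟩ := nonempty_isColimit_overMk h (L.et.map V.obj.hom)
  obtain ⟨i, y, hy⟩ := exists_lift_pt_cofan (isColimitCofanMkObjOfIsColimit p.inv _ _ h') x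
  let e : Over.mk (L.et.map (a i) ≫ L.et.map V.obj.hom) ≅
      (L.cover U).obj (FinEt.mk (a i ≫ V.obj.hom) ((hfe i).comp V.property)) :=
    Over.isoMk (Iso.refl _) (by
      change 𝟙 _ ≫ L.et.map (a i ≫ V.obj.hom) = _
      rw [Category.id_comp, L.et.map_comp]
      rfl)
  have he : e.hom ≫ (L.cover U).map (FinEt.homMk (a i) rfl) = Over.homMk (L.et.map (a i)) rfl := by
    ext1
    exact Category.id_comp _
  refine ⟨i, onSec (p.inv.map e.hom) y, Eq.trans ?_ hy⟩
  exact (onSec_comp _ _ _).symm.trans ((congrArg (fun k => onSec k y)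
    (p.inv.map_comp _ _).symm).trans (congrArg (fun k => onSec (p.inv.map k) y) he))

/-- An empty scheme is an empty coproduct, and the inverse image at a point preserves coproducts. -/
theorem nonempty_of_fibre (V : U.FinEt) (x : L.Fibre p V) : Nonempty V.obj.left.U := by
  by_contra hV
  rw [not_nonempty_iff] at hV
  obtain ⟨i, -⟩ := L.exists_fibre_of_cofan p (ι := PEmpty.{2}) V (W := fun i => i.elim)
    (fun i => i.elim) (fun i => i.elim) (fun x => hV.elim x) (fun i => i.elim) (fun i => i.elim) x
  exact i.elim

theorem exists_fibre_clopen (V : U.FinEt) (O : Set V.obj.left.U) (hO : IsClopen O)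
    (x : L.Fibre p V) :
    (∃ y : L.Fibre p (FinEt.mk (clopenι _ O hO ≫ V.obj.hom)
        ((isFiniteEtale_clopenι _ _ _).comp V.property)),
      L.fibreMap p (FinEt.homMk (clopenι _ O hO) rfl) y = x) ∨
    ∃ y : L.Fibre p (FinEt.mk (clopenι _ Oᶜ hO.compl ≫ V.obj.hom)
        ((isFiniteEtale_clopenι _ _ _).comp V.property)),
      L.fibreMap p (FinEt.homMk (clopenι _ Oᶜ hO.compl) rfl) y = x := by
  let R : ULift.{1} Bool → {R : Set V.obj.left.U // IsClopen R} := fun i =>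
    bif i.down then ⟨O, hO⟩ else ⟨Oᶜ, hO.compl⟩
  obtain ⟨⟨i⟩, y, hy⟩ := L.exists_fibre_of_cofan p V
    (fun i => clopenι _ (R i).1 (R i).2) (fun i => isFiniteEtale_clopenι _ _ _)
    (fun z => by
      by_cases hz : z ∈ O
      · exact ⟨⟨true⟩, by rw [range_clopenι]; exact hz⟩
      · exact ⟨⟨false⟩, by rw [range_clopenι]; exact hz⟩)
    (fun i => mono_clopenι _ _ _)
    (fun i j hij => by
      rw [range_clopenι, range_clopenι]
      rcases i with ⟨_ | _⟩ <;> rcases j with ⟨_ | _⟩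
      · exact absurd rfl hij
      · exact disjoint_compl_left
      · exact disjoint_compl_right
      · exact absurd rfl hij) x
  cases i
  · exact Or.inr ⟨y, hy⟩
  · exact Or.inl ⟨y, hy⟩

/-- Carrying a point above `x` is a property that passes to one part of every open-closed
decomposition, because `p.inv` preserves coproducts; so `exists_connected` applies. -/
theorem exists_connected_fibre [NumberField F] (hU : U.Connected) (V : U.FinEt) (x : L.Fibre p V) :
    ∃ (W : U.FinEt) (_ : W.obj.left.Connected) (a : W ⟶ V) (w : L.Fibre p W),
      L.fibreMap p a w = x := by
  obtain ⟨X, f, hf, ⟨_, a, w, h⟩, hc⟩ := exists_connected hU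
    (fun X f => ∃ (hf : IsFiniteEtale f) (a : FinEt.mk f hf ⟶ V) (w : L.Fibre p (FinEt.mk f hf)),
      L.fibreMap p a w = x)
    (fun X f ⟨hf, a, w, _⟩ => L.nonempty_of_fibre p _ w)
    (fun X f hf ⟨_, a, w, h⟩ O hO => by
      rcases L.exists_fibre_clopen p (FinEt.mk f hf) O hO w with ⟨y, hy⟩ | ⟨y, hy⟩
      · exact Or.inl ⟨_, FinEt.homMk (W := FinEt.mk f hf) (clopenι X O hO) rfl ≫ a, y,
          (L.fibreMap_comp p _ _ _).trans ((congrArg _ hy).trans h)⟩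
      · exact Or.inr ⟨_, FinEt.homMk (W := FinEt.mk f hf) (clopenι X Oᶜ hO.compl) rfl ≫ a, y,
          (L.fibreMap_comp p _ _ _).trans ((congrArg _ hy).trans h)⟩)
    ⟨_, V.obj.hom, V.property, V.property, 𝟙 V, x, L.fibreMap_id p x⟩
  exact ⟨FinEt.mk f hf, hc, a, w, h⟩

theorem exists_connected_fibre_fin [NumberField F] (hU : U.Connected) {n : ℕ} (V : Fin n → U.FinEt)
    (x : ∀ i, L.Fibre p (V i)) :
    ∃ (W : U.FinEt) (_ : W.obj.left.Connected) (w : L.Fibre p W) (a : ∀ i, W ⟶ V i),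
      ∀ i, L.fibreMap p (a i) w = x i := by
  induction n with
  | zero =>
    obtain ⟨ht⟩ := L.isTerminal_stalk_id p
    obtain ⟨t⟩ := nonempty_of_isTerminal ht pt
    let I : U.FinEt := FinEt.mk (𝟙 U) (IsFiniteEtale.of_isIso _)
    let e : Over.mk (𝟙 (L.et.obj U)) ≅ (L.cover U).obj I := Over.isoMk (Iso.refl _) (by
      change 𝟙 _ ≫ L.et.map (𝟙 U) = _
      rw [Category.id_comp, L.et.map_id]
      rfl)
    exact ⟨I, hU, onSec (p.inv.map e.hom) t, fun i => i.elim0, fun i => i.elim0⟩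
  | succ n ih =>
    obtain ⟨W, -, w, a, ha⟩ := ih (fun i => V i.succ) (fun i => x i.succ)
    obtain ⟨X, b, c, z, hb, hc⟩ := L.exists_fibre_pb p W (V 0) w (x 0)
    obtain ⟨Y, hY, d, y, hd⟩ := L.exists_connected_fibre p hU X z
    refine ⟨Y, hY, y, fun i => Fin.cases (d ≫ c) (fun i => d ≫ b ≫ a i) i, fun i => ?_⟩
    refine Fin.cases ?_ (fun i => ?_) i
    · exact (L.fibreMap_comp p d c y).trans (by rw [hd, hc])
    · refine (L.fibreMap_comp p d (b ≫ a i) y).trans ?_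
      rw [hd, fibreMap_comp, hb, ha]

end LichtenbaumTopos

end Lichtenbaum
namespace Lichtenbaum

open TopologicalSpace Topology BObj

/-! ### Actions transported along injective maps of underlying sheaves -/

/-- Data which make a pro-group `H` act on the sheaves underlying the objects of the classifying
topos of `G`: these are embedded into sheaves underlying objects of the classifying topos of `K`,
on which `H` acts through homomorphisms to the groups of `K`. -/
structure Transport (H G K : Pro LCGrp.{0}) where
  a : H.I → K.I
  τ : ∀ l, H.F.obj l ⟶ K.F.obj (a l)
  exists_map : ∀ {l l' : H.I} (s : l' ⟶ l), ∃ s' : a l' ⟶ a l,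
    H.F.map s ≫ τ l = τ l' ≫ K.F.map s'
  Y₁ : BObj G → BObj K
  θ : ∀ Y, (forget G).obj Y ⟶ (forget K).obj (Y₁ Y)
  injective : ∀ Y Z, Function.Injective (onSec (θ Y) : Sec _ Z → Sec _ Z)
  exists_hom : ∀ {Y Y' : BObj G} (f : Y ⟶ Y'), ∃ k : Y₁ Y ⟶ Y₁ Y',
    (forget G).map f ≫ θ Y' = θ Y ≫ (forget K).map k
  exists_act : ∀ (Y : BObj G) (Z : LCH) (m : Sec ((forget G).obj Y) Z) (z : Z.obj),
    ∃ O : Opens Z.obj, z ∈ O ∧ ∃ (l : H.I) (y : Sec ((Y₁ Y).X.obj (op (a l))) (opn O)),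
      (Y₁ Y).incl (a l) y = res _ (opnι O) (onSec (θ Y) m) ∧
      ∀ (W : LCH) (φ : W ⟶ opn O) (g : C(W.obj, H.F.obj l)), ∃ m',
        onSec (θ Y) m' = (Y₁ Y).incl (a l) ((Y₁ Y).act (a l) W ((LCGrp.cont (τ l)).comp g) (res _ φ y))

/-- The action defined by transport data. -/
def Transport.action {H G K : Pro LCGrp.{0}} (D : Transport H G K) : ProAction H G where
  A Y l Z g m m' := ∃ y : Sec ((D.Y₁ Y).X.obj (op (D.a l))) Z,
    onSec (D.θ Y) m = (D.Y₁ Y).incl (D.a l) y ∧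
    onSec (D.θ Y) m' =
      (D.Y₁ Y).incl (D.a l) ((D.Y₁ Y).act (D.a l) Z ((LCGrp.cont (D.τ l)).comp g) y)
  det := by
    rintro Y l Z g m m' m'' ⟨y, h1, h2⟩ ⟨y', h1', h2'⟩
    obtain rfl := incl_injective _ _ (h1.symm.trans h1')
    exact D.injective _ _ (h2.trans h2'.symm)
  mul := by
    rintro Y l Z g g' m m' m'' ⟨y, h1, h2⟩ ⟨y', h1', h2'⟩
    obtain rfl := incl_injective _ _ (h2.symm.trans h1')
    refine ⟨y, h1, h2'.trans ?_⟩
    rw [← BObj.act_mul]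
    congr 2
    ext z
    exact (map_mul (LCGrp.hom (D.τ l)) (g z) (g' z)).symm
  res := by
    rintro Y l Z g m m' Z' φ ⟨y, h1, h2⟩
    refine ⟨Lichtenbaum.res _ φ y, ?_, ?_⟩
    · rw [onSec_res, h1, incl_res]
    · rw [onSec_res, h2, ← incl_res, BObj.act_res]
      rfl
  trans := by
    rintro Y l l' Z s g m m' ⟨y, h1, h2⟩
    obtain ⟨s', hs⟩ := D.exists_map s
    refine ⟨onSec ((D.Y₁ Y).X.map s'.op) y, by rw [h1, incl_map], ?_⟩
    rw [h2, incl_act_trans]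
    congr 2
    ext z
    exact DFunLike.congr_fun (congrArg LCGrp.hom hs) (g z)
  nat := by
    rintro Y Y' f l Z g m m' ⟨y, h1, h2⟩
    obtain ⟨k, hk⟩ := D.exists_hom f
    have e : ∀ m : Sec ((forget G).obj Y) Z, onSec (D.θ Y') (onSec ((forget G).map f) m) =
        onSec ((forget K).map k) (onSec (D.θ Y) m) := fun m => by
      rw [← onSec_comp, hk, onSec_comp]
    refine ⟨onSec ((Hom.app k).app (op (D.a l))) y, ?_, ?_⟩
    · rw [e, h1, forget_map_incl]
    · rw [e, h2, forget_map_incl, hom_equivariant]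
  exists_act Y Z m z := by
    obtain ⟨O, hz, l, y, hy, h⟩ := D.exists_act Y Z m z
    refine ⟨O, hz, l, fun W φ g => ?_⟩
    obtain ⟨m', hm'⟩ := h W φ g
    exact ⟨m', Lichtenbaum.res _ φ y, by rw [onSec_res, incl_res, hy, res_res], hm'⟩

/-! ### Morphisms of topoi and the induced morphisms of fundamental groups -/

namespace PiOne

variable {E : Type u} [Category.{1} E] {t : T ⥤ E} {p : TPoint t} (R : PiOne t p)

theorem exists_iso {X : E} (hX : SLC t X) : ∃ Y, Nonempty (R.obj Y ≅ X) :=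
  ⟨R.equiv.inverse.obj ⟨X, hX⟩, ⟨(SLC t).ι.mapIso (R.equiv.counitIso.app ⟨X, hX⟩)⟩⟩

theorem slc_obj (Y : BObj R.G) : SLC t (R.obj Y) := (R.equiv.functor.obj Y).property

/-- The action of the equivalence on morphisms. -/
abbrev map {Y Y' : BObj R.G} (k : Y ⟶ Y') : R.obj Y ⟶ R.obj Y' := (R.equiv.functor.map k).hom

/-- The compatibility of the equivalence with the points, for one object. -/
noncomputable def fib (Y : BObj R.G) : p.inv.obj (R.obj Y) ≅ (forget R.G).obj Y := R.fiber.app Y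

theorem fib_naturality {Y Y' : BObj R.G} (k : Y ⟶ Y') :
    p.inv.map (R.map k) ≫ (R.fib Y').hom = (R.fib Y).hom ≫ (forget R.G).map k :=
  R.fiber.hom.naturality k

variable {R}

/-- The morphism of the classifying topos given by a morphism of the topos. -/
noncomputable def lift {Y Y' : BObj R.G} (f : R.obj Y ⟶ R.obj Y') : Y ⟶ Y' :=
  R.equiv.functor.preimage (ObjectProperty.homMk f)

@[simp] theorem map_lift {Y Y' : BObj R.G} (f : R.obj Y ⟶ R.obj Y') : R.map (lift f) = f := by
  rw [map, lift, R.equiv.functor.map_preimage]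
  rfl

theorem fib_lift {Y Y' : BObj R.G} (f : R.obj Y ⟶ R.obj Y') :
    (R.fib Y).hom ≫ (forget R.G).map (lift f) = p.inv.map f ≫ (R.fib Y').hom := by
  rw [← fib_naturality, map_lift]

section Induces

variable {E' : Type*} [Category.{1} E'] {t' : T ⥤ E'} {p' : TPoint t'} {R' : PiOne t' p'}
  {f : E ⥤ E'} (κ : p.inv ≅ f ⋙ p'.inv)

/-- The identification of the fibres of an object and its inverse image. -/
noncomputable def fiberIso {Y : BObj R.G} {Y' : BObj R'.G} (e : f.obj (R.obj Y) ≅ R'.obj Y') :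
    (forget R.G).obj Y ≅ (forget R'.G).obj Y' :=
  (R.fib Y).symm ≪≫ κ.app (R.obj Y) ≪≫ p'.inv.mapIso e ≪≫ R'.fib Y'

theorem fib_fiberIso {Y : BObj R.G} {Y' : BObj R'.G} (e : f.obj (R.obj Y) ≅ R'.obj Y') :
    (R.fib Y).hom ≫ (fiberIso κ e).hom = κ.hom.app (R.obj Y) ≫ p'.inv.map e.hom ≫
      (R'.fib Y').hom :=
  Iso.hom_inv_id_assoc _ _

theorem fiberIso_naturality {Y Y₁ : BObj R.G} {Y' Y₁' : BObj R'.G} (e : f.obj (R.obj Y) ≅ R'.obj Y')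
    (e₁ : f.obj (R.obj Y₁) ≅ R'.obj Y₁') (k : Y ⟶ Y₁) :
    (forget R.G).map k ≫ (fiberIso κ e₁).hom = (fiberIso κ e).hom ≫
      (forget R'.G).map (lift (e.inv ≫ f.map (R.map k) ≫ e₁.hom)) := by
  have h : p.inv.map (R.map k) ≫ κ.hom.app (R.obj Y₁) =
      κ.hom.app (R.obj Y) ≫ p'.inv.map (f.map (R.map k)) := κ.hom.naturality (R.map k)
  rw [← cancel_epi (R.fib Y).hom, ← Category.assoc, ← fib_naturality, Category.assoc, fib_fiberIso,
    ← Category.assoc, h, ← Category.assoc (R.fib Y).hom, fib_fiberIso, Category.assoc,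
    Category.assoc, Category.assoc, fib_lift, ← p'.inv.map_comp_assoc, ← p'.inv.map_comp_assoc,
    Iso.hom_inv_id_assoc]

variable (R R') (hf : ∀ X, SLC t X → SLC t' (f.obj X))

/-- The object of the classifying topos which gives the inverse image. -/
noncomputable def img (Y : BObj R.G) : BObj R'.G := (R'.exists_iso (hf _ (R.slc_obj Y))).choose

/-- The defining property of `img`. -/
noncomputable def imgIso (Y : BObj R.G) : f.obj (R.obj Y) ≅ R'.obj (img R R' hf Y) :=
  (R'.exists_iso (hf _ (R.slc_obj Y))).choose_spec.some.symm

/-- The fundamental group of the source acts on the fibres of inverse images. -/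
noncomputable def transport : Transport R'.G R.G R'.G where
  a l := l
  τ l := 𝟙 _
  exists_map s := ⟨s, by rw [Category.comp_id, Category.id_comp]⟩
  Y₁ Y := img R R' hf Y
  θ Y := (fiberIso κ (imgIso R R' hf Y)).hom
  injective Y Z x y h := onSec_iso_injective _ h
  exists_hom k := ⟨_, fiberIso_naturality κ _ _ k⟩
  exists_act Y Z m z := by
    obtain ⟨O, hz, i, y, hy⟩ := BObj.exists_incl _ (onSec (fiberIso κ (imgIso R R' hf Y)).hom m) z
    refine ⟨O, hz, i, y, hy, fun W φ g => ⟨onSec (fiberIso κ (imgIso R R' hf Y)).inv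
      ((img R R' hf Y).incl i ((img R R' hf Y).act i W g (res _ φ y))), ?_⟩⟩
    rw [← onSec_comp, Iso.inv_hom_id, onSec_id]
    rfl

/-- `Induces` refers to all models of the inverse image and all refinements of levels. Any model is
isomorphic to the chosen `img`, and morphisms of the classifying topos are equivariant, so the
chosen model is enough. -/
theorem induces_iff (φ : R'.G ⟶ R.G) :
    R.Induces R' f κ φ ↔ (transport R R' κ hf).action.Realizes φ := by
  constructor
  · rintro hφ Y i l h hv Z g y m' ⟨y', h1, h2⟩
    apply (transport R R' κ hf).injective
    refine h2.trans ?_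
    have := hφ Y _ (imgIso R R' hf Y) i l h hv l (𝟙 l) Z y y'
      h1 g
    rw [R'.G.F.map_id, Category.id_comp] at this
    exact this.symm
  · intro hφ Y Y' e θ i k h hv l s Z y y' h1 g
    let e₀ := imgIso R R' hf Y
    let n := lift (e.inv ≫ f.map (R.map (𝟙 Y)) ≫ e₀.hom)
    have hn : (fiberIso κ e₀).hom = (fiberIso κ e).hom ≫ (forget R'.G).map n := by
      have := fiberIso_naturality κ e e₀ (𝟙 Y)
      rwa [(forget R.G).map_id, Category.id_comp] at this
    have h1' : onSec (fiberIso κ e).hom (Y.incl i y) = Y'.incl l y' := h1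
    have key := hφ Y i l (R'.G.F.map s ≫ h) (by rw [hv, Pro.To.mk_eq]) Z g y
      (onSec (fiberIso κ e).inv (Y'.incl l (Y'.act l Z g y')))
      ⟨onSec ((Hom.app n).app (op l)) y', by
        change onSec (fiberIso κ e₀).hom _ = _
        rw [hn, onSec_comp, h1', forget_map_incl]
        rfl, by
        change onSec (fiberIso κ e₀).hom _ = _
        rw [hn, onSec_comp, ← onSec_comp (fiberIso κ e).inv, Iso.inv_hom_id, onSec_id,
          forget_map_incl, hom_equivariant]
        rfl⟩
    change onSec (fiberIso κ e).hom _ = _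
    rw [← key, ← onSec_comp, Iso.inv_hom_id, onSec_id]

end Induces

end PiOne

end Lichtenbaum
namespace Lichtenbaum

open TopologicalSpace Topology BObj

/-! ### Fibres of composites `X ⟶ A' ⟶ A` -/

section
variable {E : Type u} [Category.{1} E] [HasPullbacks E] {A' A : E} (u : A' ⟶ A)

/-- The map to the final object of a slice. -/
abbrev bang (X : Over A') : X ⟶ Over.mk (𝟙 A') := Over.homMk X.hom

/-- The pullback of the composite `X ⟶ A' ⟶ A` along `u` is the base change of `X` along the first
projection `A' ×_A A' ⟶ A'`. The diagonal is a section of this projection, so restricting to it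
gives back `X`. -/
theorem isPullback_unit_terminal (X : Over A') :
    IsPullback ((Over.mapPullbackAdj u).unit.app X) (bang X)
      ((Over.pullback u).map ((Over.map u).map (bang X)))
      ((Over.mapPullbackAdj u).unit.app (Over.mk (𝟙 A'))) := by
  apply isPullback_of_left
  have hl : ((Over.pullback u).map ((Over.map u).map (bang X))).left ≫ pullback.fst (𝟙 A' ≫ u) u = pullback.fst (X.hom ≫ u) u ≫ X.hom := by
    simp
    exact pullback.lift_fst _ _ _
  have hr : ((Over.pullback u).map ((Over.map u).map (bang X))).left ≫ pullback.snd (𝟙 A' ≫ u) u = pullback.snd (X.hom ≫ u) u := by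
    simp
    exact pullback.lift_snd _ _ _
  have h1 : IsPullback (pullback.fst (X.hom ≫ u) u) ((Over.pullback u).map ((Over.map u).map (bang X))).left
      X.hom (pullback.fst (𝟙 A' ≫ u) u) := by
    refine IsPullback.of_bot (h₃₁ := u) (v₂₁ := pullback.snd (𝟙 A' ≫ u) u) (v₂₂ := 𝟙 A' ≫ u) ?_ hl.symm (IsPullback.of_hasPullback (𝟙 A' ≫ u) u)
    rw [hr, Category.id_comp]
    exact IsPullback.of_hasPullback (X.hom ≫ u) u
  refine IsPullback.of_right ?_ ?_ h1
  · have e1 : ((Over.mapPullbackAdj u).unit.app X).left ≫ pullback.fst (X.hom ≫ u) u = 𝟙 _ := by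
      simp
      exact pullback.lift_fst _ _ _
    have e2 : ((Over.mapPullbackAdj u).unit.app (Over.mk (𝟙 A'))).left ≫ pullback.fst (𝟙 A' ≫ u) u = 𝟙 _ := by
      simp
      exact pullback.lift_fst _ _ _
    refine (congr_arg₂ (fun a b => IsPullback a _ _ b) e1 e2).mpr ?_
    exact IsPullback.of_horiz_isIso ⟨by simp⟩
  · have := (Over.mapPullbackAdj u).unit.naturality (bang X)
    exact (congrArg CommaMorphism.left this).symm
variable {u} {p : Over A ⥤ T} {p' : Over A' ⥤ T} (κ : p ≅ Over.pullback u ⋙ p')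
/-- The inclusion of the fibre of `X` into the fibre of the composite `X ⟶ A' ⟶ A`. -/
noncomputable def sumIncl (X : Over A') : p'.obj X ⟶ p.obj ((Over.map u).obj X) :=
  p'.map ((Over.mapPullbackAdj u).unit.app X) ≫ κ.inv.app ((Over.map u).obj X)

theorem sumIncl_naturality {X Y : Over A'} (k : X ⟶ Y) :
    p'.map k ≫ sumIncl κ Y = sumIncl κ X ≫ p.map ((Over.map u).map k) := by
  have h := κ.inv.naturality ((Over.map u).map k)
  have h' := (Over.mapPullbackAdj u).unit.naturality k
  dsimp only [Functor.comp_map, Functor.id_map] at h h'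
  rw [sumIncl, sumIncl, Category.assoc, ← h, ← Category.assoc, ← Category.assoc, ← p'.map_comp, ← p'.map_comp, h']

/-- On fibres: the fibre of `X` at `p'` is the part of the fibre of `u_! X` at `p` that lies over
the base point defined by `p'` in the fibre of `A'`. -/
theorem isPullback_sumIncl [PreservesFiniteLimits p'] (X : Over A') :
    IsPullback (sumIncl κ X) (p'.map (bang X))
      (p.map ((Over.map u).map (bang X))) (sumIncl κ (Over.mk (𝟙 A'))) :=
  ((isPullback_unit_terminal u X).map p').paste_horiz
    (IsPullback.of_horiz_isIso ⟨(κ.inv.naturality ((Over.map u).map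
      (bang X))).symm⟩)

theorem sumIncl_counit (X : Over A) :
    sumIncl κ ((Over.pullback u).obj X) ≫ p.map ((Over.mapPullbackAdj u).counit.app X) = κ.inv.app X := by
  have h := κ.inv.naturality ((Over.mapPullbackAdj u).counit.app X)
  have h' := (Over.mapPullbackAdj u).right_triangle_components X
  dsimp only [Functor.comp_map, Functor.id_map] at h h'
  rw [sumIncl, Category.assoc]
  refine (congrArg (fun z => p'.map _ ≫ z) h.symm).trans ?_
  rw [← Category.assoc, ← p'.map_comp]
  refine (congrArg (fun z => p'.map z ≫ _) h').trans ?_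
  rw [p'.map_id]
  exact Category.id_comp _

theorem sumIncl_hom (X : Over A') : sumIncl κ X ≫ κ.hom.app ((Over.map u).obj X) =
    p'.map ((Over.mapPullbackAdj u).unit.app X) := by
  rw [sumIncl, Category.assoc, Iso.inv_hom_id_app]
  exact Category.comp_id _

instance (X : Over A') : Mono ((Over.mapPullbackAdj u).unit.app X) := by
  have : Mono ((Over.mapPullbackAdj u).unit.app X).left := by
    have e1 : ((Over.mapPullbackAdj u).unit.app X).left ≫ pullback.fst (X.hom ≫ u) u = 𝟙 _ := by
      simp
      exact pullback.lift_fst _ _ _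
    have : Mono (((Over.mapPullbackAdj u).unit.app X).left ≫ pullback.fst (X.hom ≫ u) u) := by rw [e1]; infer_instance
    exact mono_of_mono _ (pullback.fst (X.hom ≫ u) u)
  exact Over.mono_of_mono_left _

instance [PreservesFiniteLimits p'] (X : Over A') : Mono (sumIncl κ X) := by
  rw [sumIncl]
  infer_instance

end

namespace PiOne

section

variable {E : Type u} [Category.{1} E] [HasPullbacks E] {A' A : E} {u : A' ⟶ A} {t : T ⥤ Over A}
  {t' : T ⥤ Over A'} {p : TPoint t} {p' : TPoint t'} {R : PiOne t p} {R' : PiOne t' p'}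
  (κ : p.inv ≅ Over.pullback u ⋙ p'.inv)

/-- The fibre of an object as part of the fibre of the composite. -/
noncomputable def sumMap {Y' : BObj R'.G} {Y : BObj R.G}
    (e : R.obj Y ≅ (Over.map u).obj (R'.obj Y')) : (forget R'.G).obj Y' ⟶ (forget R.G).obj Y :=
  (R'.fib Y').inv ≫ sumIncl κ (R'.obj Y') ≫ p.inv.map e.inv ≫ (R.fib Y).hom

theorem fib_sumMap {Y' : BObj R'.G} {Y : BObj R.G}
    (e : R.obj Y ≅ (Over.map u).obj (R'.obj Y')) : (R'.fib Y').hom ≫ sumMap κ e =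
    sumIncl κ (R'.obj Y') ≫ p.inv.map e.inv ≫ (R.fib Y).hom :=
  Iso.hom_inv_id_assoc _ _

instance {Y' : BObj R'.G} {Y : BObj R.G} (e : R.obj Y ≅ (Over.map u).obj (R'.obj Y')) :
    Mono (sumMap κ e) := by
  rw [sumMap]
  infer_instance

theorem sumMap_naturality {Y' Y₁' : BObj R'.G} {Y Y₁ : BObj R.G}
    (e : R.obj Y ≅ (Over.map u).obj (R'.obj Y')) (e₁ : R.obj Y₁ ≅ (Over.map u).obj (R'.obj Y₁'))
    (k : Y' ⟶ Y₁') : (forget R'.G).map k ≫ sumMap κ e₁ =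
      sumMap κ e ≫ (forget R.G).map (lift (e.hom ≫ (Over.map u).map (R'.map k) ≫ e₁.inv)) := by
  rw [← cancel_epi (R'.fib Y').hom, ← Category.assoc, ← fib_naturality, Category.assoc, fib_sumMap,
    ← Category.assoc (p'.inv.map _), sumIncl_naturality, ← Category.assoc (R'.fib Y').hom,
    fib_sumMap, Category.assoc, Category.assoc, Category.assoc, fib_lift,
    ← p.inv.map_comp_assoc e.inv, Iso.inv_hom_id_assoc, p.inv.map_comp, Category.assoc]

/-- The triangle identity read on fibres: the fibre of `Y` embeds into that of `u_! u^* Y`, and the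
counit is a retraction of this embedding. -/
theorem fiberIso_sumMap {Y Y₂ : BObj R.G} {Y' : BObj R'.G}
    (e' : (Over.pullback u).obj (R.obj Y) ≅ R'.obj Y')
    (e : R.obj Y₂ ≅ (Over.map u).obj (R'.obj Y')) :
    (fiberIso κ e').hom ≫ sumMap κ e ≫ (forget R.G).map (lift (e.hom ≫ (Over.map u).map e'.inv ≫
      (Over.mapPullbackAdj u).counit.app (R.obj Y))) = 𝟙 _ := by
  rw [← cancel_epi (R.fib Y).hom, ← Category.assoc, fib_fiberIso, Category.assoc, Category.assoc,
    ← Category.assoc (R'.fib Y').hom, fib_sumMap, Category.assoc, Category.assoc, fib_lift,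
    ← p.inv.map_comp_assoc e.inv, Iso.inv_hom_id_assoc, p.inv.map_comp, Category.assoc,
    ← Category.assoc (sumIncl _ _), ← sumIncl_naturality, Category.assoc,
    ← p'.inv.map_comp_assoc, Iso.hom_inv_id, p'.inv.map_id, Category.id_comp,
    ← Category.assoc (sumIncl _ _)]
  refine (congrArg (fun z => _ ≫ z ≫ _) (sumIncl_counit κ (R.obj Y))).trans ?_
  rw [Iso.hom_inv_id_app_assoc, Category.comp_id]

/-- The inclusion of a fibre into that of `u_! Y'` is, after identification with the fibre of `u^*
u_! Y'`, the unit of the adjunction. It therefore comes from a morphism of the classifying topos of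
`R'.G`. -/
theorem sumMap_fiberIso {Y' Y'' : BObj R'.G} {Y : BObj R.G}
    (e : R.obj Y ≅ (Over.map u).obj (R'.obj Y'))
    (e' : (Over.pullback u).obj (R.obj Y) ≅ R'.obj Y'') :
    sumMap κ e ≫ (fiberIso κ e').hom = (forget R'.G).map (lift
      ((Over.mapPullbackAdj u).unit.app (R'.obj Y') ≫ (Over.pullback u).map e.inv ≫ e'.hom)) := by
  have h : p.inv.map e.inv ≫ κ.hom.app (R.obj Y) =
    κ.hom.app _ ≫ p'.inv.map ((Over.pullback u).map e.inv) := κ.hom.naturality e.inv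
  rw [← cancel_epi (R'.fib Y').hom, ← Category.assoc, fib_sumMap, Category.assoc, Category.assoc,
    fib_fiberIso, fib_lift, ← Category.assoc (p.inv.map e.inv), h, Category.assoc,
    ← Category.assoc (sumIncl _ _), sumIncl_hom]
  simp only [Functor.map_comp, Category.assoc]

section Point

variable {J : BObj R.G} (j : R.obj J ≅ (Over.map u).obj (Over.mk (𝟙 A')))

/-- The map from the fibre of a composite to the fibre of `A'`. -/
noncomputable def toJ {Y' : BObj R'.G} {Y : BObj R.G}
    (e : R.obj Y ≅ (Over.map u).obj (R'.obj Y')) : Y ⟶ J :=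
  lift (e.hom ≫ (Over.map u).map (bang (R'.obj Y')) ≫ j.inv)

/-- The point of the fibre of `A'` given by `p'`. -/
noncomputable def basePt (x : Sec (p'.inv.obj (Over.mk (𝟙 A'))) pt) : Sec ((forget R.G).obj J) pt :=
  onSec (sumIncl κ _ ≫ p.inv.map j.inv ≫ (R.fib J).hom) x

theorem isPullback_sumMap {Y' : BObj R'.G} {Y : BObj R.G}
    (e : R.obj Y ≅ (Over.map u).obj (R'.obj Y')) :
    IsPullback (sumMap κ e) ((R'.fib Y').inv ≫ p'.inv.map (bang (R'.obj Y')))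
      ((forget R.G).map (toJ j e)) (sumIncl κ _ ≫ p.inv.map j.inv ≫ (R.fib J).hom) := by
  have h1 := isPullback_sumIncl κ (R'.obj Y')
  have h2 : IsPullback (p.inv.map e.inv ≫ (R.fib Y).hom) (p.inv.map ((Over.map u).map (bang (R'.obj Y'))))
      ((forget R.G).map (toJ j e)) (p.inv.map j.inv ≫ (R.fib J).hom) :=
    IsPullback.of_horiz_isIso ⟨by
      rw [Category.assoc, toJ, fib_lift, ← p.inv.map_comp_assoc, ← p.inv.map_comp_assoc,
        Iso.inv_hom_id_assoc]⟩
  have h3 := h1.paste_horiz h2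
  refine h3.of_iso (R'.fib Y') (Iso.refl _) (Iso.refl _) (Iso.refl _) ?_ ?_ ?_ ?_
  · rw [fib_sumMap]
    exact Category.comp_id _
  · exact (Category.comp_id _).trans (Iso.hom_inv_id_assoc _ _).symm
  · exact (Category.comp_id _).trans (Category.id_comp _).symm
  · exact (Category.comp_id _).trans (Category.id_comp _).symm

theorem toJ_sumMap {Y' : BObj R'.G} {Y : BObj R.G} (e : R.obj Y ≅ (Over.map u).obj (R'.obj Y'))
    (x : Sec (p'.inv.obj (Over.mk (𝟙 A'))) pt) {Z : LCH} (m : Sec ((forget R'.G).obj Y') Z) :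
    onSec ((forget R.G).map (toJ j e)) (onSec (sumMap κ e) m) = res _ (toPt Z) (basePt κ j x) := by
  have := subsingleton_of_isTerminal (IsTerminal.isTerminalObj p'.inv _ Over.mkIdTerminal) Z
  rw [← onSec_comp, (isPullback_sumMap κ j e).w, onSec_comp, basePt, ← onSec_res]
  exact congrArg _ (Subsingleton.elim _ _)

theorem exists_sumMap {Y' : BObj R'.G} {Y : BObj R.G} (e : R.obj Y ≅ (Over.map u).obj (R'.obj Y'))
    (x : Sec (p'.inv.obj (Over.mk (𝟙 A'))) pt) {Z : LCH} (m : Sec ((forget R.G).obj Y) Z)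
    (h : onSec ((forget R.G).map (toJ j e)) m = res _ (toPt Z) (basePt κ j x)) :
    ∃ m', onSec (sumMap κ e) m' = m := by
  rw [basePt, ← onSec_res] at h
  obtain ⟨m', hm, -⟩ := exists_sec_of_isPullback (isPullback_sumMap κ j e) m _ h
  exact ⟨m', hm⟩

end Point

end

end PiOne

end Lichtenbaum
namespace Lichtenbaum

universe w

open TopologicalSpace Topology BObj

/-! ### Systems of subgroups of finite index -/

theorem HasLocalSections.restrict {X Y : Type w} [TopologicalSpace X] [TopologicalSpace Y]
    {f : X → Y} (hf : HasLocalSections f) (A : Set X) (B : Set Y) (hA : Nonempty A)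
    (h : ∀ x, x ∈ A ↔ f x ∈ B) {f' : A → B} (hf' : ∀ x, (f' x : Y) = f x) :
    HasLocalSections f' := by
  intro y
  obtain ⟨V, hV, hy, σ, hσ, hs⟩ := hf y.1
  classical
  have hS : ∀ z : B, z.1 ∈ V → σ z.1 ∈ A := fun z hz => by
    rw [h, hs z.1 hz]
    exact z.2
  -- The section must be a total function; its values outside `V` are irrelevant, and an arbitrary
  -- element of `A` is used there.
  refine ⟨Subtype.val ⁻¹' V, hV.preimage continuous_subtype_val, hy,
    fun z => if hz : z.1 ∈ V then ⟨σ z.1, hS z hz⟩ else hA.some, ?_, fun z hz => ?_⟩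
  · rw [Topology.IsInducing.subtypeVal.continuousOn_iff]
    refine ContinuousOn.congr (f := fun z : B => σ z.1)
      (hσ.comp continuous_subtype_val.continuousOn fun z hz => hz) fun z hz => ?_
    have hz' : z.1 ∈ V := hz
    simp only [Function.comp_apply, dif_pos hz']
  · have hz' : z.1 ∈ V := hz
    simp only [dif_pos hz']
    exact Subtype.ext ((hf' _).trans (hs z.1 hz'))

namespace FinIndexSystem

/-- The preimages of a closed subgroup of finite index of one group of a strict pro-group. -/
def ofSubgroup {G : Pro LCGrp.{0}} (hG : IsStrict G) {i₀ : G.I} (S₀ : Subgroup (G.F.obj i₀))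
    (hc : IsClosed (S₀ : Set (G.F.obj i₀))) (hf : S₀.FiniteIndex) : FinIndexSystem where
  A := Over i₀
  H := Over.forget i₀ ⋙ G.F
  strict _ _ s := hG s.left
  S α := S₀.comap (LCGrp.hom (G.F.map α.hom) : G.F.obj α.left →* G.F.obj i₀)
  closed α := hc.preimage (LCGrp.hom (G.F.map α.hom)).continuous_toFun
  finiteIndex α := ⟨by
    have h := Subgroup.index_comap_of_surjective S₀
      (f := (LCGrp.hom (G.F.map α.hom) : G.F.obj α.left →* G.F.obj i₀)) (hG.surjective α.hom)
    exact fun h' => hf.1 (h.symm.trans h')⟩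
  comap {α β} s := by
    ext x
    have h := LCGrp.map_comp_apply s.left β.hom x
    rw [Over.w s] at h
    change LCGrp.hom (G.F.map β.hom) (LCGrp.hom (G.F.map s.left) x) ∈ S₀ ↔ _
    rw [← h]
    rfl

variable (P : FinIndexSystem)

instance (α : P.A) : Mono (P.incl.app α) :=
  ⟨fun _ _ h => LCGrp.hom_ext fun x => Subtype.ext
    (DFunLike.congr_fun (congrArg LCGrp.hom h) x)⟩

instance mono_level_incl : Mono (Pro.level P.incl : P.proS ⟶ P.proH) := by
  refine ⟨fun a b h => Pro.Hom.ext (funext fun α => ?_)⟩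
  exact Pro.To.push_injective (P.incl.app α) (congrFun (congrArg Pro.Hom.val h) α)

variable {P} in
theorem strict_sub : IsStrict P.proS := by
  intro α β s
  exact HasLocalSections.restrict (P.strict s) (P.S α : Set (P.H.obj α)) (P.S β : Set (P.H.obj β)) ⟨1⟩
    (fun x => by rw [← P.comap s]; rfl) fun x => rfl

variable {P}

/-- Components factor through the subgroups one at a time. Their compatibility can be checked in the
ambient groups because the inclusions are monomorphisms. -/
theorem exists_lift {X : Pro LCGrp.{0}} (φ : X ⟶ P.proH)
    (h : ∀ α, ∃ l f, φ.val α = Pro.To.mk (X := X) l f ∧ ∀ x, LCGrp.hom f x ∈ P.S α) :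
    ∃ φ' : X ⟶ P.proS, φ' ≫ Pro.level P.incl = φ := by
  choose l f hf hS using h
  let f' (α : P.A) : X.F.obj (l α) ⟶ P.sub.obj α :=
    ({ (MonoidHom.codRestrict (LCGrp.hom (f α) : X.F.obj (l α) →* P.H.obj α) (P.S α) (hS α)) with
        continuous_toFun := by
          exact (LCGrp.hom (f α)).continuous_toFun.subtype_mk _ } : X.F.obj (l α) →ₜ* P.S α)
  have hf' : ∀ α, f' α ≫ P.incl.app α = f α := fun α => rfl
  refine ⟨⟨fun α => Pro.To.mk (l α) (f' α), fun {α β} s => ?_⟩, ?_⟩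
  · apply Pro.To.push_injective (P.incl.app β)
    have := φ.compat s
    rw [hf, hf] at this
    exact this
  · exact Pro.Hom.ext (funext fun α => (hf α).symm)

end FinIndexSystem

/-! ### Stabilizers -/

namespace BObj

variable {G : Pro LCGrp.{0}} (Y : BObj G) {i : G.I} (v : Sec (Y.X.obj (op i)) pt)

/-- The stabilizer of a global section. -/
def stab : Subgroup (G.F.obj i) where
  carrier := {g | Y.act i pt (ContinuousMap.const _ g) v = v}
  one_mem' := Y.act_one i pt v
  mul_mem' {a b} ha hb := by
    change Y.act i pt (ContinuousMap.const _ a * ContinuousMap.const _ b) v = v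
    rw [Y.act_mul, hb, ha]
  inv_mem' {a} ha := by
    have ha' : Y.act i pt (ContinuousMap.const _ a) v = v := ha
    change Y.act i pt (ContinuousMap.const _ a⁻¹) v = v
    conv_lhs => rw [← ha']
    rw [← Y.act_mul]
    refine Eq.trans ?_ (Y.act_one i pt v)
    congr 1
    ext z
    exact inv_mul_cancel a

theorem mem_stab {g : G.F.obj i} : g ∈ Y.stab v ↔ Y.act i pt (ContinuousMap.const _ g) v = v :=
  Iff.rfl

theorem stab_map {k : G.I} (s : k ⟶ i) : Y.stab (onSec (Y.X.map s.op) v) =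
    (Y.stab v).comap (LCGrp.hom (G.F.map s) : G.F.obj k →* G.F.obj i) := by
  ext g
  rw [mem_stab, ← Y.act_trans s pt (ContinuousMap.const _ g) v]
  exact (Y.map_injective s).eq_iff

variable {Y}

/-- Equality of sections of a finite constant sheaf is tested at points, by `eventually_eq`. -/
theorem act_eq_iff (hY : IsFinConst ((forget G).obj Y)) {Z : LCH} (g : C(Z.obj, G.F.obj i)) :
    Y.act i Z g (res _ (toPt Z) v) = res _ (toPt Z) v ↔ ∀ z, g z ∈ Y.stab v := by
  have key : ∀ z, res _ (ptTo z) (Y.act i Z g (res _ (toPt Z) v)) =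
      Y.act i pt (ContinuousMap.const _ (g z)) v := fun z => by
    rw [res_pt_act, res_toPt_pt]
  constructor
  · intro h z
    rw [mem_stab, ← key, h, res_toPt_pt]
  · intro h
    apply incl_injective
    refine sec_ext fun z => hY.eventually_eq ?_
    rw [← incl_res, ← incl_res, key, res_toPt_pt, (Y.mem_stab v).1 (h z)]

/-- If `g z` fixes `v`, the sections `g • v` and `v` of a finite constant sheaf agree at `z`, hence
on a neighbourhood of `z`. -/
theorem isOpen_setOf_mem_stab (hY : IsFinConst ((forget G).obj Y)) {Z : LCH}
    (g : C(Z.obj, G.F.obj i)) : IsOpen {z | g z ∈ Y.stab v} := by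
  have key : ∀ z, res _ (ptTo z) (Y.incl i (Y.act i Z g (res _ (toPt Z) v))) =
      Y.incl i (Y.act i pt (ContinuousMap.const _ (g z)) v) := fun z => by
    rw [← incl_res, res_pt_act, res_toPt_pt]
  have key' : ∀ z, res _ (ptTo z) (Y.incl i (res _ (toPt Z) v)) = Y.incl i v := fun z => by
    rw [← incl_res, res_toPt_pt]
  rw [isOpen_iff_mem_nhds]
  intro z hz
  obtain ⟨O, hO, h⟩ := hY.eventually_eq (z := z)
    (x := Y.incl i (Y.act i Z g (res _ (toPt Z) v))) (y := Y.incl i (res _ (toPt Z) v)) (by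
      rw [key, key']
      exact congrArg _ hz)
  refine Filter.mem_of_superset (O.isOpen.mem_nhds hO) fun z' hz' => ?_
  have h' := congrArg (res _ (ptIn hz')) h
  rw [res_ptIn, res_ptIn, key, key'] at h'
  exact incl_injective _ _ h'

theorem isOpen_stab (hY : IsFinConst ((forget G).obj Y)) : IsOpen (Y.stab v : Set (G.F.obj i)) :=
  isOpen_setOf_mem_stab v hY (Z := (G.F.obj i).lch) (ContinuousMap.id _)

theorem isClosed_stab (hY : IsFinConst ((forget G).obj Y)) :
    IsClosed (Y.stab v : Set (G.F.obj i)) :=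
  Subgroup.isClosed_of_isOpen _ (isOpen_stab v hY)

/-- The coset space is the orbit of `v`, which embeds into the finite fibre. -/
theorem finiteIndex_stab (hY : IsFinConst ((forget G).obj Y)) : (Y.stab v).FiniteIndex := by
  have := hY.finite
  let ι : G.F.obj i ⧸ Y.stab v → Sec ((forget G).obj Y) pt :=
    Quotient.lift (fun g => Y.incl i (Y.act i pt (ContinuousMap.const _ g) v)) (by
      intro a b h
      have h' : Y.act i pt (ContinuousMap.const _ (a⁻¹ * b)) v = v := QuotientGroup.leftRel_apply.1 h
      change Y.incl i _ = Y.incl i _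
      conv_lhs => rw [← h']
      rw [← Y.act_mul]
      congr 2
      ext z
      exact mul_inv_cancel_left a b)
  have hι : Function.Injective ι := by
    rintro ⟨a⟩ ⟨b⟩ h
    refine Quotient.sound (QuotientGroup.leftRel_apply.2 ?_)
    have h' := incl_injective _ _ h
    change Y.act i pt (ContinuousMap.const _ a⁻¹ * ContinuousMap.const _ b) v = v
    rw [Y.act_mul, ← h', ← Y.act_mul]
    refine Eq.trans ?_ (Y.act_one i pt v)
    congr 1
    ext z
    exact inv_mul_cancel a
  have := Finite.of_injective ι hι
  exact Subgroup.finiteIndex_of_finite_quotient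

end BObj

end Lichtenbaum
namespace Lichtenbaum

open TopologicalSpace Topology BObj

/-! ### The presentation of the morphism of fundamental groups -/

namespace BObj

variable {G : Pro LCGrp.{0}} (hG : IsStrict G) {J : BObj G} {i₀ : G.I}
  (v : Sec (J.X.obj (op i₀)) pt) (hJ : IsFinConst ((forget G).obj J))

/-- The stabilizers of a point of a finite fibre. -/
noncomputable def stabSystem : FinIndexSystem :=
  FinIndexSystem.ofSubgroup hG (J.stab v) (isClosed_stab v hJ) (finiteIndex_stab v hJ)

theorem act_stabSystem (α : Over i₀) {Z : LCH} (g : C(Z.obj, (stabSystem hG v hJ).sub.obj α)) :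
    J.act α.left Z ((LCGrp.cont ((stabSystem hG v hJ).incl.app α)).comp g)
      (res _ (toPt Z) (onSec (J.X.map α.hom.op) v)) =
      res _ (toPt Z) (onSec (J.X.map α.hom.op) v) := by
  refine (act_eq_iff _ hJ _).2 fun z => ?_
  rw [stab_map]
  exact (g z).2

/-- The pro-group is isomorphic to the part over `i₀`. -/
noncomputable def stabIso : (stabSystem hG v hJ).proH ≅ G := Pro.sliceIso G i₀

end BObj

namespace PiOne

section

variable {E : Type u} [Category.{1} E] [HasPullbacks E] {A' A : E} {u : A' ⟶ A} {t : T ⥤ Over A}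
  {t' : T ⥤ Over A'} {p : TPoint t} {p' : TPoint t'} (R : PiOne t p) (R' : PiOne t' p')
  (κ : p.inv ≅ Over.pullback u ⋙ p'.inv)
  (hsum : ∀ X, SLC t' X → SLC t ((Over.map u).obj X))
  {J : BObj R.G} (j : R.obj J ≅ (Over.map u).obj (Over.mk (𝟙 A')))
  (x : Sec (p'.inv.obj (Over.mk (𝟙 A'))) pt)
  {i₀ : R.G.I} (v : Sec (J.X.obj (op i₀)) pt) (hv : J.incl i₀ v = basePt κ j x)
  (hJ : IsFinConst ((forget R.G).obj J))

/-- The object of the classifying topos which gives the composite. -/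
noncomputable def sumObj (Y' : BObj R'.G) : BObj R.G :=
  (R.exists_iso (hsum _ (R'.slc_obj Y'))).choose

/-- The defining property of `sumObj`. -/
noncomputable def sumIso (Y' : BObj R'.G) :
    R.obj (sumObj R R' hsum Y') ≅ (Over.map u).obj (R'.obj Y') :=
  (R.exists_iso (hsum _ (R'.slc_obj Y'))).choose_spec.some

include hv in
/-- The stabilizers of the point of the fibre of `A'` act on the fibre over this point. -/
noncomputable def sumTransport : Transport (stabSystem R.strict v hJ).proS R'.G R.G where
  a α := α.left
  τ α := (stabSystem R.strict v hJ).incl.app α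
  exists_map s := ⟨s.left, (stabSystem R.strict v hJ).incl.naturality s⟩
  Y₁ Y' := sumObj R R' hsum Y'
  θ Y' := sumMap κ (sumIso R R' hsum Y')
  injective Y Z _ _ h := onSec_injective _ h
  exists_hom k := ⟨_, sumMap_naturality κ _ _ k⟩
  exists_act Y' Z m z := by
    let e := sumIso R R' hsum Y'
    let Y := sumObj R R' hsum Y'
    obtain ⟨O, hz, i, y, hy⟩ := BObj.exists_incl _ (onSec (sumMap κ e) m) z
    let α : Over i₀ := Over.mk (IsCofiltered.minToRight i i₀)
    let y' := onSec (Y.X.map (IsCofiltered.minToLeft i i₀).op) y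
    have hy' : Y.incl α.left y' = res _ (opnι O) (onSec (sumMap κ e) m) :=
      (incl_map _ (IsCofiltered.minToLeft i i₀) y).trans hy
    -- By `exists_sumMap` the translate stays in the fibre at `p'` if it still lies over the base
    -- point. It does: the map to `J` is equivariant and the acting element stabilizes the base
    -- point.
    refine ⟨O, hz, α, y', hy', fun W φ g => exists_sumMap κ j e x _ ?_⟩
    have h1 : onSec ((Hom.app (toJ j e)).app (op α.left)) (res _ φ y') =
        res _ (toPt W) (onSec (J.X.map α.hom.op) v) := by
      apply incl_injective
      rw [← forget_map_incl, incl_res, hy', res_res, ← onSec_res, toJ_sumMap _ _ _ x,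
        incl_res, incl_map, hv]
    rw [forget_map_incl, hom_equivariant, h1]
    refine (congrArg _ (act_stabSystem R.strict v hJ α g)).trans ?_
    rw [incl_res, incl_map, hv]


variable (hpull : ∀ X, SLC t X → SLC t' ((Over.pullback u).obj X))
  (hterm : SLC t' (Over.mk (𝟙 A')))

-- Inside the fibre of `u^* J`, with `J` corresponding to `u_! 1`, the base point is the image of
-- the terminal object under the unit `1 ⟶ u^* u_! 1`. The terminal object has only one section over
-- any space, so the action on it is trivial, and equivariance makes the base point fixed.
include hterm in
theorem exists_fixed : ∃ (l : R'.G.I) (w : Sec ((img R R' hpull J).X.obj (op l)) pt),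
    (img R R' hpull J).incl l w =
      onSec (fiberIso κ (imgIso R R' hpull J)).hom (basePt κ j x) ∧
    ∀ Z (g : C(Z.obj, R'.G.F.obj l)),
      (img R R' hpull J).act l Z g (res _ (toPt Z) w) = res _ (toPt Z) w := by
  obtain ⟨J', ⟨j'⟩⟩ := R'.exists_iso hterm
  let k := lift (j'.hom ≫ (Over.mapPullbackAdj u).unit.app (Over.mk (𝟙 A')) ≫
    (Over.pullback u).map j.inv ≫ (imgIso R R' hpull J).hom)
  let e : p'.inv.obj (Over.mk (𝟙 A')) ≅ (BObj.forget R'.G).obj J' :=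
    (p'.inv.mapIso j').symm ≪≫ R'.fib J'
  have he : e.hom ≫ (BObj.forget R'.G).map k =
      (sumIncl κ _ ≫ p.inv.map j.inv ≫ (R.fib J).hom) ≫ (fiberIso κ (imgIso R R' hpull J)).hom := by
    have h : p.inv.map j.inv ≫ κ.hom.app (R.obj J) =
      κ.hom.app _ ≫ p'.inv.map ((Over.pullback u).map j.inv) := κ.hom.naturality j.inv
    rw [Category.assoc, Category.assoc, fib_fiberIso, ← Category.assoc (p.inv.map j.inv), h,
      Category.assoc, ← Category.assoc (sumIncl _ _), sumIncl_hom]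
    change (p'.inv.map j'.inv ≫ (R'.fib J').hom) ≫ _ = _
    rw [Category.assoc, fib_lift, ← p'.inv.map_comp_assoc, Iso.inv_hom_id_assoc]
    simp only [Functor.map_comp, Category.assoc]
  obtain ⟨l, y, hy⟩ := J'.exists_incl_pt (onSec e.hom x)
  have hsub (Z : LCH) : Subsingleton (Sec ((BObj.forget R'.G).obj J') Z) := by
    have := subsingleton_of_isTerminal (IsTerminal.isTerminalObj p'.inv _ Over.mkIdTerminal) Z
    exact ⟨fun a b => onSec_iso_injective e.symm (Subsingleton.elim (α := Sec (p'.inv.obj _) Z) _ _)⟩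
  refine ⟨l, onSec ((Hom.app k).app (op l)) y, ?_, fun Z g => ?_⟩
  · rw [← forget_map_incl, hy, ← onSec_comp, he]
    rfl
  · rw [← onSec_res, ← hom_equivariant]
    congr 1
    exact incl_injective _ _ ((hsub Z).elim _ _)

-- `ψ` describes the action of `G'` on the fibre of `u^* J`, where the base point is fixed; so
-- representatives of `ψ`, taken at a fine enough level, land in its stabilizers.
include hpull hterm hv in
theorem exists_stab_lift (ψ : R'.G ⟶ R.G) (hψ : R.Induces R' (Over.pullback u) κ ψ) :
    ∃ ψ' : R'.G ⟶ (stabSystem R.strict v hJ).proS,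
      ψ' ≫ Pro.level (stabSystem R.strict v hJ).incl = ψ ≫ (stabIso R.strict v hJ).inv := by
  refine FinIndexSystem.exists_lift _ fun (α : Over i₀) => ?_
  obtain ⟨l₁, w, hw, hfix⟩ := exists_fixed R R' κ j x hpull hterm
  obtain ⟨k, h, hk⟩ := (ψ.val α.left).exists_rep
  refine ⟨IsCofiltered.min k l₁, R'.G.F.map (IsCofiltered.minToLeft k l₁) ≫ h, ?_, fun g => ?_⟩
  · refine Eq.trans ?_ (Pro.To.mk_eq _ _).symm
    refine (congrArg (fun z => Pro.To.push z (𝟙 (R.G.F.obj α.left))) hk).trans ?_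
    exact congrArg (Pro.To.mk k) (Category.comp_id h)
  · let s := IsCofiltered.minToRight k l₁
    let y := onSec (J.X.map α.hom.op) v
    let Y' := img R R' hpull J
    have hy : J.incl α.left y = basePt κ j x := (J.incl_map _ v).trans hv
    have h1 : onSec (fiberIso κ (imgIso R R' hpull J)).hom (J.incl α.left y) =
        Y'.incl _ (onSec (Y'.X.map s.op) w) := by
      rw [hy, incl_map, hw]
    have key := hψ J Y' (imgIso R R' hpull J) α.left k h hk _ (IsCofiltered.minToLeft k l₁) pt y
      (onSec (Y'.X.map s.op) w) h1 (ContinuousMap.const _ g)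
    have hfix' := hfix pt ((LCGrp.cont (R'.G.F.map s)).comp (ContinuousMap.const _ g))
    rw [toPt_unique (toPt pt) (𝟙 pt), res_id] at hfix'
    have h2 : Y'.incl _ (Y'.act _ pt (ContinuousMap.const _ g) (onSec (Y'.X.map s.op) w)) =
        Y'.incl _ (onSec (Y'.X.map s.op) w) := by
      rw [incl_act_trans, incl_map]
      exact congrArg _ hfix'
    have key' := incl_injective _ _ (onSec_iso_injective (fiberIso κ (imgIso R R' hpull J))
      (key.trans (h2.trans h1.symm)))
    have : LCGrp.hom (R'.G.F.map (IsCofiltered.minToLeft k l₁) ≫ h) g ∈ J.stab y := key'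
    rw [stab_map] at this
    exact this

theorem tor_eq_of_incl {G : Pro LCGrp.{0}} (hG : IsStrict G) {i l : G.I} (r : l ⟶ i)
    {y : Sec ((free hG i pt).X.obj (op l)) pt} (h : tor hG i 1 = (free hG i pt).incl l y)
    (g : G.F.obj l) : (free hG i pt).incl l ((free hG i pt).act l pt (ContinuousMap.const _ g) y) =
      tor hG i (ContinuousMap.const _ (LCGrp.hom (G.F.map r) g)) := by
  have e : y = onSec ((free hG i pt).X.map r.op)
      (freeMk hG i ((1 : C(pt.obj, G.F.obj i)).prodMk (LCH.toC (toPt pt)))) := by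
    apply incl_injective
    rw [incl_map, ← h]
    rfl
  rw [e, incl_act_trans, act_freeMk, mul_one]
  rfl

-- Compare both morphisms on the generator of the torsor `G'_i`. Its fibre embeds into that of `u_!`
-- of the torsor, where the stabilizers act and define `χ`; the action of `G'` on `u^* u_!` of the
-- torsor is given by `ψ`. Since the unit is equivariant and injective on fibres, the translate
-- obtained through `χ` is the usual one.
include hpull in
theorem comp_eq_id (ψ : R'.G ⟶ R.G) (hψ : R.Induces R' (Over.pullback u) κ ψ)
    (ψ' : R'.G ⟶ (stabSystem R.strict v hJ).proS)
    (hψ' : ψ' ≫ Pro.level (stabSystem R.strict v hJ).incl = ψ ≫ (stabIso R.strict v hJ).inv)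
    (χ : (stabSystem R.strict v hJ).proS ⟶ R'.G)
    (hχ : (sumTransport R R' κ hsum j x v hv hJ).action.Realizes χ) : ψ' ≫ χ = 𝟙 _ := by
  apply Pro.Hom.ext
  funext i
  obtain ⟨α, c, hs⟩ := (sumTransport R R' κ hsum j x v hv hJ).action.exists_spec R'.strict i
  obtain ⟨k, d, hd⟩ := (ψ'.val α).exists_rep
  let l := IsCofiltered.min k i
  let s : l ⟶ k := IsCofiltered.minToLeft k i
  let r : l ⟶ i := IsCofiltered.minToRight k i
  have h1 : (ψ' ≫ χ).val i = Pro.To.mk k (d ≫ hs.hom) := by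
    change ψ'.bind (χ.val i) = _
    rw [hχ.val_eq hs, Pro.Hom.bind_mk, hd]
    rfl
  have h2 : (𝟙 R'.G : R'.G ⟶ R'.G).val i = Pro.To.mk i (𝟙 _) := rfl
  have h3 : ψ.val α.left = Pro.To.mk k (d ≫ (stabSystem R.strict v hJ).incl.app α) := by
    have h := congrFun (congrArg Pro.Hom.val hψ') α
    have h' : (ψ ≫ (stabIso R.strict v hJ).inv).val α = (ψ.val α.left).push (𝟙 _) := rfl
    have h'' : (ψ' ≫ Pro.level (stabSystem R.strict v hJ).incl).val α =
      (ψ'.val α).push ((stabSystem R.strict v hJ).incl.app α) := rfl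
    rw [h', h'', hd] at h
    obtain ⟨k', f, hf⟩ := (ψ.val α.left).exists_rep
    rw [hf] at h ⊢
    refine Eq.trans ?_ h.symm
    exact congrArg (Pro.To.mk k') (Category.comp_id f).symm
  rw [h1, h2, ← Pro.To.mk_eq s, ← Pro.To.mk_eq r, Category.comp_id]
  congr 1
  apply LCGrp.hom_ext
  intro g
  let Y' := free R'.strict i pt
  let Y := sumObj R R' hsum Y'
  let e := sumIso R R' hsum Y'
  let e' := imgIso R R' hpull Y
  let n := lift ((Over.mapPullbackAdj u).unit.app (R'.obj Y') ≫ (Over.pullback u).map e.inv ≫ e'.hom)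
  have hn : sumMap κ e ≫ (fiberIso κ e').hom = (BObj.forget R'.G).map n := sumMap_fiberIso κ e e'
  have hmono : Mono ((BObj.forget R'.G).map n) := by rw [← hn]; infer_instance
  let g' : (stabSystem R.strict v hJ).sub.obj α := LCGrp.hom d (LCGrp.hom (R'.G.F.map s) g)
  obtain ⟨y, hy1, hy2⟩ := hs pt (ContinuousMap.const _ g')
  let y₀ : Sec (Y'.X.obj (op l)) pt := onSec (Y'.X.map r.op)
    (freeMk R'.strict i ((1 : C(pt.obj, R'.G.F.obj i)).prodMk (LCH.toC (toPt pt))))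
  have hy₀ : tor R'.strict i 1 = Y'.incl l y₀ := (incl_map _ r _).symm
  have hθ : ∀ m : Sec ((BObj.forget R'.G).obj Y') pt,
      onSec (fiberIso κ e').hom (onSec (sumMap κ e) m) = onSec ((BObj.forget R'.G).map n) m := by
    intro m
    rw [← onSec_comp, hn]
  have key := hψ Y _ e' α.left k _ h3 l s pt y (onSec ((Hom.app n).app (op l)) y₀) (by
    change onSec (fiberIso κ e').hom _ = _
    refine (congrArg _ hy1.symm).trans ((hθ _).trans ?_)
    rw [hy₀, forget_map_incl]) (ContinuousMap.const _ g)
  rw [← hom_equivariant, ← forget_map_incl, tor_eq_of_incl R'.strict r hy₀] at key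
  have key' := (congrArg _ hy2).trans key
  have key'' := onSec_injective _ ((hθ _).symm.trans key')
  exact congrArg (fun f => f star) (tor_injective R'.strict key'')

-- Compare both morphisms on the generator of the torsor `G_i`. It is moved into the fibre of `u^*`
-- of the torsor, on which `ψ` gives the action of `G'`, and then into `u_! u^*`, where `χ` is
-- defined by the stabilizers. The counit is equivariant and returns the generator to the torsor,
-- where the stabilizers act through their inclusion.
include hpull in
theorem comp_eq_incl (ψ : R'.G ⟶ R.G) (hψ : R.Induces R' (Over.pullback u) κ ψ)
    (χ : (stabSystem R.strict v hJ).proS ⟶ R'.G)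
    (hχ : (sumTransport R R' κ hsum j x v hv hJ).action.Realizes χ) :
    χ ≫ ψ = Pro.level (stabSystem R.strict v hJ).incl ≫ (stabIso R.strict v hJ).hom := by
  apply Pro.Hom.ext
  funext i
  let P := stabSystem R.strict v hJ
  have hψ' := (induces_iff R R' κ hpull ψ).1 hψ
  obtain ⟨l, h, hs⟩ := (transport R R' κ hpull).action.exists_spec R.strict i
  obtain ⟨α, c, hc⟩ := (χ.val l).exists_rep
  let Y := free R.strict i pt
  let Y' := img R R' hpull Y
  let e' := imgIso R R' hpull Y
  let Y₂ := sumObj R R' hsum Y'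
  let e := sumIso R R' hsum Y'
  let m := onSec (fiberIso κ e').hom (tor R.strict i (Z := pt) 1)
  -- Three levels must be refined simultaneously by `β`: `α`, where `χ` is represented, `α₁`, where
  -- `m` can be acted upon, and `α₂`, which lies above `i`.
  obtain ⟨α₁, hα₁⟩ := (sumTransport R R' κ hsum j x v hv hJ).action.exists_pt Y' m
  let α₂ : Over i₀ := Over.mk (IsCofiltered.minToRight i i₀)
  let α₃ : P.A := IsCofiltered.min α₁ (α₂ : P.A)
  let β : P.A := IsCofiltered.min α α₃
  let s : β ⟶ α := IsCofiltered.minToLeft _ _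
  let s₁ : β ⟶ α₁ := IsCofiltered.minToRight α α₃ ≫ IsCofiltered.minToLeft _ _
  let s₂ : β ⟶ α₂ := IsCofiltered.minToRight α α₃ ≫ IsCofiltered.minToRight _ _
  let r : Over.left (X := i₀) β ⟶ i := Over.Hom.left s₂ ≫ IsCofiltered.minToLeft i i₀
  have h1 : (χ ≫ ψ).val i = Pro.To.mk (X := P.proS) β (P.sub.map s ≫ c ≫ hs.hom) := by
    change χ.bind (ψ.val i) = _
    rw [hψ'.val_eq hs, Pro.Hom.bind_mk, hc]
    exact (Pro.To.mk_eq (X := P.proS) s (c ≫ hs.hom)).symm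
  have h2 : (Pro.level P.incl ≫ (stabIso R.strict v hJ).hom).val i =
      Pro.To.mk (X := P.proS) β (P.incl.app β ≫ R.G.F.map r) := by
    have h := Pro.To.mk_eq (X := P.proS) s₂ (P.incl.app α₂ ≫ R.G.F.map (IsCofiltered.minToLeft i i₀))
    refine Eq.trans h.symm (congrArg (Pro.To.mk (X := P.proS) β) ?_)
    apply LCGrp.hom_ext
    intro g
    exact (LCGrp.map_comp_apply (Over.Hom.left s₂) (IsCofiltered.minToLeft i i₀) _).symm
  refine h1.trans (Eq.trans (congrArg _ ?_) h2.symm)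
  apply LCGrp.hom_ext
  intro g
  obtain ⟨m', hm'⟩ := hα₁ pt (ContinuousMap.const _ (LCGrp.hom (P.sub.map s₁) g))
  rw [toPt_unique (toPt pt) (𝟙 pt), res_id] at hm'
  have hA := (sumTransport R R' κ hsum j x v hv hJ).action.trans (g := ContinuousMap.const _ g) s₁ hm'
  let a : R'.G.F.obj l := LCGrp.hom c (LCGrp.hom (P.sub.map s) g)
  obtain ⟨y', hy1, hy2⟩ := hs pt (ContinuousMap.const _ a)
  have hm1 : m = Y'.incl l y' := hy1
  rw [hm1] at hA
  have hreal := hχ Y' l β (P.sub.map s ≫ c) (by rw [hc]; exact (Pro.To.mk_eq (X := P.proS) s c).symm)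
    pt (ContinuousMap.const _ g) y' m' hA
  have hm2 : m' = onSec (fiberIso κ e').hom (tor R.strict i (h.comp (ContinuousMap.const _ a))) :=
    hreal.trans hy2.symm
  obtain ⟨y, hz1, hz2⟩ := hA
  let n := lift (e.hom ≫ (Over.map u).map e'.inv ≫ (Over.mapPullbackAdj u).counit.app (R.obj Y))
  have hn : ∀ b : Sec ((BObj.forget R.G).obj Y) pt, onSec ((BObj.forget R.G).map n)
      (onSec (sumMap κ e) (onSec (fiberIso κ e').hom b)) = b := by
    intro b
    rw [← onSec_comp, ← onSec_comp]
    exact (congrArg (fun f => onSec f b) (fiberIso_sumMap κ e' e)).trans (onSec_id b)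
  have k1 : tor R.strict i 1 = Y.incl _ (onSec ((Hom.app n).app _) y) := by
    rw [← hn (tor R.strict i 1)]
    refine (congrArg (onSec ((BObj.forget R.G).map n)) (Eq.trans ?_ hz1)).trans (forget_map_incl n y)
    rw [← hm1]
    rfl
  have k2 : tor R.strict i (h.comp (ContinuousMap.const _ a)) = Y.incl _ (Y.act _ pt
      (ContinuousMap.const _ (LCGrp.hom (P.incl.app β) g)) (onSec ((Hom.app n).app _) y)) := by
    refine (hn _).symm.trans ((congrArg (onSec ((BObj.forget R.G).map n)) (Eq.trans ?_ hz2)).trans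
      ((forget_map_incl n _).trans (congrArg _ (hom_equivariant n _ y))))
    rw [hm2]
    rfl
  have k3 := k2.trans (tor_eq_of_incl R.strict r k1 _)
  exact congrArg (fun f => f star) (tor_injective R.strict k3)

include hpull hterm hsum hv in
/-- The morphism of fundamental groups is presented by the stabilizers of the point of the fibre. -/
theorem exists_presentation (ψ : R'.G ⟶ R.G) (hψ : R.Induces R' (Over.pullback u) κ ψ) :
    ∃ P : FinIndexPresentation ψ, P.toFinIndexSystem = stabSystem R.strict v hJ := by
  obtain ⟨χ, hχ, -⟩ := (sumTransport R R' κ hsum j x v hv hJ).action.existsUnique_realizes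
    FinIndexSystem.strict_sub R'.strict
  obtain ⟨ψ', hψ'⟩ := exists_stab_lift R R' κ j x v hv hJ hpull hterm ψ hψ
  have h1 := comp_eq_id R R' κ hsum j x v hv hJ hpull ψ hψ ψ' hψ' χ hχ
  have h2 := comp_eq_incl R R' κ hsum j x v hv hJ hpull ψ hψ χ hχ
  -- The other composite needs no computation: `(S_α) ⟶ (H_α)` is a monomorphism, and the identity
  -- holds after composing with it.
  have h3 : χ ≫ ψ' = 𝟙 _ := by
    rw [← cancel_mono (Pro.level (stabSystem R.strict v hJ).incl), Category.assoc, hψ',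
      ← Category.assoc, h2, Category.assoc, Iso.hom_inv_id]
    exact (Category.comp_id _).trans (Category.id_comp _).symm
  exact ⟨{ toFinIndexSystem := stabSystem R.strict v hJ
           isoH := stabIso R.strict v hJ
           isoS := ⟨χ, ψ', h3, h1⟩
           comm := h2 }, rfl⟩

end

end PiOne

end Lichtenbaum
namespace Lichtenbaum

open TopologicalSpace Topology

/-! ### The transfer -/

section Transfer

variable {A B C D : Type*} [Group A] [Group B] [CommGroup C] [CommGroup D]

theorem transfer_mem {H : Subgroup A} {s : A ⧸ H → A} (hs : ∀ q, (s q : A ⧸ H) = q) (a : A)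
    (q : A ⧸ H) : (s q)⁻¹ * (a * s (a⁻¹ • q)) ∈ H := by
  rw [← QuotientGroup.eq, hs]
  change q = a • ((s (a⁻¹ • q) : A) : A ⧸ H)
  rw [hs, smul_inv_smul]

/-- A form of the transfer in which the section of the coset space is an arbitrary function, so that
sections for two groups can be matched. -/
theorem transfer_eq_prod {H : Subgroup A} [H.FiniteIndex] [Fintype (A ⧸ H)] (ϕ : H →* C)
    {s : A ⧸ H → A} (hs : ∀ q, (s q : A ⧸ H) = q) (a : A) :
    MonoidHom.transfer ϕ a = ∏ q, ϕ ⟨_, transfer_mem hs a q⟩ := by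
  rw [MonoidHom.transfer_def ϕ ⟨Set.range s, Subgroup.isComplement_range_left hs⟩ a,
    Subgroup.leftTransversals.diff]
  obtain rfl := Subsingleton.elim (α := Fintype (A ⧸ H)) H.fintypeQuotientOfFiniteIndex ‹_›
  refine Finset.prod_congr rfl fun q _ => ?_
  congr 1
  apply Subtype.ext
  dsimp only
  rw [Subgroup.smul_apply_eq_smul_apply_inv_smul]
  rw [Subgroup.IsComplement.leftQuotientEquiv_apply hs, Subgroup.IsComplement.leftQuotientEquiv_apply hs]
  rfl

/-- Since `H` is the preimage of `K` and `h` is surjective, `h` induces a bijection of coset spaces.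
The image of a section for `H` is a section for `K`, and with these choices the two products agree
factor by factor. -/
theorem transfer_naturality {H : Subgroup A} {K : Subgroup B} [H.FiniteIndex] [K.FiniteIndex]
    (h : A →* B) (hh : Function.Surjective h) (hK : K.comap h = H) (h₀ : H →* K)
    (hh₀ : ∀ x, (h₀ x : B) = h x) (ϕ : H →* C) (ψ : K →* D) (c : C →* D)
    (hc : ∀ x, c (ϕ x) = ψ (h₀ x)) (a : A) :
    c (MonoidHom.transfer ϕ a) = MonoidHom.transfer ψ (h a) := by
  have hmem : ∀ x, h x ∈ K ↔ x ∈ H := fun x => by rw [← hK]; rfl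
  let f : A ⧸ H → B ⧸ K := Quotient.map' h fun x y hxy => by
    rw [QuotientGroup.leftRel_apply] at hxy ⊢
    rwa [← map_inv, ← map_mul, hmem]
  have hf : ∀ x : A, f x = (h x : B ⧸ K) := fun _ => rfl
  have hfs : ∀ (a : A) q, f (a • q) = h a • f q := by
    rintro a ⟨q⟩
    exact (hf (a * q)).trans (congrArg _ (map_mul h a q))
  let e : A ⧸ H ≃ B ⧸ K := Equiv.ofBijective f ⟨by
    rintro ⟨x⟩ ⟨y⟩ hxy
    have := QuotientGroup.eq.1 hxy
    rw [← map_inv, ← map_mul, hmem] at this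
    exact QuotientGroup.eq.2 this, by
    rintro ⟨y⟩
    obtain ⟨x, rfl⟩ := hh y
    exact ⟨x, rfl⟩⟩
  let s : A ⧸ H → A := Quotient.out
  have hs : ∀ q, (s q : A ⧸ H) = q := Quotient.out_eq'
  have hs' : ∀ q, (h (s (e.symm q)) : B ⧸ K) = q := fun q => by
    rw [← hf, hs]
    exact e.apply_symm_apply q
  have := Fintype.ofFinite (A ⧸ H)
  have := Fintype.ofFinite (B ⧸ K)
  rw [transfer_eq_prod ϕ hs, transfer_eq_prod ψ (s := fun q => h (s (e.symm q))) hs', map_prod]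
  refine Fintype.prod_equiv e _ _ fun q => ?_
  rw [hc]
  congr 1
  apply Subtype.ext
  have e2 : e.symm ((h a)⁻¹ • e q) = a⁻¹ • q := by
    rw [Equiv.symm_apply_eq, ← map_inv]
    exact (hfs _ _).symm
  rw [hh₀]
  dsimp only
  rw [e2, e.symm_apply_apply, map_mul, map_mul, map_inv]

/-- `H` is open, so the coset space is discrete and the representative of `a⁻¹ • q` is a locally
constant function of `a`; each factor of the product is then continuous. -/
theorem continuous_transfer [TopologicalSpace A] [IsTopologicalGroup A] [TopologicalSpace C]
    [IsTopologicalGroup C] {H : Subgroup A} [H.FiniteIndex] (hH : IsOpen (H : Set A)) (ϕ : H →* C)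
    (hϕ : Continuous ϕ) : Continuous (MonoidHom.transfer ϕ) := by
  have := Fintype.ofFinite (A ⧸ H)
  have : DiscreteTopology (A ⧸ H) := QuotientGroup.discreteTopology hH
  let s : A ⧸ H → A := Quotient.out
  have hs : ∀ q, (s q : A ⧸ H) = q := Quotient.out_eq'
  have h : ∀ a, MonoidHom.transfer ϕ a = _ := transfer_eq_prod ϕ hs
  rw [funext h]
  refine continuous_finsetProd _ fun q _ => hϕ.comp (Continuous.subtype_mk ?_ _)
  have h1 : Continuous fun a : A => s (a⁻¹ • q) :=
    continuous_of_discreteTopology.comp (continuous_inv.smul continuous_const)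
  exact continuous_const.mul (continuous_id.mul h1)

end Transfer

namespace FinIndexSystem

variable (P : FinIndexSystem)

theorem isOpen (α : P.A) : IsOpen (P.S α : Set (P.H.obj α)) :=
  Subgroup.isOpen_of_isClosed_of_finiteIndex _ (P.closed α)

/-- The transfer at one level. -/
noncomputable def transferHom (α : P.A) :
    LCGrp.ab.obj (P.H.obj α) ⟶ LCGrp.ab.obj (P.sub.obj α) :=
  let f : P.H.obj α →* TopologicalAbelianization (P.S α) := MonoidHom.transfer (P.clsS α)
  have hf : Continuous f := continuous_transfer (P.isOpen α) _ continuous_quot_mk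
  haveI : IsClosed ((commutator (P.S α)).topologicalClosure : Set (P.S α)) :=
    Subgroup.isClosed_topologicalClosure _
  ({ QuotientGroup.lift _ f (Subgroup.topologicalClosure_minimal _
        (Abelianization.commutator_subset_ker f) (isClosed_singleton.preimage hf)) with
      continuous_toFun := by
        exact continuous_quot_lift _ hf } :
    TopologicalAbelianization (P.H.obj α) →ₜ* TopologicalAbelianization (P.S α))

/-- The transfer as a natural transformation. -/
noncomputable def transferNat : P.H ⋙ LCGrp.ab ⟶ P.sub ⋙ LCGrp.ab where
  app := P.transferHom
  naturality α β s := by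
    apply LCGrp.hom_ext
    rintro ⟨x⟩
    exact (transfer_naturality (H := P.S α) (K := P.S β) (LCGrp.hom (P.H.map s) : P.H.obj α →* P.H.obj β)
      (P.strict.surjective s) (P.comap s)
      (LCGrp.hom (P.sub.map s) : P.sub.obj α →* P.sub.obj β) (fun x => rfl) (P.clsS α) (P.clsS β)
      (LCGrp.hom (LCGrp.ab.map (P.sub.map s))).toMonoidHom (fun x => rfl) x).symm

theorem isTransfer_transferNat : P.IsTransfer P.transferNat := fun _ _ => rfl

theorem IsTransfer.eq {τ : P.H ⋙ LCGrp.ab ⟶ P.sub ⋙ LCGrp.ab} (hτ : P.IsTransfer τ) :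
    τ = P.transferNat := by
  ext α
  apply LCGrp.hom_ext
  rintro ⟨x⟩
  exact hτ α x

variable {P} {P' : FinIndexSystem}

/-- On a suitable refinement a component of the inverse followed by `h` is a transition map of `Y`,
which is surjective by strictness. -/
theorem exists_surjective {X Y : Pro LCGrp.{0}} (hY : IsStrict Y) (a : X ≅ Y)
    {j : Y.I} {i : X.I}
    {h : X.F.obj i ⟶ Y.F.obj j} (e : a.hom.val j = Pro.To.mk i h) :
    Function.Surjective (LCGrp.hom h) := by
  obtain ⟨k, f, hf⟩ := (a.inv.val i).exists_rep
  have h1 : (a.inv ≫ a.hom).val j = Pro.To.mk k (f ≫ h) := by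
    change a.inv.bind (a.hom.val j) = _
    rw [e, Pro.Hom.bind_mk, hf]
    rfl
  rw [a.inv_hom_id] at h1
  obtain ⟨l, s, s', hs⟩ := Pro.To.mk_eq_mk_iff.1 (show Pro.To.mk (X := Y) j (𝟙 _) = _ from h1)
  intro y
  obtain ⟨z, hz⟩ := hY.surjective s y
  refine ⟨LCGrp.hom f (LCGrp.hom (Y.F.map s') z), ?_⟩
  rw [← hz]
  exact (DFunLike.congr_fun (congrArg LCGrp.hom hs) z).symm

/-- Compatible isomorphisms between two families of subgroups are given by maps which identify the
subgroups. -/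
theorem exists_compare (a : P.proH ≅ P'.proH) (b : P.proS ≅ P'.proS)
    (w : b.hom ≫ Pro.level P'.incl = Pro.level P.incl ≫ a.hom) (β : P'.A) :
    ∃ (α : P.A) (h : P.H.obj α ⟶ P'.H.obj β) (k : P.sub.obj α ⟶ P'.sub.obj β),
      a.hom.val β = Pro.To.mk (X := P.proH) α h ∧ b.hom.val β = Pro.To.mk (X := P.proS) α k ∧
      k ≫ P'.incl.app β = P.incl.app α ≫ h ∧ Function.Surjective (LCGrp.hom h) ∧
      (P'.S β).comap (LCGrp.hom h : P.H.obj α →* P'.H.obj β) = P.S α := by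
  -- Representatives for the ambient groups and for the subgroups are refined to a common level at
  -- which the square commutes. This is used for the given isomorphisms and for their inverses.
  have step : ∀ {P P' : FinIndexSystem} (a : P.proH ≅ P'.proH) (b : P.proS ≅ P'.proS)
      (_ : b.hom ≫ Pro.level P'.incl = Pro.level P.incl ≫ a.hom) (β : P'.A),
      ∃ (α : P.A) (h : P.H.obj α ⟶ P'.H.obj β) (k : P.sub.obj α ⟶ P'.sub.obj β),
        a.hom.val β = Pro.To.mk (X := P.proH) α h ∧ b.hom.val β = Pro.To.mk (X := P.proS) α k ∧
        k ≫ P'.incl.app β = P.incl.app α ≫ h := by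
    intro P P' a b w β
    obtain ⟨i, h, hh⟩ := (a.hom.val β).exists_rep
    obtain ⟨j, k, hk⟩ := (b.hom.val β).exists_rep
    have e := congrFun (congrArg Pro.Hom.val w) β
    have e1 : (b.hom ≫ Pro.level P'.incl).val β = Pro.To.mk (X := P.proS) j (k ≫ P'.incl.app β) := by
      change (b.hom.val β).push (P'.incl.app β) = _
      rw [hk]
      rfl
    have e2 : (Pro.level P.incl ≫ a.hom).val β = Pro.To.mk (X := P.proS) i (P.incl.app i ≫ h) := by
      change Pro.Hom.bind _ (a.hom.val β) = _
      rw [hh]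
      rfl
    rw [e1, e2] at e
    obtain ⟨l, s, s', hs⟩ := Pro.To.mk_eq_mk_iff.1 e
    refine ⟨l, P.H.map s' ≫ h, P.sub.map s ≫ k, ?_, ?_, ?_⟩
    · rw [hh]
      exact (Pro.To.mk_eq (X := P.proH) s' h).symm
    · rw [hk]
      exact (Pro.To.mk_eq (X := P.proS) s k).symm
    · rw [Category.assoc]
      refine hs.trans ?_
      rw [← Category.assoc, ← Category.assoc]
      exact congrArg (fun f => f ≫ h) (P.incl.naturality s')
  obtain ⟨α, h, k, hh, hk, hkh⟩ := step a b w β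
  have hkh' : ∀ x : P.S α, LCGrp.hom h x = (show P'.S β from LCGrp.hom k x).1 := fun x =>
    (DFunLike.congr_fun (congrArg LCGrp.hom hkh) x).symm
  refine ⟨α, h, k, hh, hk, hkh, exists_surjective P'.strict a hh, le_antisymm ?_ ?_⟩
  · have w' : b.inv ≫ Pro.level P.incl = Pro.level P'.incl ≫ a.inv := by
      rw [Iso.inv_comp_eq, ← Category.assoc, w, Category.assoc, a.hom_inv_id]
      exact (Category.comp_id _).symm
    obtain ⟨β', h', k', hh', hk', hkh''⟩ := step a.symm b.symm w' α
    have e : (a.inv ≫ a.hom).val β = Pro.To.mk (X := P'.proH) β' (h' ≫ h) := by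
      change a.inv.bind (a.hom.val β) = _
      rw [hh, Pro.Hom.bind_mk]
      exact congrArg (fun z => Pro.To.push z h) hh'
    rw [a.inv_hom_id] at e
    obtain ⟨l, s, s', hs⟩ := Pro.To.mk_eq_mk_iff.1
      (show Pro.To.mk (X := P'.proH) β (𝟙 _) = _ from e)
    intro x hx
    -- An element of the preimage of `S'_β` is lifted through the inverse isomorphism to a level `l`
    -- of `P'`. The lift lies in `S'_l` because its image under the transition map lies in `S'_β`,
    -- and the square for the inverse carries it into `S_α`.
    obtain ⟨y, rfl⟩ := exists_surjective P.strict a.symm hh' x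
    obtain ⟨z, rfl⟩ := P'.strict.surjective s' y
    have hz : z ∈ P'.S l := by
      rw [← P'.comap s]
      have := DFunLike.congr_fun (congrArg LCGrp.hom hs) z
      exact (congrArg (· ∈ P'.S β) this).mpr hx
    have hz' : LCGrp.hom (P'.H.map s') z ∈ P'.S β' := by
      rw [← P'.comap s'] at hz
      exact hz
    have := DFunLike.congr_fun (congrArg LCGrp.hom hkh'') (⟨_, hz'⟩ : P'.S β')
    exact this ▸ (LCGrp.hom k' (⟨_, hz'⟩ : P'.S β') : P.S α).2
  · intro x hx
    change LCGrp.hom h x ∈ P'.S β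
    rw [hkh' ⟨x, hx⟩]
    exact (LCGrp.hom k (⟨x, hx⟩ : P.S α) : P'.S β).2

theorem transfer_compare (a : P.proH ≅ P'.proH) (b : P.proS ≅ P'.proS)
    (w : b.hom ≫ Pro.level P'.incl = Pro.level P.incl ≫ a.hom) :
    (Pro.level P.transferNat : proAb.obj P.proH ⟶ proAb.obj P.proS) ≫ proAb.map b.hom =
      proAb.map a.hom ≫ (Pro.level P'.transferNat : proAb.obj P'.proH ⟶ proAb.obj P'.proS) := by
  apply Pro.Hom.ext
  funext β
  obtain ⟨α, h, k, hh, hk, hkh, hs, hc⟩ := exists_compare a b w β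
  have e1 : ((Pro.level P.transferNat : proAb.obj P.proH ⟶ proAb.obj P.proS) ≫
      proAb.map b.hom).val β = Pro.To.mk (X := proAb.obj P.proH) α
        (P.transferHom α ≫ LCGrp.ab.map k) := by
    change Pro.Hom.bind _ (Pro.To.map LCGrp.ab (b.hom.val β)) = _
    rw [hk]
    rfl
  have e2 : (proAb.map a.hom ≫ (Pro.level P'.transferNat : proAb.obj P'.proH ⟶ proAb.obj P'.proS)).val β =
      Pro.To.mk (X := proAb.obj P.proH) α (LCGrp.ab.map h ≫ P'.transferHom β) := by
    change (Pro.To.map LCGrp.ab (a.hom.val β)).push (P'.transferHom β) = _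
    rw [hh]
    rfl
  rw [e1, e2]
  congr 1
  apply LCGrp.hom_ext
  rintro ⟨x⟩
  have := P'.finiteIndex β
  exact transfer_naturality (H := P.S α) (K := P'.S β) (LCGrp.hom h : P.H.obj α →* P'.H.obj β)
    hs hc (LCGrp.hom k : P.sub.obj α →* P'.sub.obj β)
    (fun x => DFunLike.congr_fun (congrArg LCGrp.hom hkh) x) (P.clsS α) (P'.clsS β)
    (LCGrp.hom (LCGrp.ab.map k)).toMonoidHom (fun x => rfl) x

end FinIndexSystem

theorem FinIndexPresentation.comm_inv {G' G : Pro LCGrp.{0}} {f : G' ⟶ G}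
    (P P' : FinIndexPresentation f) :
    (P.isoS ≪≫ P'.isoS.symm).hom ≫ Pro.level P'.incl =
      Pro.level P.incl ≫ (P.isoH ≪≫ P'.isoH.symm).hom := by
  rw [← cancel_mono P'.isoH.hom]
  simp only [Iso.trans_hom, Iso.symm_hom, Category.assoc, Iso.inv_hom_id]
  rw [← P'.comm, Iso.inv_hom_id_assoc, P.comm]
  exact (congrArg _ (Category.comp_id _)).symm

theorem conj_eq_of_comp_eq {C : Type*} [Category* C] {A A' B B' X Y : C} (h : A ≅ X) (h' : A' ≅ X)
    (s : B ≅ Y) (s' : B' ≅ Y) {t : A ⟶ B} {t' : A' ⟶ B'}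
    (hc : t ≫ s.hom ≫ s'.inv = (h.hom ≫ h'.inv) ≫ t') :
    h'.inv ≫ t' ≫ s'.hom = h.inv ≫ t ≫ s.hom := by
  rw [Category.assoc, ← Iso.inv_comp_eq] at hc
  rw [← Category.assoc, ← hc]
  simp

/-- The transfer is defined and independent of the presentation. -/
theorem existsUnique_isTransfer {G' G : Pro LCGrp.{0}} {f : G' ⟶ G}
    (P : FinIndexPresentation f) : ∃! tr : proAb.obj G ⟶ proAb.obj G', IsTransfer f tr := by
  have key : ∀ (P : FinIndexPresentation f) (tr : proAb.obj G ⟶ proAb.obj G'),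
      proAb.map P.isoH.hom ≫ tr =
        (Pro.level P.transferNat : proAb.obj P.proH ⟶ proAb.obj P.proS) ≫ proAb.map P.isoS.hom ↔
      tr = proAb.map P.isoH.inv ≫
        (Pro.level P.transferNat : proAb.obj P.proH ⟶ proAb.obj P.proS) ≫ proAb.map P.isoS.hom :=
    fun P tr => (Iso.eq_inv_comp (proAb.mapIso P.isoH)).symm
  refine ⟨_, ⟨P, P.transferNat, P.isTransfer_transferNat, (key P _).2 rfl⟩, ?_⟩
  rintro tr ⟨P', τ, hτ, h⟩
  rw [hτ.eq, key] at h
  rw [h]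
  have hc := FinIndexSystem.transfer_compare _ _ (P.comm_inv P')
  rw [Iso.trans_hom, Iso.trans_hom, proAb.map_comp, proAb.map_comp] at hc
  exact conj_eq_of_comp_eq (proAb.mapIso P.isoH) (proAb.mapIso P'.isoH) (proAb.mapIso P.isoS)
    (proAb.mapIso P'.isoS) hc

end Lichtenbaum
namespace Lichtenbaum

open TopologicalSpace Topology

/-! ### The conjugation action -/

theorem Pro.prodMap_comp {X X' X'' Y Y' Y'' : Pro TopCat.{0}} (f : X ⟶ X') (f' : X' ⟶ X'')
    (g : Y ⟶ Y') (g' : Y' ⟶ Y'') :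
    Pro.prodMap (f ≫ f') (g ≫ g') = Pro.prodMap f g ≫ Pro.prodMap f' g' := by
  apply Pro.Hom.ext
  funext a
  change Pro.To.pair (Pro.Hom.bind f (f'.val a.1)) (Pro.Hom.bind g (g'.val a.2)) =
    Pro.Hom.bind (Pro.prodMap f g) (Pro.To.pair (f'.val a.1) (g'.val a.2))
  generalize f'.val a.1 = x
  generalize g'.val a.2 = y
  induction x using Pro.To.ind with | h i x =>
  induction y using Pro.To.ind with | h k y =>
  change Pro.To.pair (Pro.To.push (f.val i) x) (Pro.To.push (g.val k) y) =
    Pro.To.push (Pro.To.pair (f.val i) (g.val k)) _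
  generalize f.val i = z
  generalize g.val k = w
  induction z using Pro.To.ind with | h j z =>
  induction w using Pro.To.ind with | h l w => rfl

theorem Pro.prodMap_id (X Y : Pro TopCat.{0}) : Pro.prodMap (𝟙 X) (𝟙 Y) = 𝟙 _ := rfl

/-- The product of two isomorphisms of pro-spaces. -/
def Pro.prodIso {X X' Y Y' : Pro TopCat.{0}} (f : X ≅ X') (g : Y ≅ Y') :
    X.prod Y ≅ X'.prod Y' where
  hom := Pro.prodMap f.hom g.hom
  inv := Pro.prodMap f.inv g.inv
  hom_inv_id := by
    rw [← Pro.prodMap_comp, f.hom_inv_id, g.hom_inv_id, Pro.prodMap_id]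
  inv_hom_id := by
    rw [← Pro.prodMap_comp, f.inv_hom_id, g.inv_hom_id, Pro.prodMap_id]

namespace FinIndexSystem

variable (P : FinIndexSystem) (normal : ∀ α, (P.S α).Normal)

/-- Conjugation on the subgroup at one level. -/
def conjS (α : P.A) (h : P.H.obj α) : P.sub.obj α ⟶ P.sub.obj α :=
  ({ toFun := fun x => ⟨h * x * h⁻¹, (normal α).conj_mem x x.2 h⟩
     map_one' := Subtype.ext (by simp)
     map_mul' := fun x y => Subtype.ext (by simp)
     continuous_toFun := by
       exact ((continuous_const.mul continuous_subtype_val).mul continuous_const).subtype_mk _ } :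
    P.S α →ₜ* P.S α)

/-- The conjugation action at one level. -/
def conjMap (α : P.A) : C(P.H.obj α × TopologicalAbelianization (P.S α),
      TopologicalAbelianization (P.S α)) where
  toFun a := LCGrp.hom (LCGrp.ab.map (P.conjS normal α a.1)) a.2
  continuous_toFun := by
    -- Joint continuity must be checked on a product with a quotient. Quotient maps of groups are
    -- open, so their product with the identity is again a quotient map.
    have h : IsOpenQuotientMap (Prod.map id (P.clsS α) :
        P.H.obj α × P.S α → P.H.obj α × TopologicalAbelianization (P.S α)) :=
      IsOpenQuotientMap.id.prodMap QuotientGroup.isOpenQuotientMap_mk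
    refine h.isQuotientMap.continuous_iff.2 ?_
    have h2 : Continuous fun a : P.H.obj α × P.S α =>
        (⟨a.1 * a.2 * a.1⁻¹, (normal α).conj_mem a.2 a.2.2 a.1⟩ : P.S α) :=
      ((continuous_fst.mul (continuous_subtype_val.comp continuous_snd)).mul
        continuous_fst.inv).subtype_mk _
    exact (continuous_quot_mk : Continuous (P.clsS α)).comp h2

/-- The conjugation action. -/
def conjPro : (proTop.obj P.proH).prod (proTop.obj (proAb.obj P.proS)) ⟶
    proTop.obj (proAb.obj P.proS) where
  val α := Pro.To.mk (X := (proTop.obj P.proH).prod (proTop.obj (proAb.obj P.proS))) (α, α)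
      (TopCat.ofHom (P.conjMap normal α))
  compat {α β} s := by
    refine Eq.trans (congrArg (Pro.To.mk _) ?_) (Pro.To.mk_eq
      (X := (proTop.obj P.proH).prod (proTop.obj (proAb.obj P.proS))) (i := (β, β)) (k := (α, α))
      (s, s) _)
    apply TopCat.hom_ext
    ext ⟨h, ⟨x⟩⟩
    refine congrArg (P.clsS β) (Subtype.ext ?_)
    have key : ∀ h x : P.H.obj α, LCGrp.hom (P.H.map s) (h * x * h⁻¹) =
        LCGrp.hom (P.H.map s) h * LCGrp.hom (P.H.map s) x * (LCGrp.hom (P.H.map s) h)⁻¹ :=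
      fun h x => by rw [map_mul, map_mul, map_inv]
    exact key h (show P.S α from x).1

theorem isConj_conjPro : P.IsConj normal (P.conjPro normal) :=
  fun α => ⟨P.conjMap normal α, fun _ _ => rfl, rfl⟩

variable {P normal}

theorem IsConj.eq {c : (proTop.obj P.proH).prod (proTop.obj (proAb.obj P.proS)) ⟶
    proTop.obj (proAb.obj P.proS)} (hc : P.IsConj normal c) : c = P.conjPro normal := by
  apply Pro.Hom.ext
  funext α
  obtain ⟨m, hm, h⟩ := hc α
  rw [h]
  have : m = P.conjMap normal α := by
    ext ⟨g, ⟨x⟩⟩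
    exact hm g x
  rw [this]
  rfl

variable {P' : FinIndexSystem} {normal' : ∀ α, (P'.S α).Normal}

theorem conj_compare (a : P.proH ≅ P'.proH) (b : P.proS ≅ P'.proS)
    (w : b.hom ≫ Pro.level P'.incl = Pro.level P.incl ≫ a.hom) :
    P.conjPro normal ≫ proTop.map (proAb.map b.hom) =
      Pro.prodMap (proTop.map a.hom) (proTop.map (proAb.map b.hom)) ≫ P'.conjPro normal' := by
  apply Pro.Hom.ext
  funext β
  obtain ⟨α, h, k, hh, hk, hkh, -⟩ := exists_compare a b w β
  have e1 : (P.conjPro normal ≫ proTop.map (proAb.map b.hom)).val β =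
      Pro.To.mk (X := (proTop.obj P.proH).prod (proTop.obj (proAb.obj P.proS))) (α, α)
        (TopCat.ofHom (P.conjMap normal α) ≫ LCGrp.toTop.map (LCGrp.ab.map k)) := by
    change Pro.Hom.bind _ (Pro.To.map LCGrp.toTop (Pro.To.map LCGrp.ab (b.hom.val β))) = _
    rw [hk]
    rfl
  have e2 : (Pro.prodMap (proTop.map a.hom) (proTop.map (proAb.map b.hom)) ≫
      P'.conjPro normal').val β =
      Pro.To.mk (X := (proTop.obj P.proH).prod (proTop.obj (proAb.obj P.proS))) (α, α)
        (TopCat.ofHom ((LCGrp.toTop.map h).hom.prodMap (LCGrp.toTop.map (LCGrp.ab.map k)).hom) ≫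
          TopCat.ofHom (P'.conjMap normal' β)) := by
    change Pro.To.push (Pro.To.pair (Pro.To.map LCGrp.toTop (a.hom.val β))
      (Pro.To.map LCGrp.toTop (Pro.To.map LCGrp.ab (b.hom.val β)))) _ = _
    rw [hh, hk]
    rfl
  rw [e1, e2]
  refine congrArg (Pro.To.mk _) ?_
  apply TopCat.hom_ext
  ext ⟨g, ⟨x⟩⟩
  have hkh' : ∀ x : P.S α, (show P'.S β from LCGrp.hom k x).1 = LCGrp.hom h x := fun x =>
    DFunLike.congr_fun (congrArg LCGrp.hom hkh) x
  refine congrArg (P'.clsS β) (Subtype.ext ?_)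
  have key : ∀ (g : P.H.obj α) (x : P.S α),
      (show P'.S β from LCGrp.hom k (LCGrp.hom (P.conjS normal α g) x)).1 =
        LCGrp.hom h g * (show P'.S β from LCGrp.hom k x).1 * (LCGrp.hom h g)⁻¹ := fun g x =>
    ((hkh' _).trans (show LCGrp.hom h (g * x * g⁻¹) = LCGrp.hom h g * LCGrp.hom h x *
      (LCGrp.hom h g)⁻¹ by rw [map_mul, map_mul, map_inv])).trans
      (congrArg (fun z => LCGrp.hom h g * z * (LCGrp.hom h g)⁻¹) (hkh' x).symm)
  exact key g x

end FinIndexSystem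

/-- The conjugation action is defined and independent of the presentation. -/
theorem existsUnique_isConjugationAction {G' G : Pro LCGrp.{0}} {f : G' ⟶ G}
    (P : FinIndexPresentation f) (normal : ∀ α, (P.S α).Normal) :
    ∃! c : (proTop.obj G).prod (proTop.obj (proAb.obj G')) ⟶ proTop.obj (proAb.obj G'),
      IsConjugationAction f c := by
  have key : ∀ (P : FinIndexPresentation f) (normal : ∀ α, (P.S α).Normal) c,
      Pro.prodMap (proTop.map P.isoH.hom) (proTop.map (proAb.map P.isoS.hom)) ≫ c =
        P.conjPro normal ≫ proTop.map (proAb.map P.isoS.hom) ↔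
      c = Pro.prodMap (proTop.map P.isoH.inv) (proTop.map (proAb.map P.isoS.inv)) ≫
        P.conjPro normal ≫ proTop.map (proAb.map P.isoS.hom) :=
    fun P _ c => (Iso.eq_inv_comp (Pro.prodIso (proTop.mapIso P.isoH)
      (proTop.mapIso (proAb.mapIso P.isoS)))).symm
  refine ⟨_, ⟨P, normal, P.conjPro normal, P.isConj_conjPro normal, (key P normal _).2 rfl⟩, ?_⟩
  rintro c ⟨P', normal', c', hc', h⟩
  rw [hc'.eq, key] at h
  rw [h]
  have hc := FinIndexSystem.conj_compare (normal := normal) (normal' := normal') _ _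
    (P.comm_inv P')
  rw [Iso.trans_hom, Iso.trans_hom, proAb.map_comp, proTop.map_comp, proTop.map_comp,
    Pro.prodMap_comp] at hc
  exact conj_eq_of_comp_eq
    (Pro.prodIso (proTop.mapIso P.isoH) (proTop.mapIso (proAb.mapIso P.isoS)))
    (Pro.prodIso (proTop.mapIso P'.isoH) (proTop.mapIso (proAb.mapIso P'.isoS)))
    (proTop.mapIso (proAb.mapIso P.isoS)) (proTop.mapIso (proAb.mapIso P'.isoS)) hc

end Lichtenbaum
namespace Lichtenbaum

open TopologicalSpace Topology EtSch

/-! ### Finite étale maps and fundamental groups -/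

namespace BObj

variable {G : Pro LCGrp.{0}} (Y : BObj G) {i : G.I}

/-- An endomorphism carrying `v` to `n⁻¹ • v` commutes with the action, so whatever fixes `v` fixes
`n⁻¹ • v`; this says that `n * g * n⁻¹` fixes `v`. -/
theorem normal_stab (v : Sec (Y.X.obj (op i)) pt)
    (h : ∀ w : Sec (Y.X.obj (op i)) pt, ∃ s : Y ⟶ Y,
      onSec ((forget G).map s) (Y.incl i v) = Y.incl i w) : (Y.stab v).Normal := by
  refine ⟨fun g hg n => ?_⟩
  obtain ⟨s, hs⟩ := h (Y.act i pt (ContinuousMap.const _ n⁻¹) v)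
  have hs' : onSec (s.app.app (op i)) v = Y.act i pt (ContinuousMap.const _ n⁻¹) v := by
    apply Y.incl_injective i
    rw [← hs, forget_map_incl]
  have h1 := hom_equivariant s (ContinuousMap.const pt.obj g) v
  rw [(Y.mem_stab v).1 hg, hs'] at h1
  rw [mem_stab]
  have h2 : (ContinuousMap.const pt.obj (n * g * n⁻¹) : C(pt.obj, G.F.obj i)) =
    ContinuousMap.const _ n * (ContinuousMap.const _ g * ContinuousMap.const _ n⁻¹) := by
    ext
    exact mul_assoc _ _ _
  rw [h2, Y.act_mul, Y.act_mul, ← h1, ← Y.act_mul]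
  have h3 : (ContinuousMap.const pt.obj n * ContinuousMap.const _ n⁻¹ : C(pt.obj, G.F.obj i)) = 1 := by
    ext
    exact mul_inv_cancel _
  rw [h3, Y.act_one]

end BObj

namespace LichtenbaumTopos

variable {F : Type} [Field F] [NumberField F] (L : LichtenbaumTopos.{u} F)

/-- Both points come from one point of a connected cover `W` via two maps to `V`. The Galois
property gives an automorphism matching these maps at one complex point of `W`, hence matching them
altogether by `eq_of_eq_SpecC`. -/
theorem exists_fibreMap_eq {V U : EtSch F} {f : V ⟶ U} (hU : U.Connected) (hf : IsGalois f)
    (p : TPoint (L.str U)) (x y : L.Fibre p (FinEt.mk f hf.1)) :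
    ∃ σ : FinEt.mk f hf.1 ⟶ FinEt.mk f hf.1, L.fibreMap p σ x = y := by
  obtain ⟨W, hW, w, a, ha⟩ := L.exists_connected_fibre_fin p hU
    (fun _ : Fin 2 => FinEt.mk f hf.1) ![x, y]
  have : ConnectedSpace W.obj.left.U := hW
  obtain ⟨c⟩ := exists_SpecC W.obj.left
  have ha' : ∀ i, (a i).hom.left ≫ f = W.obj.hom := fun i => Over.w (a i).hom
  have hh : ∀ i, hom (a i).hom.left ≫ hom f = hom W.obj.hom := fun i =>
    congrArg EtSch.hom (ha' i)
  obtain ⟨σ, hσ, hc⟩ := hf.2 (c ≫ hom (a 0).hom.left) (c ≫ hom (a 1).hom.left) (by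
    rw [Category.assoc, Category.assoc, hh, hh])
  refine ⟨FinEt.homMk (V := FinEt.mk f hf.1) (W := FinEt.mk f hf.1) σ.hom hσ, ?_⟩
  have h0 : hom (a 0).hom.left ≫ hom σ.hom = hom (a 1).hom.left := by
    refine eq_of_eq_SpecC (hom f) _ _ ?_ c (by rw [← hc, Category.assoc])
    rw [hh, Category.assoc, ← EtSch.hom_comp, hσ, hh]
  have h1 : a 0 ≫ FinEt.homMk (V := FinEt.mk f hf.1) (W := FinEt.mk f hf.1) σ.hom hσ = a 1 := by
    apply ObjectProperty.hom_ext
    apply Over.OverMorphism.ext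
    exact hom_ext' h0
  rw [← show L.fibreMap p (a 0) w = x from ha 0, ← show L.fibreMap p (a 1) w = y from ha 1,
    ← fibreMap_comp, h1]

/-- The identity cover, as the image of the terminal object. -/
noncomputable def coverIso {V U : EtSch F} (f : V ⟶ U) (hf : IsFiniteEtale f) :
    (L.cover U).obj (FinEt.mk f hf) ≅ (Over.map (L.et.map f)).obj (Over.mk (𝟙 (L.et.obj V))) :=
  Over.isoMk (Iso.refl _) (by
    change 𝟙 _ ≫ 𝟙 _ ≫ L.et.map f = L.et.map f
    rw [Category.id_comp, Category.id_comp])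

theorem slc_id {U : EtSch F} (hU : U.Connected) : SLC (L.str U) (Over.mk (𝟙 (L.et.obj U))) := by
  have h := L.slc_cover hU (FinEt.mk (𝟙 U) (IsFiniteEtale.of_isIso _))
  have e : (L.cover U).obj (FinEt.mk (𝟙 U) (IsFiniteEtale.of_isIso _)) = Over.mk (𝟙 (L.et.obj U)) :=
    congrArg Over.mk (L.et.map_id U)
  rwa [e] at h

omit [NumberField F] in
theorem existsUnique_induces {V U : EtSch F} (f : V ⟶ U) {p' : TPoint (L.str V)}
    {p : TPoint (L.str U)} (κ : p.inv ≅ L.pull f ⋙ p'.inv) (R' : PiOne (L.str V) p')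
    (R : PiOne (L.str U) p) : ∃! ψ : R'.G ⟶ R.G, R.Induces R' (L.pull f) κ ψ := by
  simp only [R.induces_iff R' κ fun X => L.slc_pull f]
  exact ProAction.existsUnique_realizes R'.strict R.strict _

/-- The presentation consists of the stabilizers of the base point in the fibre of `V` at `p`. For
Galois `f` the endomorphisms of `V` over `U` reach every point of this fibre, so the same
stabilizers are normal. -/
theorem exists_finIndexPresentation {V U : EtSch F} {f : V ⟶ U} (hV : V.Connected)
    (hU : U.Connected) (hf : IsFiniteEtale f) {p' : TPoint (L.str V)}
    {p : TPoint (L.str U)} (κ : p.inv ≅ L.pull f ⋙ p'.inv) (R' : PiOne (L.str V) p')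
    (R : PiOne (L.str U) p) (ψ : R'.G ⟶ R.G) (hψ : R.Induces R' (L.pull f) κ ψ) :
    ∃ P : FinIndexPresentation ψ, IsGalois f → ∀ α, (P.S α).Normal := by
  obtain ⟨J, ⟨j₀⟩⟩ := R.exists_iso (L.slc_cover hU (FinEt.mk f hf))
  let e : (BObj.forget R.G).obj J ≅ L.stalk p (FinEt.mk f hf) :=
    (R.fib J).symm ≪≫ p.inv.mapIso j₀
  have hJ : IsFinConst ((BObj.forget R.G).obj J) := (L.isFinConst_stalk p hU _).of_iso e.symm
  obtain ⟨x⟩ := nonempty_of_isTerminal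
    (IsTerminal.isTerminalObj p'.inv _ (Over.mkIdTerminal (X := L.et.obj V))) pt
  let j := j₀ ≪≫ L.coverIso f hf
  obtain ⟨i, v, hv⟩ := J.exists_incl_pt (PiOne.basePt κ j x)
  obtain ⟨P, hP⟩ := PiOne.exists_presentation R R' κ (fun X => L.slc_map hf hU) j x v hv hJ
    (fun X => L.slc_pull f) (L.slc_id hV) ψ hψ
  refine ⟨P, fun hG => ?_⟩
  rw [hP]
  intro α
  have := J.normal_stab v fun w => by
    obtain ⟨σ, hσ⟩ := L.exists_fibreMap_eq hU hG p (onSec e.hom (J.incl i v))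
      (onSec e.hom (J.incl i w))
    refine ⟨PiOne.lift (j₀.hom ≫ (L.cover U).map σ ≫ j₀.inv), ?_⟩
    apply onSec_injective e.hom
    rw [← hσ, ← onSec_comp]
    refine (congrArg (fun f => onSec f (J.incl i v)) ?_).trans (onSec_comp _ _ _)
    change _ ≫ (R.fib J).inv ≫ p.inv.map j₀.hom = ((R.fib J).inv ≫ p.inv.map j₀.hom) ≫
      p.inv.map ((L.cover U).map σ)
    rw [← cancel_epi (R.fib J).hom, ← Category.assoc, PiOne.fib_lift]
    simp only [Category.assoc, Iso.hom_inv_id_assoc, ← Functor.map_comp, Iso.inv_hom_id,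
      Category.comp_id]
  exact this.comap _

end LichtenbaumTopos

end Lichtenbaum
namespace Lichtenbaum

open TopologicalSpace Topology EtSch

/-! ### The action of a pro-group on points of the underlying sheaf -/

namespace BObj

variable {G : Pro LCGrp.{0}} (Y : BObj G)

/-- The element `g` at level `l` acts on the point `x`, with value `x'`. -/
def Acts (l : G.I) (g : G.F.obj l) (x x' : Sec ((forget G).obj Y) pt) : Prop :=
  ∃ y : Sec (Y.X.obj (op l)) pt, Y.incl l y = x ∧
    Y.incl l (Y.act l pt (ContinuousMap.const _ g) y) = x'

variable {Y} {l : G.I} {g : G.F.obj l} {x x' x'' : Sec ((forget G).obj Y) pt}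

theorem Acts.det (h : Y.Acts l g x x') (h' : Y.Acts l g x x'') : x' = x'' := by
  obtain ⟨y, hy, rfl⟩ := h
  obtain ⟨y', hy', rfl⟩ := h'
  rw [Y.incl_injective l (hy.trans hy'.symm)]

theorem Acts.trans {k : G.I} (s : k ⟶ l) {g : G.F.obj k}
    (h : Y.Acts l (LCGrp.hom (G.F.map s) g) x x') : Y.Acts k g x x' := by
  obtain ⟨y, hy, hy'⟩ := h
  refine ⟨onSec (Y.X.map s.op) y, (Y.incl_map s y).trans hy, ?_⟩
  rw [incl_act_trans]
  exact hy'

theorem Acts.mul {h : G.F.obj l} (h1 : Y.Acts l g x x') (h2 : Y.Acts l h x' x'') :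
    Y.Acts l (h * g) x x'' := by
  obtain ⟨y, hy, hy'⟩ := h1
  obtain ⟨z, hz, hz'⟩ := h2
  refine ⟨y, hy, ?_⟩
  rw [← hz', Y.incl_injective l (hz.trans hy'.symm), ← Y.act_mul]
  rfl

theorem Acts.inv (h : Y.Acts l g x x') : Y.Acts l g⁻¹ x' x := by
  obtain ⟨y, hy, hy'⟩ := h
  refine ⟨_, hy', ?_⟩
  rw [← hy, ← Y.act_mul]
  congr 1
  refine Eq.trans ?_ (Y.act_one l pt y)
  congr 1
  ext z
  exact inv_mul_cancel g

theorem Acts.nat {Y' : BObj G} (f : Y ⟶ Y') (h : Y.Acts l g x x') :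
    Y'.Acts l g (onSec ((forget G).map f) x) (onSec ((forget G).map f) x') := by
  obtain ⟨y, rfl, rfl⟩ := h
  exact ⟨onSec ((Hom.app f).app (op l)) y, (forget_map_incl f y).symm, by
    rw [forget_map_incl, hom_equivariant]⟩

variable (Y) in
theorem acts_incl (g : G.F.obj l) (y : Sec (Y.X.obj (op l)) pt) :
    Y.Acts l g (Y.incl l y) (Y.incl l (Y.act l pt (ContinuousMap.const _ g) y)) := ⟨y, rfl, rfl⟩

theorem acts_self_iff {y : Sec (Y.X.obj (op l)) pt} :
    Y.Acts l g (Y.incl l y) (Y.incl l y) ↔ g ∈ Y.stab y :=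
  ⟨fun h => Y.incl_injective l ((Y.acts_incl g y).det h), fun h => ⟨y, rfl, congrArg _ h⟩⟩

theorem Acts.exists_trans (hG : IsStrict G) {k : G.I} {h : G.F.obj k} (h1 : Y.Acts l g x x')
    (h2 : Y.Acts k h x' x'') : ∃ m n, Y.Acts m n x x'' := by
  obtain ⟨m, a, b, -⟩ := IsCofilteredOrEmpty.cone_objs l k
  obtain ⟨g', rfl⟩ := hG.surjective a g
  obtain ⟨h', rfl⟩ := hG.surjective b h
  exact ⟨m, _, (h1.trans a).mul (h2.trans b)⟩

/-! ### Objects with trivial action -/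

variable (Y)

/-- All points are defined at all levels and fixed by the action. -/
def IsTriv : Prop := ∀ (l : G.I) (m : Sec ((forget G).obj Y) pt),
  ∃ y : Sec (Y.X.obj (op l)) pt, Y.incl l y = m ∧
    ∀ (Z : LCH) (g : C(Z.obj, G.F.obj l)), Y.act l Z g (res _ (toPt Z) y) = res _ (toPt Z) y

theorem isTriv_of_subsingleton (h : ∀ Z, Subsingleton (Sec ((forget G).obj Y) Z)) : Y.IsTriv := by
  have key : ∀ (k : G.I) (Z : LCH) (y y' : Sec (Y.X.obj (op k)) Z), y = y' := fun k Z y y' =>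
    Y.incl_injective k ((h Z).elim _ _)
  intro l m
  obtain ⟨j, y, rfl⟩ := Y.exists_incl_pt m
  obtain ⟨k, a, b, -⟩ := IsCofilteredOrEmpty.cone_objs l j
  obtain ⟨z, hz, -⟩ := Y.invariants a pt (onSec (Y.X.map b.op) y) fun _ _ _ _ => key _ _ _ _
  exact ⟨z, (h pt).elim _ _, fun Z g => key _ _ _ _⟩

variable {Y}

theorem IsTriv.of_hom {Y' : BObj G} (h : Y.IsTriv)
    (hm : ∀ m : Sec ((forget G).obj Y') pt, ∃ (f : Y ⟶ Y') (m' : _),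
      onSec ((forget G).map f) m' = m) : Y'.IsTriv := by
  intro l m
  obtain ⟨f, m', rfl⟩ := hm m
  obtain ⟨y, rfl, hy⟩ := h l m'
  refine ⟨onSec ((Hom.app f).app (op l)) y, (forget_map_incl f y).symm, fun Z g => ?_⟩
  rw [← onSec_res, ← hom_equivariant, hy]

/-- In a finite constant sheaf sections are locally constant, so the condition on global points
passes to all sections by gluing. -/
theorem IsTriv.exists_incl (h : Y.IsTriv) (hY : IsFinConst ((forget G).obj Y)) (l : G.I) {Z : LCH}
    (m : Sec ((forget G).obj Y) Z) : ∃ y : Sec (Y.X.obj (op l)) Z, Y.incl l y = m ∧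
      ∀ g : C(Z.obj, G.F.obj l), Y.act l Z g y = y := by
  have hloc : ∀ z : Z.obj, ∃ O : Opens Z.obj, z ∈ O ∧ ∃ y : Sec (Y.X.obj (op l)) pt,
      Y.incl l (res _ (toPt (opn O)) y) = res _ (opnι O) m ∧
      ∀ g : C((opn O).obj, G.F.obj l), Y.act l _ g (res _ (toPt _) y) = res _ (toPt _) y := by
    intro z
    obtain ⟨O, hz, hO⟩ := hY.exists_eq m z
    obtain ⟨y, hy, hy'⟩ := h l (res _ (ptTo z) m)
    exact ⟨O, hz, y, by rw [incl_res, hy, hO], hy' _⟩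
  obtain ⟨y, hy⟩ := sec_glue (S := Y.X.obj (op l)) (Z := Z) (fun φ y => Y.incl l y = res _ φ m)
    (fun f g x hx => by rw [incl_res, hx, res_res])
    (fun f x y hx hy => Y.incl_injective l (hx.trans hy.symm)) fun z => by
      obtain ⟨O, hz, y, hy, -⟩ := hloc z
      exact ⟨O, hz, _, hy⟩
  refine ⟨y, sec_ext fun z => ?_, fun g => sec_ext fun z => ?_⟩
  · obtain ⟨O, hz, y', hy', -⟩ := hloc z
    exact ⟨O, hz, by rw [← incl_res, hy _ _ hy', hy']⟩
  · obtain ⟨O, hz, y', hy', h'⟩ := hloc z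
    exact ⟨O, hz, by rw [Y.act_res, hy _ _ hy', h']⟩

/-- Invariant maps to an object with trivial action are morphisms. -/
theorem IsTriv.exists_hom {Y' : BObj G} (h : Y'.IsTriv) (hY' : IsFinConst ((forget G).obj Y'))
    (ϕ : (forget G).obj Y ⟶ (forget G).obj Y')
    (hϕ : ∀ l Z g (y : Sec (Y.X.obj (op l)) Z),
      onSec ϕ (Y.incl l (Y.act l Z g y)) = onSec ϕ (Y.incl l y)) :
    ∃ f : Y ⟶ Y', (forget G).map f = ϕ := by
  choose c hc hc' using fun (l : G.I) (Z : LCH) (m : Sec ((forget G).obj Y') Z) =>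
    h.exists_incl hY' l m
  let f : Y ⟶ Y' := BObj.Hom.mk
    { app := fun l => T.homMk (fun Z y => c l.unop Z (onSec ϕ (Y.incl l.unop y))) fun {Z Z'} φ y => by
        apply Y'.incl_injective l.unop
        rw [hc, incl_res, incl_res, hc, onSec_res]
      naturality := fun {l k} s => by
        refine T_hom_ext fun Z y => Y'.incl_injective k.unop ?_
        rw [onSec_comp, onSec_comp, onSec_homMk, onSec_homMk, hc]
        exact (congrArg _ (Y.incl_map s.unop y)).trans
          ((hc _ _ _).symm.trans (Y'.incl_map s.unop _).symm) }
    (fun l Z g y => by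
      change c l Z _ = Y'.act l Z g (c l Z _)
      rw [hc', hϕ])
  refine ⟨f, colimit.hom_ext fun l => T_hom_ext fun Z y => ?_⟩
  exact (forget_map_incl f y).trans (hc _ _ _)

end BObj

end Lichtenbaum
namespace Lichtenbaum

open TopologicalSpace Topology EtSch

/-! ### The sheaf of locally constant truth values -/

/-- The final sheaf, as a represented sheaf. -/
def unitSheaf : T := repIf True PUnit.{1}

/-- The map from the final sheaf given by a global section. -/
def unitSheaf.desc {S : T} (x : Sec S pt) : unitSheaf ⟶ S :=
  T.homMk (fun Z _ => res S (toPt Z) x) fun φ _ => by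
    rw [res_res]
    rfl

/-- `unitSheaf` is final. -/
def isTerminalUnitSheaf : IsTerminal unitSheaf :=
  IsTerminal.ofUniqueHom (fun _ => T.homMk (fun _ _ => repIf.mk (.const _ PUnit.unit)
    fun _ => trivial) fun _ _ => rfl) fun _ _ => T_hom_ext fun _ _ => repIf.ext fun _ => rfl

/-- The sheaf of continuous maps to the discrete two-point space. -/
def boolSheaf : T := repIf True Bool

theorem isFinConst_boolSheaf : IsFinConst boolSheaf := by
  refine ⟨Bool, inferInstance, fun b => repIf.mk (.const _ b) fun _ => trivial, fun Z x z => ?_⟩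
  refine ⟨⟨repIf.fn (P := True) x ⁻¹' {repIf.fn (P := True) x z},
    (isOpen_discrete _).preimage (repIf.fn (P := True) x).continuous⟩, rfl,
    repIf.fn (P := True) x z, repIf.ext fun w => w.2⟩

open Classical in
/-- The characteristic function of a set of points. -/
noncomputable def charFn {S : T} (hS : IsFinConst S) (B : Set (Sec S pt)) : S ⟶ boolSheaf :=
  T.homMk (fun Z m => repIf.mk (P := True) (M := Bool) ⟨fun z => decide (res S (ptTo z) m ∈ B), by
    refine (IsLocallyConstant.iff_exists_open _).2 (fun z => ?_) |>.continuous
    obtain ⟨O, hz, h⟩ := hS.exists_eq m z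
    refine ⟨O, O.isOpen, hz, fun z' hz' => ?_⟩
    exact congrArg (fun y => decide (y ∈ B))
      ((res_ptIn hz' m).symm.trans ((congrArg _ h).trans (res_toPt_pt _ _)))⟩ fun _ => trivial) fun φ m => repIf.ext fun z => by
      change decide _ = decide _
      rw [res_res, ptTo_comp]
      rfl

open Classical in
theorem fn_charFn {S : T} (hS : IsFinConst S) (B : Set (Sec S pt)) {Z : LCH} (m : Sec S Z)
    (z : Z.obj) : repIf.fn (P := True) (onSec (charFn hS B) m) z = decide (res S (ptTo z) m ∈ B) :=
  rfl

namespace PiOne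

variable {E : Type u} [Category.{1} E] {t : T ⥤ E} {p : TPoint t} (R : PiOne t p)

/-- The sheaf underlying an object which corresponds to `X` is the fibre of `X`. -/
noncomputable def fibIso {Y : BObj R.G} {X : E} (e : R.obj Y ≅ X) :
    (BObj.forget R.G).obj Y ≅ p.inv.obj X :=
  (R.fib Y).symm ≪≫ p.inv.mapIso e

/-- The sheaf underlying an object which corresponds to the inverse image of a sheaf. -/
noncomputable def strIso {Y : BObj R.G} {S : T} (e : R.obj Y ≅ t.obj S) :
    (BObj.forget R.G).obj Y ≅ S :=
  R.fibIso e ≪≫ p.sec.app S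

variable {R}

theorem fibIso_naturality {Y Y' : BObj R.G} {X X' : E} (e : R.obj Y ≅ X) (e' : R.obj Y' ≅ X')
    (a : X ⟶ X') : (BObj.forget R.G).map (lift (e.hom ≫ a ≫ e'.inv)) ≫ (R.fibIso e').hom =
      (R.fibIso e).hom ≫ p.inv.map a := by
  simp only [fibIso, Iso.trans_hom, Iso.symm_hom, Functor.mapIso_hom, Category.assoc]
  rw [← cancel_epi (R.fib Y).hom, ← Category.assoc, fib_lift]
  simp only [Functor.map_comp, Category.assoc, Iso.hom_inv_id_assoc]
  rw [← p.inv.map_comp e'.inv, Iso.inv_hom_id, p.inv.map_id, Category.comp_id]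

theorem strIso_naturality {Y Y' : BObj R.G} {S S' : T} (e : R.obj Y ≅ t.obj S)
    (e' : R.obj Y' ≅ t.obj S') (g : S ⟶ S') :
    (BObj.forget R.G).map (lift (e.hom ≫ t.map g ≫ e'.inv)) ≫ (R.strIso e').hom =
      (R.strIso e).hom ≫ g := by
  have h : p.inv.map (t.map g) ≫ p.sec.hom.app S' = p.sec.hom.app S ≫ g := p.sec.hom.naturality g
  rw [strIso, Iso.trans_hom, ← Category.assoc, fibIso_naturality, Category.assoc]
  exact (congrArg _ h).trans (Category.assoc _ _ _).symm

/-- A global section of `S` is a map from the final sheaf, so `Y` receives its points from the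
object corresponding to the inverse image of the final sheaf, whose sections are unique. -/
theorem isTriv_of_str (hslc : ∀ S, SLC t (t.obj S)) {Y : BObj R.G} {S : T}
    (e : R.obj Y ≅ t.obj S) : Y.IsTriv := by
  obtain ⟨Y₁, ⟨e₁⟩⟩ := R.exists_iso (hslc unitSheaf)
  have h₁ : Y₁.IsTriv := Y₁.isTriv_of_subsingleton fun Z => by
    have := subsingleton_of_isTerminal isTerminalUnitSheaf Z
    exact ⟨fun a b => onSec_iso_injective (R.strIso e₁) (Subsingleton.elim _ _)⟩
  refine h₁.of_hom fun m => ?_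
  let b := unitSheaf.desc (onSec (R.strIso e).hom m)
  obtain ⟨x⟩ := nonempty_of_isTerminal isTerminalUnitSheaf pt
  refine ⟨lift (e₁.hom ≫ t.map b ≫ e.inv), onSec (R.strIso e₁).inv x, ?_⟩
  apply onSec_iso_injective (R.strIso e)
  rw [← onSec_comp, strIso_naturality, onSec_comp]
  exact (congrArg (fun φ => res S φ (onSec (R.strIso e).hom m))
    (toPt_unique (toPt pt) (𝟙 pt))).trans (res_id _)

/-- The action is transitive on the points of an object on which functions are constant. -/
theorem exists_acts (hslc : ∀ S, SLC t (t.obj S)) {X : E}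
    (hX : ∀ (S : T) (c : X ⟶ t.obj S) (x x' : Sec (p.inv.obj X) pt),
      onSec (p.inv.map c ≫ p.sec.hom.app S) x = onSec (p.inv.map c ≫ p.sec.hom.app S) x')
    {Y : BObj R.G} (e : R.obj Y ≅ X) (hY : IsFinConst ((BObj.forget R.G).obj Y))
    (x x' : Sec ((BObj.forget R.G).obj Y) pt) : ∃ l g, Y.Acts l g x x' := by
  let B : Set (Sec ((BObj.forget R.G).obj Y) pt) := {x' | ∃ l g, Y.Acts l g x x'}
  have hB : ∀ {l g a b}, Y.Acts l g a b → (a ∈ B ↔ b ∈ B) := fun h =>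
    ⟨fun ⟨_, _, ha⟩ => ha.exists_trans R.strict h, fun ⟨_, _, hb⟩ => hb.exists_trans R.strict h.inv⟩
  obtain ⟨Y₂, ⟨e₂⟩⟩ := R.exists_iso (hslc boolSheaf)
  -- The characteristic function of the orbit `B` is invariant, so it is a morphism to the object
  -- with trivial action given by `boolSheaf`. By `hX` it is constant on points, and it is true at
  -- `x`.
  obtain ⟨f, hf⟩ := (isTriv_of_str hslc e₂).exists_hom
    (isFinConst_boolSheaf.of_iso (R.strIso e₂).symm) (charFn hY B ≫ (R.strIso e₂).inv)
    (Y := Y) (fun l Z g y => by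
      rw [onSec_comp, onSec_comp]
      refine congrArg _ (repIf.ext (P := True) fun z => ?_)
      rw [fn_charFn, fn_charFn, ← BObj.incl_res, ← BObj.incl_res, BObj.res_pt_act]
      exact decide_eq_decide.2 (hB (Y.acts_incl _ _)).symm)
  let c : X ⟶ t.obj boolSheaf := e.inv ≫ R.map f ≫ e₂.hom
  have hc : p.inv.map c ≫ p.sec.hom.app boolSheaf = p.inv.map e.inv ≫ (R.fib Y).hom ≫ charFn hY B := by
    have h1 : charFn hY B = (BObj.forget R.G).map f ≫ (R.strIso e₂).hom := by
      rw [hf, Category.assoc, Iso.inv_hom_id, Category.comp_id]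
    rw [h1, strIso, fibIso, ← Category.assoc (R.fib Y).hom, ← fib_naturality]
    simp [c]
  have h := fun a b => hX boolSheaf c (onSec (R.fibIso e).hom a)
    (onSec (R.fibIso e).hom b)
  have h' : ∀ a b, onSec (charFn hY B) a = onSec (charFn hY B) b := fun a b => by
    have := h a b
    rw [hc, ← onSec_comp, ← onSec_comp] at this
    simpa [fibIso, ← Functor.map_comp_assoc] using this
  have hx : x ∈ B := by
    obtain ⟨l, y, rfl⟩ := Y.exists_incl_pt x
    exact ⟨l, 1, y, rfl, congrArg _ (Y.act_one l pt y)⟩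
  have := congrArg (fun s => repIf.fn (P := True) s star) (h' x x')
  rw [fn_charFn, fn_charFn, res_ptTo_pt, res_ptTo_pt] at this
  exact (decide_eq_decide.1 this).1 hx

end PiOne

namespace LichtenbaumTopos

variable {F : Type} [Field F] (L : LichtenbaumTopos.{u} F)

/-- By adjunction a map from `W` to the inverse image of `S` factors through the inverse image of
`t_! W`, which is final since `W` is connected over `T`. -/
theorem onSec_str_eq {U : EtSch F} (p : TPoint (L.str U)) {W : U.FinEt}
    (hW : W.obj.left.Connected) (S : T) (c : (L.cover U).obj W ⟶ (L.str U).obj S)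
    (x x' : L.Fibre p W) :
    onSec (p.inv.map c ≫ p.sec.hom.app S) x = onSec (p.inv.map c ≫ p.sec.hom.app S) x' := by
  let A := L.tSh.obj (L.et.obj W.obj.left)
  obtain ⟨hA⟩ := L.connected _ hW
  let adj : Over.forget (L.et.obj U) ⋙ L.tSh ⊣ L.str U := (Over.forgetAdjStar _).comp L.tAdj
  have h : c = adj.unit.app _ ≫ (L.str U).map ((adj.homEquiv _ _).symm c) :=
    ((adj.homEquiv _ _).apply_symm_apply c).symm.trans (adj.homEquiv_unit _ _ _)
  have h2 : p.inv.map ((L.str U).map ((adj.homEquiv _ _).symm c)) ≫ p.sec.hom.app S =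
    p.sec.hom.app _ ≫ (adj.homEquiv _ _).symm c := p.sec.hom.naturality _
  rw [h, p.inv.map_comp, Category.assoc, h2]
  simp only [onSec_comp]
  have := subsingleton_of_isTerminal hA pt
  exact congrArg _ (this.elim _ _)

end LichtenbaumTopos

end Lichtenbaum
namespace Lichtenbaum

open TopologicalSpace Topology EtSch

universe v' u'

/-- A morphism of pro-objects is given by a property of its components. -/
theorem Pro.exists_hom {C : Type u'} [Category.{v'} C] {X Y : Pro C}
    (P : ∀ (j : Y.I) (i : X.I), (X.F.obj i ⟶ Y.F.obj j) → Prop)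
    (hex : ∀ j, ∃ i h, P j i h) (hres : ∀ {j i k h} (s : k ⟶ i), P j i h → P j k (X.F.map s ≫ h))
    (hpush : ∀ {j j' i h} (s : j ⟶ j'), P j i h → P j' i (h ≫ Y.F.map s))
    (huniq : ∀ {j i h h'}, P j i h → P j i h' → h = h') :
    ∃ φ : X ⟶ Y, ∀ j i h, P j i h → φ.val j = To.mk i h := by
  choose i h hP using hex
  have key : ∀ {j i i' h h'}, P j i h → P j i' h' → (To.mk i h : X.To _) = To.mk i' h' := by
    intro j i i' h h' hh hh'
    obtain ⟨k, s, s', -⟩ := IsCofilteredOrEmpty.cone_objs i i'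
    rw [← To.mk_eq s, ← To.mk_eq s', huniq (hres s hh) (hres s' hh')]
  exact ⟨⟨fun j => To.mk (i j) (h j), fun {j k} s => key (hpush s (hP j)) (hP k)⟩,
    fun j i h hh => key (hP j) hh⟩

/-! ### The automorphism group of a fibre functor -/

section AutFib

variable {C : Type 1} [Category.{0} C] {q : C ⥤ Type 1}

namespace AutFib

theorem one_perm (V : C) (x : q.obj V) : (1 : AutFib q).perm V x = x := rfl

theorem mul_perm (σ τ : AutFib q) (V : C) (x : q.obj V) :
    (σ * τ).perm V x = σ.perm V (τ.perm V x) := rfl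

theorem inv_perm_perm (σ : AutFib q) (V : C) (x : q.obj V) : σ⁻¹.perm V (σ.perm V x) = x := by
  rw [← mul_perm, inv_mul_cancel, one_perm]

theorem perm_naturality (σ : AutFib q) {V W : C} (a : V ⟶ W) (x : q.obj V) :
    σ.perm W (q.map a x) = q.map a (σ.perm V x) :=
  ConcreteCategory.congr_hom ((Iso.hom σ).naturality a) x

/-- The automorphism given by a natural family of permutations. -/
def ofPerm (f f' : ∀ V, q.obj V → q.obj V) (h : ∀ V x, f' V (f V x) = x)
    (h' : ∀ V x, f V (f' V x) = x)
    (hn : ∀ {V W : C} (a : V ⟶ W) x, f W (q.map a x) = q.map a (f V x)) : AutFib q :=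
  NatIso.ofComponents (fun V => Equiv.toIso ⟨f V, f' V, h V, h' V⟩) fun a => by
    ext x
    exact hn a x

end AutFib

variable (q) in
/-- The automorphisms which act trivially on finitely many fibres. -/
def OpenNormal.ker (I : Set C) (hI : I.Finite) : OpenNormal q where
  N :=
    { carrier := {σ | ∀ V ∈ I, ∀ x, σ.perm V x = x}
      one_mem' := fun _ _ _ => rfl
      mul_mem' := fun {σ τ} hσ hτ V hV x => by rw [AutFib.mul_perm, hτ V hV, hσ V hV]
      inv_mem' := fun {σ} hσ V hV x => by
        conv_lhs => rw [← hσ V hV x]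
        exact σ.inv_perm_perm V x }
  normal := ⟨fun σ hσ τ V hV x => by
    rw [AutFib.mul_perm, AutFib.mul_perm, hσ V hV, ← AutFib.mul_perm, mul_inv_cancel,
      AutFib.one_perm]⟩
  isOpen := by
    have h : {σ : AutFib q | ∀ V ∈ I, ∀ x, σ.perm V x = x} =
        ⋂ V ∈ I, (fun σ : AutFib q => σ.perm V) ⁻¹' {id} := by
      ext σ
      simp [funext_iff]
    change IsOpen {σ : AutFib q | ∀ V ∈ I, ∀ x, σ.perm V x = x}
    rw [h]
    refine hI.isOpen_biInter fun V _ => ?_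
    exact iInf_le (fun V => TopologicalSpace.induced (fun σ : AutFib q => σ.perm V) ⊥) V _
      ⟨{id}, trivial, rfl⟩

theorem OpenNormal.mem_ker {I : Set C} {hI : I.Finite} {σ : AutFib q} :
    σ ∈ (OpenNormal.ker q I hI).N ↔ ∀ V ∈ I, ∀ x, σ.perm V x = x := Iff.rfl

/-- A neighbourhood of the identity in an infimum of induced topologies is controlled by finitely
many fibres. The kernels are therefore cofinal, and values of a morphism need only be determined
there. -/
theorem OpenNormal.exists_ker_le (N : OpenNormal q) :
    ∃ (I : Set C) (hI : I.Finite), OpenNormal.ker q I hI ≤ N := by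
  have h := N.isOpen.mem_nhds N.N.one_mem
  rw [nhds_iInf, Filter.mem_iInf] at h
  obtain ⟨I, hI, S, hS, h⟩ := h
  refine ⟨I, hI, fun σ hσ => ?_⟩
  change σ ∈ (N.N : Set (AutFib q))
  rw [h, Set.mem_iInter]
  intro V
  have hV := hS V
  rw [@nhds_induced _ _ ⊥, @nhds_discrete _ ⊥ (@DiscreteTopology.mk _ ⊥ rfl)] at hV
  obtain ⟨B, hB, hBS⟩ := hV
  refine hBS ?_
  have : σ.perm V.1 = (1 : AutFib q).perm V.1 := funext fun x => hσ V.1 V.2 x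
  change σ.perm V.1 ∈ B
  rw [this]
  exact hB

instance (N : OpenNormal q) : DiscreteTopology N.quot := ⟨rfl⟩

theorem OpenNormal.cls_eq {N : OpenNormal q} {σ τ : AutFib q} :
    N.cls q σ = N.cls q τ ↔ σ⁻¹ * τ ∈ N.N := QuotientGroup.eq

theorem OpenNormal.cls_surjective {N : OpenNormal q} (x : N.quot) : ∃ σ, N.cls q σ = x :=
  QuotientGroup.mk_surjective x

theorem OpenNormal.cls_mul {N : OpenNormal q} (σ τ : AutFib q) :
    N.cls q (σ * τ) = N.cls q σ * N.cls q τ := rfl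

theorem OpenNormal.cls_eq_of_le {N : OpenNormal q} {I : Set C} {hI : I.Finite}
    (h : OpenNormal.ker q I hI ≤ N) {σ τ : AutFib q} (e : ∀ V ∈ I, ∀ x, σ.perm V x = τ.perm V x) :
    N.cls q σ = N.cls q τ := by
  refine cls_eq.2 (h fun V hV x => ?_)
  rw [AutFib.mul_perm, ← e V hV, AutFib.inv_perm_perm]

theorem OpenNormal.perm_eq {N : OpenNormal q} {V : C} (hN : ∀ σ ∈ N.N, ∀ x, σ.perm V x = x)
    {σ τ : AutFib q} (h : N.cls q σ = N.cls q τ) (x : q.obj V) : σ.perm V x = τ.perm V x := by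
  have := hN _ (cls_eq.1 h) x
  conv_lhs => rw [← this]
  rw [← AutFib.mul_perm, mul_inv_cancel_left]

end AutFib

/-- An action of a pro-group on the fibres of a fibre functor. -/
structure FibAction (G : Pro LCGrp.{0}) {C : Type 1} [Category.{0} C] (q : C ⥤ Type 1) where
  A : ∀ (V : C) (l : G.I), G.F.obj l → q.obj V → q.obj V → Prop
  det : ∀ {V l g x x' x''}, A V l g x x' → A V l g x x'' → x' = x''
  trans : ∀ {V l k} (s : k ⟶ l) {g x x'}, A V l (LCGrp.hom (G.F.map s) g) x x' → A V k g x x'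
  mul : ∀ {V l g h x x' x''}, A V l g x x' → A V l h x' x'' → A V l (h * g) x x''
  inv : ∀ {V l g x x'}, A V l g x x' → A V l g⁻¹ x' x
  nat : ∀ {V W} (a : V ⟶ W) {l g x x'}, A V l g x x' → A W l g (q.map a x) (q.map a x')
  exists_act : ∀ V x, ∃ l, ∀ g, ∃ x', A V l g x x'
  isOpen : ∀ V l x, IsOpen {g | A V l g x x}

namespace FibAction

variable {G : Pro LCGrp.{0}} (hG : IsStrict G) {C : Type 1} [Category.{0} C] {q : C ⥤ Type 1}
  (𝒜 : FibAction G q)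

/-- The action is given by the morphism `φ`. -/
def Realizes (φ : (Pro.mapFunctor LCGrp.lift).obj G ⟶ etPiOne q) : Prop :=
  ∀ (V : C) (N : OpenNormal q), (∀ σ ∈ N.N, ∀ x, σ.perm V x = x) →
    ∀ (i : G.I) (h : LCGrp.lift.obj (G.F.obj i) ⟶ N.quot),
      φ.val N = Pro.To.mk (X := (Pro.mapFunctor LCGrp.lift).obj G) i h →
      ∀ (l : G.I) (s : l ⟶ i) (g : G.F.obj l) (x x' : q.obj V) (σ : AutFib q),
        LCGrp.hom h (ULift.up (LCGrp.hom (G.F.map s) g)) = N.cls _ σ → 𝒜.A V l g x x' →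
          x' = σ.perm V x

variable {𝒜}

theorem one {V l x x'} (h : 𝒜.A V l 1 x x') : 𝒜.A V l 1 x x := by
  have h1 := 𝒜.mul h (𝒜.inv h)
  rwa [inv_one, mul_one] at h1

theorem exists_le {I : Type 1} [Finite I] (V : I → C) (x : ∀ i, q.obj (V i)) (l₀ : G.I) :
    ∃ (l : G.I) (_ : l ⟶ l₀), ∀ i g, ∃ x', 𝒜.A (V i) l g (x i) x' := by
  classical
  have := Fintype.ofFinite I
  choose l hl using fun i => 𝒜.exists_act (V i) (x i)
  obtain ⟨k, hk⟩ := IsCofiltered.inf_objs_exists (insert l₀ (Finset.univ.image l))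
  refine ⟨k, (hk (Finset.mem_insert_self _ _)).some, fun i g => ?_⟩
  obtain ⟨s⟩ := hk (Finset.mem_insert_of_mem (Finset.mem_image_of_mem l (Finset.mem_univ i)))
  obtain ⟨x', hx'⟩ := hl i (LCGrp.hom (G.F.map s) g)
  exact ⟨x', 𝒜.trans s hx'⟩

include hG in
/-- The element `g` at level `l` lifts to an automorphism of the fibre functor. -/
theorem exists_aut [∀ V, Finite (q.obj V)] (l : G.I) (g : G.F.obj l) :
    ∃ σ : AutFib q, ∀ V x x', 𝒜.A V l g x x' → σ.perm V x = x' := by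
  -- The lifts of `g` are chosen independently at each level and need not be compatible; the limit
  -- below removes the choices.
  choose γ hγ using fun k : Over l => hG.surjective k.hom g
  let : Preorder (Over l) :=
    { le := fun a b => Nonempty (b ⟶ a)
      le_refl := fun a => ⟨𝟙 a⟩
      le_trans := fun a b c ⟨f⟩ ⟨g⟩ => ⟨g ≫ f⟩ }
  have : IsDirectedOrder (Over l) := ⟨fun a b =>
    ⟨IsCofiltered.min a b, ⟨IsCofiltered.minToLeft a b⟩, ⟨IsCofiltered.minToRight a b⟩⟩⟩
  have : Nonempty (Over l) := ⟨Over.mk (𝟙 l)⟩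
  -- For a point `x` of a finite fibre the translate of `x` by the lift at level `k` is defined for
  -- all fine `k` and takes finitely many values, so one value occurs for almost all `k`. Limits of
  -- the inverse lifts give the inverse automorphism.
  let 𝒰 : Ultrafilter (Over l) := Ultrafilter.of Filter.atTop
  have key : ∀ (δ : ∀ k : Over l, G.F.obj k.left) V (x : q.obj V),
      ∃ x', ∀ᶠ k in 𝒰, 𝒜.A V k.left (δ k) x x' := by
    intro δ V x
    obtain ⟨m, s, hm⟩ := 𝒜.exists_le (I := PUnit) (fun _ => V) (fun _ => x) l
    have h1 : ∀ᶠ k in 𝒰, ∃ x', 𝒜.A V k.left (δ k) x x' := by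
      refine (Ultrafilter.of_le _) ?_
      filter_upwards [Filter.eventually_ge_atTop (Over.mk s)] with k hk
      obtain ⟨a⟩ := hk
      obtain ⟨x', hx'⟩ := hm PUnit.unit (LCGrp.hom (G.F.map a.left) (δ k))
      exact ⟨x', 𝒜.trans a.left hx'⟩
    have h2 : (⋃ x' ∈ Set.univ, {k : Over l | 𝒜.A V k.left (δ k) x x'}) ∈ 𝒰 := by
      filter_upwards [h1] with k hk
      simpa using hk
    obtain ⟨x', -, h⟩ := (Ultrafilter.finite_biUnion_mem_iff Set.finite_univ).1 h2
    exact ⟨x', h⟩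
  choose f hf using key γ
  choose f' hf' using key fun k => (γ k)⁻¹
  let σ : AutFib q := AutFib.ofPerm f f' (fun V x => by
    obtain ⟨k, h, h'⟩ := ((hf V x).and (hf' V (f V x))).exists
    exact 𝒜.det h' (𝒜.inv h)) (fun V x => by
    obtain ⟨k, h, h'⟩ := ((hf' V x).and (hf V (f' V x))).exists
    have := 𝒜.inv h
    rw [inv_inv] at this
    exact 𝒜.det h' this) fun {V W} a x => by
    obtain ⟨k, h, h'⟩ := ((hf V x).and (hf W (q.map a x))).exists
    exact 𝒜.det h' (𝒜.nat a h)
  refine ⟨σ, fun V x x' h => ?_⟩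
  obtain ⟨k, hk⟩ := (hf V x).exists
  refine 𝒜.det hk (𝒜.trans k.hom ?_)
  rw [hγ]
  exact h

variable (𝒜) in
/-- The homomorphism `h` is compatible with the action. -/
def Good (N : OpenNormal q) (l : G.I) (h : LCGrp.lift.obj (G.F.obj l) ⟶ N.quot) : Prop :=
  ∀ (g : G.F.obj l) (σ : AutFib q), (∀ V x x', 𝒜.A V l g x x' → σ.perm V x = x') →
    LCGrp.hom h (ULift.up g) = N.cls q σ

-- `N` contains the kernel of the action on finitely many finite fibres. At a level acting on all
-- their points the class modulo `N` of an automorphism lifting `g` depends only on `g`; it is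
-- locally constant because the stabilizers are open.
include hG in
theorem exists_good [∀ V, Finite (q.obj V)] (N : OpenNormal q) : ∃ l h, 𝒜.Good N l h := by
  obtain ⟨I, hI, hN⟩ := N.exists_ker_le
  have := hI.to_subtype
  obtain ⟨l, -, hl⟩ := 𝒜.exists_le (I := Σ V : I, q.obj V.1) (fun i => i.1.1) (fun i => i.2)
    (IsCofiltered.nonempty (C := G.I)).some
  choose σ hσ using fun g => 𝒜.exists_aut hG l g
  have key : ∀ (g : G.F.obj l) τ, (∀ V x x', 𝒜.A V l g x x' → τ.perm V x = x') →
      N.cls q (σ g) = N.cls q τ := fun g τ hτ => by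
    refine OpenNormal.cls_eq_of_le hN fun V hV x => ?_
    obtain ⟨x', hx'⟩ := hl ⟨⟨V, hV⟩, x⟩ g
    rw [hσ g _ _ _ hx', hτ _ _ _ hx']
  let f : ULift.{1} (G.F.obj l) →* N.quot := MonoidHom.mk' (fun g => N.cls q (σ g.down)) (by
    rintro ⟨g⟩ ⟨g'⟩
    change N.cls q (σ (g * g')) = N.cls q (σ g) * N.cls q (σ g')
    rw [← OpenNormal.cls_mul]
    refine OpenNormal.cls_eq_of_le hN fun V hV x => ?_
    obtain ⟨x', hx'⟩ := hl ⟨⟨V, hV⟩, x⟩ g'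
    obtain ⟨x'', hx''⟩ := hl ⟨⟨V, hV⟩, x'⟩ g
    rw [AutFib.mul_perm, hσ _ _ _ _ hx', hσ _ _ _ _ hx'', hσ _ _ _ _ (𝒜.mul hx' hx'')])
  have hf : Continuous f := by
    refine continuous_of_continuousAt_one f ?_
    rw [ContinuousAt, nhds_discrete N.quot, Filter.tendsto_pure]
    have h1 : ∀ᶠ g : G.F.obj l in 𝓝 1, ∀ i : Σ V : I, q.obj V.1, 𝒜.A i.1.1 l g i.2 i.2 :=
      Filter.eventually_all.2 fun i => (𝒜.isOpen _ _ _).mem_nhds (one (hl i 1).choose_spec)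
    have h2 := (continuous_uliftDown (X := G.F.obj l)).tendsto 1 |>.eventually h1
    filter_upwards [h2] with g hg
    rw [map_one]
    refine OpenNormal.cls_eq_of_le hN (τ := 1) fun V hV x => ?_
    exact hσ _ _ _ _ (hg ⟨⟨V, hV⟩, x⟩)
  exact ⟨l, ({ f with continuous_toFun := hf } : ULift.{1} (G.F.obj l) →ₜ* N.quot), key⟩

include hG in
theorem exists_good_hom [∀ V, Finite (q.obj V)] :
    ∃ φ : (Pro.mapFunctor LCGrp.lift).obj G ⟶ etPiOne q, ∀ N l h, 𝒜.Good N l h →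
      φ.val N = Pro.To.mk (X := (Pro.mapFunctor LCGrp.lift).obj G) l h := by
  refine Pro.exists_hom (X := (Pro.mapFunctor LCGrp.lift).obj G) (Y := etPiOne q) 𝒜.Good
    (𝒜.exists_good hG) ?_ ?_ ?_
  · intro N l k h s hh g σ hσ
    exact hh _ σ fun V x x' hx => hσ V x x' (𝒜.trans s hx)
  · intro N N' l h s hh g σ hσ
    exact congrArg (LCGrp.hom ((etPiOne q).F.map s)) (hh g σ hσ)
  · intro N l h h' hh hh'
    apply LCGrp.hom_ext
    rintro ⟨g⟩
    obtain ⟨σ, hσ⟩ := 𝒜.exists_aut hG l g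
    exact (hh g σ hσ).trans (hh' g σ hσ).symm

end FibAction

end Lichtenbaum
namespace Lichtenbaum

open TopologicalSpace Topology EtSch

/-! ### Uniqueness and density for morphisms given by actions on fibres -/

namespace FibAction

variable {G : Pro LCGrp.{0}} (hG : IsStrict G) {C : Type 1} [Category.{0} C] {q : C ⥤ Type 1}
  {𝒜 : FibAction G q}

include hG in
theorem realizes_of_good [∀ V, Finite (q.obj V)]
    {φ : (Pro.mapFunctor LCGrp.lift).obj G ⟶ etPiOne q} (hφ : ∀ N l h, 𝒜.Good N l h →
      φ.val N = Pro.To.mk (X := (Pro.mapFunctor LCGrp.lift).obj G) l h) : 𝒜.Realizes φ := by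
  intro V N hN i h hi l s g x x' σ hσ hx
  obtain ⟨j, h', hh'⟩ := 𝒜.exists_good hG N
  have e := hi.symm.trans (hφ N j h' hh')
  obtain ⟨k, a, b, hab⟩ := Pro.To.mk_eq_mk_iff.1 e
  obtain ⟨k', c, d, hcd⟩ := IsCofiltered.cospan (C := G.I) s a
  obtain ⟨g', rfl⟩ := hG.surjective c g
  obtain ⟨τ, hτ⟩ := 𝒜.exists_aut hG k' g'
  have h1 := 𝒜.trans c hx
  rw [← hτ _ _ _ h1]
  refine OpenNormal.perm_eq hN ?_ x
  have h2 : LCGrp.hom h' (ULift.up (LCGrp.hom (G.F.map b) (LCGrp.hom (G.F.map d) g'))) =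
      N.cls q τ := hh' _ _ fun V x x' hx => hτ V x x' (𝒜.trans d (𝒜.trans b hx))
  refine h2.symm.trans (Eq.trans ?_ hσ)
  have h3 : LCGrp.hom (G.F.map a) (LCGrp.hom (G.F.map d) g') =
      LCGrp.hom (G.F.map s) (LCGrp.hom (G.F.map c) g') :=
    (LCGrp.map_comp_apply (G := G) d a g').symm.trans
      ((congrArg (fun t => LCGrp.hom (G.F.map t) g') hcd.symm).trans
        (LCGrp.map_comp_apply (G := G) c s g'))
  exact (DFunLike.congr_fun (congrArg LCGrp.hom hab)
    (ULift.up (LCGrp.hom (G.F.map d) g'))).symm.trans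
      (congrArg (fun z => LCGrp.hom h (ULift.up z)) h3)

/-- Modulo a kernel of finitely many fibres a class is determined by its action on them, and
`Realizes` prescribes this action once the level acts on all their points. -/
theorem Realizes.val_ker [∀ V, Finite (q.obj V)]
    {φ : (Pro.mapFunctor LCGrp.lift).obj G ⟶ etPiOne q} (h : 𝒜.Realizes φ) (I : Set C)
    (hI : I.Finite) : ∃ l f, 𝒜.Good (OpenNormal.ker q I hI) l f ∧
      φ.val (OpenNormal.ker q I hI) =
        Pro.To.mk (X := (Pro.mapFunctor LCGrp.lift).obj G) l f := by
  obtain ⟨i, f, hf⟩ := (φ.val (OpenNormal.ker q I hI)).exists_rep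
  have := hI.to_subtype
  obtain ⟨l, s, hl⟩ := 𝒜.exists_le (I := Σ V : I, q.obj V.1) (fun i => i.1.1) (fun i => i.2) i
  refine ⟨l, LCGrp.lift.map (G.F.map s) ≫ f, fun g σ hσ => ?_, ?_⟩
  · obtain ⟨τ, hτ⟩ := OpenNormal.cls_surjective (LCGrp.hom f (ULift.up (LCGrp.hom (G.F.map s) g)))
    refine hτ.symm.trans (OpenNormal.cls_eq_of_le le_rfl fun V hV x => ?_)
    obtain ⟨x', hx'⟩ := hl ⟨⟨V, hV⟩, x⟩ g
    rw [hσ V x x' hx']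
    exact (h V _ (fun σ hσ => OpenNormal.mem_ker.1 hσ V hV) i f hf l s g x x' τ hτ.symm hx').symm
  · rw [hf]
    exact (Pro.To.mk_eq (X := (Pro.mapFunctor LCGrp.lift).obj G) s f).symm

include hG in
theorem existsUnique_realizes [∀ V, Finite (q.obj V)] (𝒜 : FibAction G q) :
    ∃! φ : (Pro.mapFunctor LCGrp.lift).obj G ⟶ etPiOne q, 𝒜.Realizes φ := by
  obtain ⟨φ, hφ⟩ := 𝒜.exists_good_hom hG
  refine ⟨φ, realizes_of_good hG hφ, fun φ' h' => Pro.Hom.ext (funext fun (N : OpenNormal q) => ?_)⟩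
  obtain ⟨I, hI, hN⟩ := OpenNormal.exists_ker_le N
  obtain ⟨l, f, hf, e⟩ := h'.val_ker I hI
  let s : OpenNormal.ker q I hI ⟶ N := homOfLE hN
  exact (φ'.compat s).symm.trans ((congrArg (fun z => Pro.To.push z _)
    (e.trans (hφ _ _ _ hf).symm)).trans (φ.compat s))

include hG in
/-- A morphism given by an action has dense image if any finite family of points comes from a
single point on whose orbit the action is transitive. -/
theorem Realizes.hasDenseImage [∀ V, Finite (q.obj V)]
    {φ : (Pro.mapFunctor LCGrp.lift).obj G ⟶ etPiOne q} (h : 𝒜.Realizes φ)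
    (hd : ∀ {I : Type 1} [Finite I] (V : I → C) (x : ∀ i, q.obj (V i)),
      ∃ (W : C) (w : q.obj W), (∀ i, ∃ a : W ⟶ V i, q.map a w = x i) ∧
        ∀ w', ∃ l g, 𝒜.A W l g w w') : HasDenseImage φ := by
  intro (N : OpenNormal q) i f hf y
  obtain ⟨τ, rfl⟩ := OpenNormal.cls_surjective y
  obtain ⟨I, hI, hN⟩ := OpenNormal.exists_ker_le N
  obtain ⟨l, f', hf', e⟩ := h.val_ker I hI
  let r : OpenNormal.ker q I hI ⟶ N := homOfLE hN
  have := hI.to_subtype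
  obtain ⟨W, w, ha, hw⟩ := hd (I := Σ V : I, q.obj V.1) (fun i => i.1.1) (fun i => i.2)
  -- By transitivity some `g` moves `w` as `τ` does. All points of the fibres in `I` are images of
  -- `w`, so by naturality an automorphism lifting `g` agrees with `τ` on them, that is, modulo `N`.
  obtain ⟨j, g, hg⟩ := hw (τ.perm W w)
  have e' : Pro.To.mk (X := (Pro.mapFunctor LCGrp.lift).obj G) l (f' ≫ (etPiOne q).F.map (r)) =
      Pro.To.mk (X := (Pro.mapFunctor LCGrp.lift).obj G) i f := by
    exact ((congrArg (fun z => Pro.To.push z _) e).symm.trans (φ.compat r)).trans hf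
  obtain ⟨k, b, c, hbc⟩ := Pro.To.mk_eq_mk_iff.1 e'
  obtain ⟨m, s, s', -⟩ := IsCofilteredOrEmpty.cone_objs (C := G.I) j k
  obtain ⟨g', rfl⟩ := hG.surjective s g
  obtain ⟨σ, hσ⟩ := 𝒜.exists_aut hG m g'
  have h1 : LCGrp.hom f' (ULift.up (LCGrp.hom (G.F.map b) (LCGrp.hom (G.F.map s') g'))) =
      (OpenNormal.ker q I hI).cls q σ :=
    hf' _ _ fun V x x' hx => hσ V x x' (𝒜.trans s' (𝒜.trans b hx))
  have h2 : N.cls q σ = N.cls q τ := by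
    refine OpenNormal.cls_eq_of_le hN fun V hV x => ?_
    obtain ⟨a, hax⟩ : ∃ a : W ⟶ V, q.map a w = x := ha ⟨⟨V, hV⟩, x⟩
    rw [← hax, AutFib.perm_naturality,
      AutFib.perm_naturality, hσ _ _ _ (𝒜.trans s hg)]
  refine ⟨ULift.up (LCGrp.hom (G.F.map c) (LCGrp.hom (G.F.map s') g')), ?_⟩
  rw [← h2]
  exact (DFunLike.congr_fun (congrArg LCGrp.hom hbc)
    (ULift.up (LCGrp.hom (G.F.map s') g'))).symm.trans
      (congrArg (LCGrp.hom ((etPiOne q).F.map (r))) h1)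

end FibAction

namespace PiOne

variable {E : Type u} [Category.{1} E] {t : T ⥤ E} {p : TPoint t} {R : PiOne t p}

theorem acts_map {Y Y' : BObj R.G} {X X' : E} (e : R.obj Y ≅ X) (e' : R.obj Y' ≅ X')
    (a : X ⟶ X') {l : R.G.I} {g : R.G.F.obj l} {x x' : Sec (p.inv.obj X) pt}
    (h : Y.Acts l g (onSec (R.fibIso e).inv x) (onSec (R.fibIso e).inv x')) :
    Y'.Acts l g (onSec (R.fibIso e').inv (onSec (p.inv.map a) x))
      (onSec (R.fibIso e').inv (onSec (p.inv.map a) x')) := by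
  have h1 := h.nat (lift (e.hom ≫ a ≫ e'.inv))
  have h2 : (R.fibIso e).inv ≫ (BObj.forget R.G).map (lift (e.hom ≫ a ≫ e'.inv)) =
      p.inv.map a ≫ (R.fibIso e').inv := by
    rw [Iso.inv_comp_eq, ← Category.assoc (R.fibIso e).hom, Iso.eq_comp_inv, fibIso_naturality]
  rwa [← onSec_comp, ← onSec_comp, h2, onSec_comp, onSec_comp] at h1

theorem acts_iff {Y Y' : BObj R.G} {X : E} (e : R.obj Y ≅ X) (e' : R.obj Y' ≅ X)
    {l : R.G.I} {g : R.G.F.obj l} {x x' : Sec (p.inv.obj X) pt} :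
    Y.Acts l g (onSec (R.fibIso e).inv x) (onSec (R.fibIso e).inv x') ↔
      Y'.Acts l g (onSec (R.fibIso e').inv x) (onSec (R.fibIso e').inv x') := by
  have key : ∀ x : Sec (p.inv.obj X) pt, onSec (p.inv.map (𝟙 X)) x = x := fun x => by
    rw [p.inv.map_id, onSec_id]
  constructor
  · intro h
    have := acts_map e e' (𝟙 X) h
    rwa [key, key] at this
  · intro h
    have := acts_map e' e (𝟙 X) h
    rwa [key, key] at this

end PiOne

/-! ### Comparison with the étale fundamental group -/

namespace LichtenbaumTopos

variable {F : Type} [Field F] [NumberField F] (L : LichtenbaumTopos.{u} F) {U : EtSch F}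
  (hU : U.Connected) {p : TPoint (L.str U)} (R : PiOne (L.str U) p)

/-- The action of the fundamental group of `U_L` on the fibres of finite étale covers of `U`. -/
noncomputable def fibAction : FibAction R.G (L.fib p) where
  A V l g x x' := ∃ (Y : BObj R.G) (e : R.obj Y ≅ (L.cover U).obj V),
    Y.Acts l g (onSec (R.fibIso e).inv x) (onSec (R.fibIso e).inv x')
  det := fun ⟨Y, e, h⟩ ⟨Y', e', h'⟩ =>
    onSec_iso_injective (R.fibIso e).symm (h.det ((PiOne.acts_iff e e').2 h'))
  trans := fun s _ _ _ ⟨Y, e, h⟩ => ⟨Y, e, h.trans s⟩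
  mul := fun ⟨Y, e, h⟩ ⟨Y', e', h'⟩ => ⟨Y, e, h.mul ((PiOne.acts_iff e e').2 h')⟩
  inv := fun ⟨Y, e, h⟩ => ⟨Y, e, h.inv⟩
  nat {V W} a _ _ _ _ := fun ⟨Y, e, h⟩ => by
    obtain ⟨Y', ⟨e'⟩⟩ := R.exists_iso (L.slc_cover hU W)
    exact ⟨Y', e', PiOne.acts_map e e' ((L.cover U).map a) h⟩
  exists_act V x := by
    obtain ⟨Y, ⟨e⟩⟩ := R.exists_iso (L.slc_cover hU V)
    obtain ⟨l, y, hy⟩ := Y.exists_incl_pt (onSec (R.fibIso e).inv x)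
    refine ⟨l, fun g => ⟨onSec (R.fibIso e).hom (Y.incl l (Y.act l pt (.const _ g) y)), Y, e, ?_⟩⟩
    rw [← hy, ← onSec_comp, Iso.hom_inv_id, onSec_id]
    exact Y.acts_incl g y
  isOpen V l x := by
    obtain ⟨Y, ⟨e⟩⟩ := R.exists_iso (L.slc_cover hU V)
    have h1 : {g : R.G.F.obj l | ∃ (Y : BObj R.G) (e : R.obj Y ≅ (L.cover U).obj V),
        Y.Acts l g (onSec (R.fibIso e).inv x) (onSec (R.fibIso e).inv x)} =
        {g | Y.Acts l g (onSec (R.fibIso e).inv x) (onSec (R.fibIso e).inv x)} :=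
      Set.ext fun g => ⟨fun ⟨_, e', h⟩ => (PiOne.acts_iff e e').2 h, fun h => ⟨Y, e, h⟩⟩
    rw [h1]
    -- The set is an open stabilizer if `x` is defined at level `l`, and empty otherwise.
    by_cases hy : ∃ y, Y.incl l y = onSec (R.fibIso e).inv x
    · obtain ⟨y, hy⟩ := hy
      simp only [← hy, BObj.acts_self_iff]
      exact BObj.isOpen_stab y ((L.isFinConst_stalk p hU V).of_iso (R.fibIso e).symm)
    · convert isOpen_empty
      exact Set.eq_empty_of_forall_notMem fun g ⟨y, h, _⟩ => hy ⟨y, h⟩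

theorem inducesEt_iff (φ : (Pro.mapFunctor LCGrp.lift).obj R.G ⟶ etPiOne (L.fib p)) :
    L.InducesEt R φ ↔ (L.fibAction hU R).Realizes φ := by
  constructor
  · rintro H V N hN i h hi l s g x x' σ hσ ⟨Y, e, y, hy, hy'⟩
    have h1 := H V Y e N hN i h hi l s y g σ hσ
    change onSec (R.fibIso e).hom _ = σ.perm V (onSec (R.fibIso e).hom _) at h1
    have key : ∀ x : L.Fibre p V, onSec (R.fibIso e).hom (onSec (R.fibIso e).inv x) = x :=
      fun x => by rw [← onSec_comp, Iso.inv_hom_id, onSec_id]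
    rw [hy, hy'] at h1
    exact (key x').symm.trans (h1.trans (congrArg (σ.perm V) (key x)))
  · intro H V Y e θ N hN i h hi l s y g σ hσ
    refine H V N hN i h hi l s g _ _ σ hσ ⟨Y, e, ?_⟩
    change Y.Acts l g (onSec (R.fibIso e).inv (onSec (R.fibIso e).hom (Y.incl l y)))
      (onSec (R.fibIso e).inv (onSec (R.fibIso e).hom _))
    rw [← onSec_comp, ← onSec_comp, Iso.hom_inv_id, onSec_id, onSec_id]
    exact Y.acts_incl g y

include hU in
theorem existsUnique_inducesEt :
    ∃! φ : (Pro.mapFunctor LCGrp.lift).obj R.G ⟶ etPiOne (L.fib p), L.InducesEt R φ := by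
  have (V : U.FinEt) : Finite ((L.fib p).obj V) := L.finite_fibre p hU V
  simp only [L.inducesEt_iff hU R]
  exact FibAction.existsUnique_realizes R.strict _

include hU in
-- Finitely many points of fibres come from one point of a connected cover, on whose fibre the
-- action is transitive by `PiOne.exists_acts` and `onSec_str_eq`.
theorem hasDenseImage_of_inducesEt {φ : (Pro.mapFunctor LCGrp.lift).obj R.G ⟶ etPiOne (L.fib p)}
    (h : L.InducesEt R φ) : HasDenseImage φ := by
  have (V : U.FinEt) : Finite ((L.fib p).obj V) := L.finite_fibre p hU V
  refine ((L.inducesEt_iff hU R φ).1 h).hasDenseImage R.strict fun {I} _ V x => ?_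
  obtain ⟨n, ⟨ε⟩⟩ := Finite.exists_equiv_fin I
  obtain ⟨W, hW, w, a, ha⟩ := L.exists_connected_fibre_fin p hU (fun i => V (ε.symm i))
    fun i => x (ε.symm i)
  obtain ⟨Y, ⟨e⟩⟩ := R.exists_iso (L.slc_cover hU W)
  refine ⟨W, w, fun i => ?_, fun w' => ?_⟩
  · obtain ⟨j, rfl⟩ := ε.symm.surjective i
    exact ⟨a j, ha j⟩
  · obtain ⟨l, g, h⟩ := PiOne.exists_acts (fun S => L.slc_str U S) (L.onSec_str_eq p hW) e
      ((L.isFinConst_stalk p hU W).of_iso (R.fibIso e).symm) (onSec (R.fibIso e).inv w)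
      (onSec (R.fibIso e).inv w')
    exact ⟨l, g, Y, e, h⟩

end LichtenbaumTopos

end Lichtenbaum

/-! ### The theorem -/

theorem mainTheorem10 (F : Type) [Field F] [NumberField F] (L : LichtenbaumTopos.{u} F) :
    (∀ (U : EtSch F), U.Connected → ∀ (p : TPoint (L.str U)) (R : PiOne (L.str U) p),
      (∃! φ : (Pro.mapFunctor LCGrp.lift).obj R.G ⟶ etPiOne (L.fib p), L.InducesEt R φ) ∧
      ∀ φ : (Pro.mapFunctor LCGrp.lift).obj R.G ⟶ etPiOne (L.fib p), L.InducesEt R φ →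
        HasDenseImage φ) ∧
    (∀ (V U : EtSch F) (f : V ⟶ U), V.Connected → U.Connected → EtSch.IsFiniteEtale f →
      ∀ (p' : TPoint (L.str V)) (p : TPoint (L.str U)) (κ : p.inv ≅ L.pull f ⋙ p'.inv)
        (R' : PiOne (L.str V) p') (R : PiOne (L.str U) p),
      (∃! ψ : R'.G ⟶ R.G, R.Induces R' (L.pull f) κ ψ) ∧
      ∀ ψ : R'.G ⟶ R.G, R.Induces R' (L.pull f) κ ψ →
        (∃! tr : proAb.obj R.G ⟶ proAb.obj R'.G, IsTransfer ψ tr) ∧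
        (EtSch.IsGalois f →
          ∃! c : (proTop.obj R.G).prod (proTop.obj (proAb.obj R'.G)) ⟶
              proTop.obj (proAb.obj R'.G), IsConjugationAction ψ c)) := by
  refine ⟨fun U hU p R => ?_, fun V U f hV hU hf p' p κ R' R =>
    ⟨L.existsUnique_induces f κ R' R, fun ψ hψ => ?_⟩⟩
  · exact ⟨L.existsUnique_inducesEt hU R, fun φ => L.hasDenseImage_of_inducesEt hU R⟩
  · obtain ⟨P, hP⟩ := L.exists_finIndexPresentation hV hU hf κ R' R ψ hψ
    exact ⟨existsUnique_isTransfer P, fun hG => existsUnique_isConjugationAction P (hP hG)⟩
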